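/- **Theorem (ARV Structure Theorem).** For vectors $v_1,\dots,v_n\in\mathbb R^m$ ($n\ge 1$) write $V=\{1,\dots,n\}$, $d(i,j):=\|v_i-v_j\|_2^2$, $B(i,r):=\{j\in V: d(i,j)\le r\}$. Sets $L,R\subseteq V$ are called $\Delta$-separated if $d(i,j)\ge\Delta$ for all $i\in L$, $j\in R$. Assume (a) $\frac18\le\|v_i\|_2^2\le 2$ and $|B(i,\frac18)|\le\frac34 n$ for all $i\in V$. Algorithms are programs for a real RAM (unit-cost real arithmetic and comparisons, rational constants, integer address registers with addition and subtraction) that can draw independent $N(0,1)$ samples at unit cost; polynomial time means that for every outcome of the samples the number of steps is at most a fixed polynomial in $n+m$. 1. There are a polynomial-time randomized algorithm, constants $c,p>0$ and a function $\Delta$ with $\Delta(n)=\Theta(1/\sqrt{\log n})$ (with absolute constants, for all $n\ge2$) such that on every input satisfying (a) and the triangle inequalities $d(i,j)\le d(i,k)+d(k,j)$ for all $i,j,k\in V$, with probability at least $p$ the algorithm finds $\Delta(n)$-separated sets $L,R\subseteq V$ with $|L|,|R|\ge cn$. 2. If the triangle inequalities also hold with the origin as an additional point, that is, $\|v_i-v_j\|_2^2\le\|v_i-v_k\|_2^2+\|v_k-v_j\|_2^2$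 for all $i,j,k\in V\cup\{0\}$ where $v_0:=0$, then the following algorithm does this. There are constants $c',p>0$ and a function $\Delta(n)=\Theta(1/\sqrt{\log n})$ (in the same sense) such that on every input satisfying (a) and these inequalities, the procedure * draw a standard Gaussian $g\in\mathbb R^m$ and put $L:=\{i\in V:\langle v_i,g\rangle\le-1\}$, $R:=\{i\in V:\langle v_i,g\rangle\ge1\}$; * if $|L|\le c'n$ or $|R|\le c'n$, FAIL; * take an inclusion-wise maximal matching $M$ in $\{(i,j)\in L\times R: d(i,j)\le\Delta(n)\}$; if $|M|>\frac{c'}2n$, FAIL; * return the sets $L'\subseteq L$ and $R'\subseteq R$ of elements not covered by $M$ has the following properties. Whenever it does not fail, $|L'|,|R'|\ge\frac{c'}2n$ and $L',R'$ are $\Delta(n)$-separated. With probability at least $p$ over $g$ it does not fail, whatever maximal matching is chosen. For a suitable choice of the maximal matchings it is carried out by a polynomial-time program. -/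

import Mathlib

/-! ### A real RAM with Gaussian sampling and a unit-cost step count -/

namespace RealRAM

/-- A machine state: natural-number registers (used as counters and as addresses), a real memory,
and the number of random samples drawn so far. -/
structure State where
  reg : ℕ → ℕ
  mem : ℕ → ℝ
  drawn : ℕ

/-- Elementary instructions. `x y z` are names of registers. The real memory is addressed
indirectly: a real operand `x` is the memory cell whose address is stored in register `x`.
There is no multiplication of registers, no rounding of reals, and only rational constants. -/
inductive Instr where
  | setNat (x k : ℕ)
  | addNat (x y z : ℕ)
  | subNat (x y z : ℕ)
  | setReal (x : ℕ) (q : ℚ)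
  | ofNat (x y : ℕ)
  | copy (x y : ℕ)
  | add (x y z : ℕ)
  | sub (x y z : ℕ)
  | mul (x y z : ℕ)
  | div (x y z : ℕ)
  | sample (x : ℕ)

/-- Write `k` into register `x`. -/
def State.setReg (s : State) (x k : ℕ) : State :=
  { s with reg := Function.update s.reg x k }

/-- The real memory cell addressed by register `x`. -/
def State.cell (s : State) (x : ℕ) : ℝ := s.mem (s.reg x)

/-- Write `r` into the real memory cell addressed by register `x`. -/
def State.setCell (s : State) (x : ℕ) (r : ℝ) : State :=
  { s with mem := Function.update s.mem (s.reg x) r }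

/-- The effect of one instruction, when the random samples are `ω 0, ω 1, ω 2, …`.
The instruction `sample` reads the next unread sample. -/
noncomputable def Instr.apply (ω : ℕ → ℝ) (s : State) : Instr → State
  | .setNat x k => s.setReg x k
  | .addNat x y z => s.setReg x (s.reg y + s.reg z)
  | .subNat x y z => s.setReg x (s.reg y - s.reg z)
  | .setReal x q => s.setCell x (q : ℝ)
  | .ofNat x y => s.setCell x (s.reg y : ℝ)
  | .copy x y => s.setCell x (s.cell y)
  | .add x y z => s.setCell x (s.cell y + s.cell z)
  | .sub x y z => s.setCell x (s.cell y - s.cell z)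
  | .mul x y z => s.setCell x (s.cell y * s.cell z)
  | .div x y z => s.setCell x (s.cell y / s.cell z)
  | .sample x => { s.setCell x (ω s.drawn) with drawn := s.drawn + 1 }

/-- Tests: strict comparison of two registers, or comparison of two real memory cells. -/
inductive Test where
  | natLT (x y : ℕ)
  | realLE (x y : ℕ)

def Test.Holds (s : State) : Test → Prop
  | .natLT x y => s.reg x < s.reg y
  | .realLE x y => s.cell x ≤ s.cell y

/-- Programs. -/
inductive Program where
  | instr (i : Instr)
  | seq (p q : Program)
  | ite (b : Test) (p q : Program)
  | loop (b : Test) (p : Program)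

/-- `Exec ω p s t s'`: with the random samples `ω`, the program `p` started in state `s` halts in
state `s'` after exactly `t` steps; every instruction and every evaluation of a test is one step. -/
inductive Exec (ω : ℕ → ℝ) : Program → State → ℕ → State → Prop
  | instr (i : Instr) (s : State) : Exec ω (.instr i) s 1 (i.apply ω s)
  | seq {p q : Program} {s s' s'' : State} {t t' : ℕ} :
      Exec ω p s t s' → Exec ω q s' t' s'' → Exec ω (.seq p q) s (t + t') s''
  | ite_true {b : Test} {p q : Program} {s s' : State} {t : ℕ} :
      b.Holds s → Exec ω p s t s' → Exec ω (.ite b p q) s (t + 1) s'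
  | ite_false {b : Test} {p q : Program} {s s' : State} {t : ℕ} :
      ¬ b.Holds s → Exec ω q s t s' → Exec ω (.ite b p q) s (t + 1) s'
  | loop_done {b : Test} {p : Program} {s : State} :
      ¬ b.Holds s → Exec ω (.loop b p) s 1 s
  | loop_step {b : Test} {p : Program} {s s' s'' : State} {t t' : ℕ} :
      b.Holds s → Exec ω p s t s' → Exec ω (.loop b p) s' t' s'' →
      Exec ω (.loop b p) s (t + 1 + t') s''

/-- The initial state on input `v₀, …, vₙ₋₁ ∈ ℝᵐ`: registers `0` and `1` hold `n` and `m`, the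
coordinates are stored row by row in the first `n * m` memory cells, everything else is zero. -/
noncomputable def input {n m : ℕ} (v : Fin n → EuclideanSpace ℝ (Fin m)) : State where
  reg := fun x => if x = 0 then n else if x = 1 then m else 0
  mem := fun a =>
    if h : a < n * m then
      v (finProdFinEquiv.symm ⟨a, h⟩).1 (finProdFinEquiv.symm ⟨a, h⟩).2
    else 0
  drawn := 0

open Classical in
/-- The output read off a final state: FAIL (`none`) if register `2` is zero; otherwise the two
sets whose indicator vectors start at the addresses stored in registers `3` and `4`
(a nonzero entry means membership). -/
noncomputable def output (n : ℕ) (s : State) : Option (Finset (Fin n) × Finset (Fin n)) :=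
  if s.reg 2 = 0 then none
  else some
    (Finset.univ.filter fun i : Fin n => s.mem (s.reg 3 + i) ≠ 0,
     Finset.univ.filter fun i : Fin n => s.mem (s.reg 4 + i) ≠ 0)

/-- On input `v` and random samples `ω`, the program `P` halts after at most `T` steps
with output `o`. -/
def Outputs (P : Program) {n m : ℕ} (v : Fin n → EuclideanSpace ℝ (Fin m)) (ω : ℕ → ℝ) (T : ℕ)
    (o : Option (Finset (Fin n) × Finset (Fin n))) : Prop :=
  ∃ (t : ℕ) (s : State), Exec ω P (input v) t s ∧ t ≤ T ∧ output n s = o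

/-- The law of the random samples: independent standard Gaussians. -/
noncomputable def samples : MeasureTheory.Measure (ℕ → ℝ) :=
  MeasureTheory.Measure.infinitePi fun _ : ℕ => ProbabilityTheory.gaussianReal 0 1

end RealRAM

/-! ### Squared Euclidean distances and separated sets -/

namespace ARV

/-- `d(i, j) = ‖v i - v j‖²`. -/
noncomputable def sqDist {V : Type*} {m : ℕ} (v : V → EuclideanSpace ℝ (Fin m)) (i j : V) : ℝ :=
  ‖v i - v j‖ ^ 2

/-- The squared distances satisfy the triangle inequality. -/
def TriangleIneq {V : Type*} {m : ℕ} (v : V → EuclideanSpace ℝ (Fin m)) : Prop :=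
  ∀ i j k : V, sqDist v i j ≤ sqDist v i k + sqDist v k j

/-- The vectors `v` together with the origin, which gets the additional index `none`. -/
def withOrigin {V : Type*} {m : ℕ} (v : V → EuclideanSpace ℝ (Fin m)) :
    Option V → EuclideanSpace ℝ (Fin m)
  | none => 0
  | some i => v i

/-- `B(i, r) = {j | d(i, j) ≤ r}`. -/
noncomputable def ball {n m : ℕ} (v : Fin n → EuclideanSpace ℝ (Fin m)) (i : Fin n) (r : ℝ) :
    Finset (Fin n) :=
  Finset.univ.filter fun j => sqDist v i j ≤ r

/-- Norm bounds `1/8 ≤ ‖v i‖² ≤ 2`, and no ball `B(i, 1/8)` has more than `3n/4` points. -/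
def Spread {n m : ℕ} (v : Fin n → EuclideanSpace ℝ (Fin m)) : Prop :=
  (∀ i, 1 / 8 ≤ ‖v i‖ ^ 2 ∧ ‖v i‖ ^ 2 ≤ 2) ∧
    ∀ i, ((ball v i (1 / 8)).card : ℝ) ≤ 3 / 4 * n

/-- `d(L, R) ≥ Δ`. -/
def Separated {n m : ℕ} (v : Fin n → EuclideanSpace ℝ (Fin m)) (Δ : ℝ)
    (L R : Finset (Fin n)) : Prop :=
  ∀ i ∈ L, ∀ j ∈ R, Δ ≤ sqDist v i j

/-- `Δ(n) = Θ(1 / √(log n))`, uniformly over all `n ≥ 2`. -/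
def ThetaInvSqrtLog (Δ : ℕ → ℝ) : Prop :=
  ∃ a b : ℝ, 0 < a ∧ 0 < b ∧
    ∀ n : ℕ, 2 ≤ n → a / √(Real.log n) ≤ Δ n ∧ Δ n ≤ b / √(Real.log n)

/-! ### The well-separated sets algorithm -/

/-- `L = {i | ⟨v i, g⟩ ≤ -1}`. -/
noncomputable def leftSet {n m : ℕ} (v : Fin n → EuclideanSpace ℝ (Fin m))
    (g : EuclideanSpace ℝ (Fin m)) : Finset (Fin n) :=
  Finset.univ.filter fun i => inner ℝ (v i) g ≤ -1

/-- `R = {i | ⟨v i, g⟩ ≥ 1}`. -/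
noncomputable def rightSet {n m : ℕ} (v : Fin n → EuclideanSpace ℝ (Fin m))
    (g : EuclideanSpace ℝ (Fin m)) : Finset (Fin n) :=
  Finset.univ.filter fun i => 1 ≤ inner ℝ (v i) g

/-- `M` is a matching consisting of pairs `(i, j) ∈ L × R` with `d(i, j) ≤ Δ`
(for disjoint `L` and `R`). -/
def IsShortMatching {n m : ℕ} (v : Fin n → EuclideanSpace ℝ (Fin m)) (Δ : ℝ)
    (L R : Finset (Fin n)) (M : Finset (Fin n × Fin n)) : Prop :=
  (∀ e ∈ M, e.1 ∈ L ∧ e.2 ∈ R ∧ sqDist v e.1 e.2 ≤ Δ) ∧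
    ∀ e ∈ M, ∀ f ∈ M, e.1 = f.1 ∨ e.2 = f.2 → e = f

/-- The elements of `S` that are not covered by `M`. -/
def uncovered {n : ℕ} (M : Finset (Fin n × Fin n)) (S : Finset (Fin n)) : Finset (Fin n) :=
  S.filter fun i => ∀ e ∈ M, e.1 ≠ i ∧ e.2 ≠ i

/-- `AlgorithmResult c Δ v g o`: when the Gaussian vector drawn is `g`, the algorithm with
parameters `c` and `Δ` may return `o`. It fails if `|L| ≤ c n` or `|R| ≤ c n`; otherwise it takes
some inclusion-wise maximal matching `M` of `Δ`-short pairs in `L × R`, fails if `|M| > (c/2) n`,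
and else returns the uncovered parts of `L` and `R`. The only freedom is the choice of `M`. -/
inductive AlgorithmResult (c Δ : ℝ) {n m : ℕ} (v : Fin n → EuclideanSpace ℝ (Fin m))
    (g : EuclideanSpace ℝ (Fin m)) : Option (Finset (Fin n) × Finset (Fin n)) → Prop
  | small :
      ((leftSet v g).card : ℝ) ≤ c * n ∨ ((rightSet v g).card : ℝ) ≤ c * n →
      AlgorithmResult c Δ v g none
  | largeMatching (M : Finset (Fin n × Fin n)) :
      c * n < (leftSet v g).card → c * n < (rightSet v g).card →
      Maximal (IsShortMatching v Δ (leftSet v g) (rightSet v g)) M →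
      c / 2 * n < M.card →
      AlgorithmResult c Δ v g none
  | success (M : Finset (Fin n × Fin n)) :
      c * n < (leftSet v g).card → c * n < (rightSet v g).card →
      Maximal (IsShortMatching v Δ (leftSet v g) (rightSet v g)) M →
      (M.card : ℝ) ≤ c / 2 * n →
      AlgorithmResult c Δ v g
        (some (uncovered M (leftSet v g), uncovered M (rightSet v g)))

/-- The Gaussian vector in `ℝᵐ` made of the first `m` samples. -/
def gaussianVector (m : ℕ) (ω : ℕ → ℝ) : EuclideanSpace ℝ (Fin m) :=
  WithLp.toLp 2 fun k : Fin m => ω k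

end ARV

/-! ### Maxima of linear functionals under the standard Gaussian measure -/

namespace ARV

open MeasureTheory ProbabilityTheory Filter Topology

section MaxInner

variable {E : Type*} [NormedAddCommGroup E] [InnerProductSpace ℝ E]
variable {ι : Type*} {S : Finset ι}

/-! Cut the projections ⟨v_i, g⟩ at two levels at distance at least 1; this gives candidate sides L
and R. If both are large and the procedure still fails, the removed matching has linearly many
pairs, each Δ-short and yet stretched by at least 1 in direction g. So the core is
`exists_stretchSet_le`: for Δ ≤ κ / √(log n) with κ small, the directions admitting such a pairing
have small Gaussian measure.

This is proved by chaining. Let F_k(i, g) be the maximum of ⟨v_j - v_i, g⟩ over the points j within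
k short hops of i, and μ_k(i) its mean over g. A pair (i, j) stretched by σ gives F_{k+1}(i, g) ≥
F_k(j, g) + σ. By the triangle inequality for squared distances, k hops lead to Euclidean distance
at most √(kΔ), so F_k(i, ·) is a maximum of Gaussians of standard deviation at most √(kΔ) and
differs from μ_k(i) by O(√(kΔ)) on average (`integral_abs_maxInner_sub_integral_le`). Replace F_k by
μ_k and sum over the pairing: the remaining differences μ_k(j) - μ_k(i) cancel against those of the
reversed pairing in direction -g (`IsPairing.le_hopGain`). Hence, if the stretching directions had
measure at least q, then ∑_i μ_k(i) would grow by a constant multiple of n per step while kΔ is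
below a constant (`sum_hopMean_succ_ge`). After order 1/Δ steps the average of the μ_k(i) would be
of order 1/Δ = √(log n) / κ, whereas a maximum of n Gaussians of bounded variance has mean O(√(log
n)) (`hopMean_le`): a contradiction for small κ.

It remains to see that the sides are large with constant probability. A quarter of all pairs are far
apart. With the origin in the triangle inequalities, each far pair lands on opposite sides of ±1
with constant probability (`exists_prob_large_sides`). Without it, a far pair is still stretched by
1 with constant probability, and counting gives a cut at the projection of some input point
(`exists_prob_threshold`); the first algorithm tries all n of these cuts.

Finally, both procedures are written as real RAM programs, with greedy matching, and verified
together with their step counts. -/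

/-- The maximum of the linear functionals `⟨a j, ·⟩`, `j ∈ S`. -/
noncomputable def maxInner (hS : S.Nonempty) (a : ι → E) (x : E) : ℝ :=
  S.sup' hS fun j => inner ℝ (a j) x

variable (hS : S.Nonempty) (a : ι → E)

theorem exists_maxInner_eq (x : E) : ∃ j ∈ S, maxInner hS a x = inner ℝ (a j) x :=
  Finset.exists_mem_eq_sup' hS _

theorem inner_le_maxInner {j : ι} (hj : j ∈ S) (x : E) : inner ℝ (a j) x ≤ maxInner hS a x :=
  Finset.le_sup' (fun j => inner ℝ (a j) x) hj

theorem abs_maxInner_le (x : E) : |maxInner hS a x| ≤ ∑ j ∈ S, |inner ℝ (a j) x| := by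
  obtain ⟨j, hj, h⟩ := exists_maxInner_eq hS a x
  rw [h]
  exact Finset.single_le_sum (f := fun j => |(inner ℝ (a j) x : ℝ)|) (fun _ _ => abs_nonneg _) hj

end MaxInner

section Gaussian

variable {E : Type*} [NormedAddCommGroup E] [InnerProductSpace ℝ E] [FiniteDimensional ℝ E]
  [MeasurableSpace E] [BorelSpace E]

theorem map_inner_stdGaussian (a : E) :
    (stdGaussian E).map (fun x => inner ℝ a x) = gaussianReal 0 (‖a‖ ^ 2).toNNReal := by
  have h := IsGaussian.map_eq_gaussianReal (μ := stdGaussian E) (innerSL ℝ a)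
  rw [integral_strongDual_stdGaussian, variance_dual_stdGaussian, innerSL_apply_norm] at h
  exact h

theorem memLp_inner_stdGaussian (a : E) :
    MemLp (fun x : E => inner ℝ a x) 2 (stdGaussian E) :=
  IsGaussian.memLp_dual (stdGaussian E) (innerSL ℝ a) 2 (by norm_num)

theorem integrable_inner_stdGaussian (a : E) :
    Integrable (fun x : E => inner ℝ a x) (stdGaussian E) :=
  IsGaussian.integrable_dual (stdGaussian E) (innerSL ℝ a)

theorem integral_inner_stdGaussian (a : E) : ∫ x : E, inner ℝ a x ∂stdGaussian E = 0 :=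
  integral_strongDual_stdGaussian (innerSL ℝ a)

theorem variance_inner_stdGaussian (a : E) :
    Var[fun x : E => inner ℝ a x; stdGaussian E] = ‖a‖ ^ 2 := by
  have h := variance_dual_stdGaussian (E := E) (innerSL ℝ a)
  rwa [innerSL_apply_norm] at h

theorem integral_inner_sq_stdGaussian (a : E) :
    ∫ x : E, inner ℝ a x ^ 2 ∂stdGaussian E = ‖a‖ ^ 2 := by
  have h := variance_eq_sub (memLp_inner_stdGaussian a)
  rw [variance_inner_stdGaussian, integral_inner_stdGaussian] at h
  simpa using h.symm

/-- AM-GM, 2‖a‖|t| ≤ ‖a‖² + t², reduces the first absolute moment to the variance. -/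
theorem lintegral_abs_inner_stdGaussian_le (a : E) :
    ∫⁻ x : E, ENNReal.ofReal |inner ℝ a x| ∂stdGaussian E ≤ ENNReal.ofReal ‖a‖ := by
  rcases eq_or_ne a 0 with rfl | ha
  · simp
  have hs : 0 < ‖a‖ := norm_pos_iff.2 ha
  rw [← ofReal_integral_eq_lintegral_ofReal (integrable_inner_stdGaussian a).abs
    (ae_of_all _ fun _ => abs_nonneg _)]
  refine ENNReal.ofReal_le_ofReal ?_
  have hsq : Integrable (fun x : E => inner ℝ a x ^ 2) (stdGaussian E) :=
    (memLp_inner_stdGaussian a).integrable_sq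
  calc ∫ x : E, |inner ℝ a x| ∂stdGaussian E
      ≤ ∫ x : E, (‖a‖ + inner ℝ a x ^ 2 / ‖a‖) / 2 ∂stdGaussian E := by
        refine integral_mono (integrable_inner_stdGaussian a).abs
          (((integrable_const _).add (hsq.div_const _)).div_const _) fun x => ?_
        have h : 2 * ‖a‖ * |inner ℝ a x| ≤ ‖a‖ ^ 2 + inner ℝ a x ^ 2 := by
          nlinarith [sq_nonneg (‖a‖ - |inner ℝ a x|), sq_abs (inner ℝ a x : ℝ)]
        have h2 : (‖a‖ + inner ℝ a x ^ 2 / ‖a‖) / 2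
            = (‖a‖ ^ 2 + inner ℝ a x ^ 2) / (2 * ‖a‖) := by field_simp
        change |inner ℝ a x| ≤ (‖a‖ + inner ℝ a x ^ 2 / ‖a‖) / 2
        rw [h2, le_div_iff₀ (by positivity)]
        linarith
    _ = ‖a‖ := by
        rw [integral_div, integral_add (integrable_const _) (hsq.div_const _), integral_div,
          integral_inner_sq_stdGaussian]
        simp
        field_simp
        norm_num

theorem map_neg_stdGaussian : (stdGaussian E).map (fun x => -x) = stdGaussian E :=
  stdGaussian_map (LinearIsometryEquiv.neg ℝ)

theorem measurePreserving_rotation_stdGaussian (θ : ℝ) :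
    MeasurePreserving (ContinuousLinearMap.rotation (E := E) θ)
      ((stdGaussian E).prod (stdGaussian E)) ((stdGaussian E).prod (stdGaussian E)) :=
  ⟨by fun_prop, IsGaussian.map_rotation_eq_self (by simp) θ⟩

variable {ι : Type*} {S : Finset ι} (hS : S.Nonempty) (a : ι → E)

theorem measurable_maxInner : Measurable (maxInner hS a) := by
  have h : maxInner hS a = S.sup' hS fun j x => inner ℝ (a j) x := by
    ext x; simp [maxInner, Finset.sup'_apply]
  rw [h]
  exact Finset.measurable_sup' hS fun j _ => by fun_prop

theorem integrable_maxInner : Integrable (maxInner hS a) (stdGaussian E) := by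
  refine (integrable_finsetSum S fun j _ => (integrable_inner_stdGaussian (a j)).abs).mono'
    (measurable_maxInner hS a).aestronglyMeasurable (ae_of_all _ fun x => ?_)
  exact abs_maxInner_le hS a x

/-- The mean one-sided change of a function under rotation by the angle `θ`. -/
noncomputable def rotationDefect (f : E → ℝ) (θ : ℝ) : ENNReal :=
  ∫⁻ z : E × E, ENNReal.ofReal (f z.1 - f (Real.cos θ • z.1 + Real.sin θ • z.2))
    ∂(stdGaussian E).prod (stdGaussian E)

/-- A rotation by θ + δ is a rotation by δ after one by θ, the product measure is invariant under
the latter, and the positive part is subadditive. -/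
theorem rotationDefect_add_le {f : E → ℝ} (hf : Measurable f) (θ δ : ℝ) :
    rotationDefect f (θ + δ) ≤ rotationDefect f θ + rotationDefect f δ := by
  have h : rotationDefect f δ = ∫⁻ z : E × E,
      ENNReal.ofReal (f (Real.cos θ • z.1 + Real.sin θ • z.2)
        - f (Real.cos (θ + δ) • z.1 + Real.sin (θ + δ) • z.2))
      ∂(stdGaussian E).prod (stdGaussian E) := by
    rw [rotationDefect, ← (measurePreserving_rotation_stdGaussian (E := E) θ).lintegral_comp
      (by fun_prop)]
    refine lintegral_congr fun z => ?_
    congr 3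
    simp only [ContinuousLinearMap.rotation_apply, Real.cos_add, Real.sin_add]
    module
  rw [h, rotationDefect, rotationDefect, ← lintegral_add_left (by fun_prop)]
  refine lintegral_mono fun z => ?_
  refine le_trans (le_of_eq ?_) ENNReal.ofReal_add_le
  congr 1
  ring

theorem rotationDefect_nsmul_le {f : E → ℝ} (hf : Measurable f) (δ : ℝ) (N : ℕ) :
    rotationDefect f (N * δ) ≤ N * rotationDefect f δ := by
  induction N with
  | zero => simp [rotationDefect]
  | succ N ih =>
    push_cast
    rw [add_mul, add_mul, one_mul, one_mul]
    exact (rotationDefect_add_le hf _ _).trans (add_le_add_left ih _)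

/-- A maximizing index j at x still competes at the rotated point, so the loss is at most (1 - cos
δ) F(x) - sin δ ⟨a_j, y⟩. As j depends on x only, ⟨a_j, y⟩ is for fixed x a single Gaussian of
standard deviation at most σ, and the size of `S` does not enter. -/
theorem rotationDefect_maxInner_le {σ : ℝ} (hσ : ∀ j ∈ S, ‖a j‖ ≤ σ) {δ : ℝ}
    (hδ : 0 ≤ Real.sin δ) :
    rotationDefect (maxInner hS a) δ ≤
      ENNReal.ofReal (1 - Real.cos δ) * (∫⁻ x, ENNReal.ofReal |maxInner hS a x| ∂stdGaussian E)
        + ENNReal.ofReal (Real.sin δ) * ENNReal.ofReal σ := by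
  choose A hA hAx using exists_maxInner_eq hS a
  have hc : 0 ≤ 1 - Real.cos δ := by linarith [Real.cos_le_one δ]
  calc rotationDefect (maxInner hS a) δ
      ≤ ∫⁻ z : E × E, (ENNReal.ofReal (1 - Real.cos δ) * ENNReal.ofReal |maxInner hS a z.1|
          + ENNReal.ofReal (Real.sin δ) * ENNReal.ofReal |inner ℝ (a (A z.1)) z.2|)
          ∂(stdGaussian E).prod (stdGaussian E) := by
        refine lintegral_mono fun z => ?_
        have h1 := inner_le_maxInner hS a (hA z.1) (Real.cos δ • z.1 + Real.sin δ • z.2)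
        rw [inner_add_right, real_inner_smul_right, real_inner_smul_right, ← hAx] at h1
        rw [← ENNReal.ofReal_mul hc, ← ENNReal.ofReal_mul hδ]
        refine le_trans (ENNReal.ofReal_le_ofReal ?_) ENNReal.ofReal_add_le
        have h2 := mul_le_mul_of_nonneg_left (le_abs_self (maxInner hS a z.1)) hc
        have h3 := mul_le_mul_of_nonneg_left
          (neg_abs_le (inner ℝ (a (A z.1)) z.2 : ℝ)) hδ
        linarith
    -- The choice `A` of a maximizer need not be measurable; this direction of Tonelli's theorem
    -- holds for arbitrary functions.
    _ ≤ ∫⁻ x : E, ∫⁻ y : E, (ENNReal.ofReal (1 - Real.cos δ) * ENNReal.ofReal |maxInner hS a x|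
          + ENNReal.ofReal (Real.sin δ) * ENNReal.ofReal |inner ℝ (a (A x)) y|)
          ∂stdGaussian E ∂stdGaussian E := lintegral_prod_le _
    _ ≤ ∫⁻ x : E, (ENNReal.ofReal (1 - Real.cos δ) * ENNReal.ofReal |maxInner hS a x|
          + ENNReal.ofReal (Real.sin δ) * ENNReal.ofReal σ) ∂stdGaussian E := by
        refine lintegral_mono fun x => ?_
        change ∫⁻ y : E, (_ + _) ∂stdGaussian E ≤ _
        rw [lintegral_add_left (by fun_prop), lintegral_const, measure_univ, mul_one,
          lintegral_const_mul _ (by fun_prop)]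
        gcongr
        exact (lintegral_abs_inner_stdGaussian_le _).trans
          (ENNReal.ofReal_le_ofReal (hσ _ (hA x)))
    _ = _ := by
        have := measurable_maxInner hS a
        rw [lintegral_add_right _ (by fun_prop), lintegral_const, measure_univ, mul_one,
          lintegral_const_mul _ (by fun_prop)]

/-- Split the quarter turn from x to its independent copy into N equal rotations. The second-order
terms N(1 - cos δ) vanish as N → ∞, and the first-order terms add up to N sin δ ≤ π/2 ≤ 2. -/
theorem lintegral_sub_maxInner_le {σ : ℝ} (hσ : ∀ j ∈ S, ‖a j‖ ≤ σ) :
    ∫⁻ z : E × E, ENNReal.ofReal (maxInner hS a z.1 - maxInner hS a z.2)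
      ∂(stdGaussian E).prod (stdGaussian E) ≤ ENNReal.ofReal (2 * σ) := by
  have hσ0 : 0 ≤ σ := by
    obtain ⟨j, hj⟩ := hS
    exact (norm_nonneg _).trans (hσ j hj)
  set I : ℝ := ∫ x, |maxInner hS a x| ∂stdGaussian E with hI
  have hI0 : 0 ≤ I := integral_nonneg fun _ => abs_nonneg _
  have hIl : ∫⁻ x, ENNReal.ofReal |maxInner hS a x| ∂stdGaussian E = ENNReal.ofReal I :=
    (ofReal_integral_eq_lintegral_ofReal (integrable_maxInner hS a).abs
      (ae_of_all _ fun _ => abs_nonneg _)).symm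
  have hstart : ∫⁻ z : E × E, ENNReal.ofReal (maxInner hS a z.1 - maxInner hS a z.2)
      ∂(stdGaussian E).prod (stdGaussian E) = rotationDefect (maxInner hS a) (Real.pi / 2) := by
    simp [rotationDefect]
  have hN : ∀ N : ℕ, 0 < N → rotationDefect (maxInner hS a) (Real.pi / 2)
      ≤ ENNReal.ofReal (2 * I / N + 2 * σ) := by
    intro N hN
    have hN' : (1 : ℝ) ≤ N := by exact_mod_cast hN
    have hpi := Real.pi_pos
    have hpi4 := Real.pi_le_four
    set δ : ℝ := Real.pi / 2 / N with hδ
    have hδ0 : 0 ≤ δ := by positivity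
    have hδpi : δ ≤ Real.pi := by
      rw [hδ, div_le_iff₀ (by positivity)]
      nlinarith
    have hs := Real.sin_nonneg_of_nonneg_of_le_pi hδ0 hδpi
    have hNδ : N * δ = Real.pi / 2 := by rw [hδ]; field_simp
    rw [← hNδ]
    refine (rotationDefect_nsmul_le (measurable_maxInner hS a) δ N).trans ?_
    have hc : 0 ≤ 1 - Real.cos δ := by linarith [Real.cos_le_one δ]
    refine (mul_le_mul_right (rotationDefect_maxInner_le hS a hσ hs) _).trans ?_
    rw [hIl, ← ENNReal.ofReal_mul hc, ← ENNReal.ofReal_mul hs,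
      ← ENNReal.ofReal_add (by positivity) (by positivity), ← ENNReal.ofReal_natCast,
      ← ENNReal.ofReal_mul (by positivity)]
    refine ENNReal.ofReal_le_ofReal ?_
    have h1 : 1 - Real.cos δ ≤ δ ^ 2 / 2 := by linarith [@Real.one_sub_sq_div_two_le_cos δ]
    have h2 := Real.sin_le hδ0
    have h3 : N * (1 - Real.cos δ) ≤ 2 / N := by
      calc N * (1 - Real.cos δ) ≤ N * (δ ^ 2 / 2) := by gcongr
        _ = (N * δ) ^ 2 / 2 / N := by field_simp
        _ ≤ 2 / N := by
          rw [hNδ]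
          gcongr
          nlinarith
    have h4 : N * Real.sin δ ≤ 2 := by
      calc N * Real.sin δ ≤ N * δ := by gcongr
        _ ≤ 2 := by rw [hNδ]; linarith
    calc N * ((1 - Real.cos δ) * I + Real.sin δ * σ)
        = (N * (1 - Real.cos δ)) * I + (N * Real.sin δ) * σ := by ring
      _ ≤ 2 / N * I + 2 * σ := by gcongr
      _ = 2 * I / N + 2 * σ := by ring
  rw [hstart]
  have hlim : Tendsto (fun N : ℕ => ENNReal.ofReal (2 * I / N + 2 * σ)) atTop
      (𝓝 (ENNReal.ofReal (0 + 2 * σ))) :=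
    ENNReal.tendsto_ofReal ((tendsto_const_div_atTop_nhds_zero_nat (2 * I)).add_const _)
  rw [zero_add] at hlim
  refine ge_of_tendsto hlim ?_
  filter_upwards [eventually_gt_atTop 0] with N h using hN N h

/-- The maximum of Gaussians of standard deviation at most `σ` deviates from its mean by `O(σ)`
on average. -/
theorem integral_abs_maxInner_sub_integral_le {σ : ℝ} (hσ : ∀ j ∈ S, ‖a j‖ ≤ σ) :
    ∫ x, |maxInner hS a x - ∫ y, maxInner hS a y ∂stdGaussian E| ∂stdGaussian E ≤ 4 * σ := by
  set γ := stdGaussian E with hγ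
  set F := maxInner hS a with hF
  have hFi : Integrable F γ := integrable_maxInner hS a
  have h1 : Integrable (fun z : E × E => F z.1 - F z.2) (γ.prod γ) :=
    (hFi.comp_fst γ).sub (hFi.comp_snd γ)
  have hσ0 : 0 ≤ σ := by
    obtain ⟨j, hj⟩ := hS
    exact (norm_nonneg _).trans (hσ j hj)
  have hpos : ∫ z : E × E, max (F z.1 - F z.2) 0 ∂γ.prod γ ≤ 2 * σ := by
    have h := lintegral_sub_maxInner_le hS a hσ
    rw [integral_eq_lintegral_of_nonneg_ae (f := fun z : E × E => max (F z.1 - F z.2) 0)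
      (ae_of_all _ fun _ => le_max_right _ _) h1.pos_part.aestronglyMeasurable]
    refine ENNReal.toReal_le_of_le_ofReal (by positivity) (le_trans (le_of_eq ?_) h)
    refine lintegral_congr fun z => ?_
    rw [ENNReal.ofReal_max]
    simp [hF]
  have habs : ∫ z : E × E, |F z.1 - F z.2| ∂γ.prod γ ≤ 4 * σ := by
    have hsw : ∫ z : E × E, max (F z.2 - F z.1) 0 ∂γ.prod γ
        = ∫ z : E × E, max (F z.1 - F z.2) 0 ∂γ.prod γ :=
      integral_prod_swap (μ := γ) (ν := γ) (fun z : E × E => max (F z.1 - F z.2) 0)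
    have h2 : Integrable (fun z : E × E => F z.2 - F z.1) (γ.prod γ) :=
      (hFi.comp_snd γ).sub (hFi.comp_fst γ)
    have : ∫ z : E × E, |F z.1 - F z.2| ∂γ.prod γ
        = ∫ z : E × E, (max (F z.1 - F z.2) 0 + max (F z.2 - F z.1) 0) ∂γ.prod γ := by
      refine integral_congr_ae (ae_of_all _ fun z => ?_)
      rcases le_total (F z.1) (F z.2) with h | h
      · simp [abs_of_nonpos (sub_nonpos.2 h), h]
      · simp [abs_of_nonneg (sub_nonneg.2 h), h]
    rw [this, integral_add h1.pos_part h2.pos_part, hsw]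
    linarith
  -- Jensen: the mean of F is its average over the independent copy.
  refine le_trans ?_ habs
  rw [integral_prod _ h1.abs]
  refine integral_mono (hFi.sub (integrable_const _)).abs h1.abs.integral_prod_left fun x => ?_
  have : F x - ∫ y, F y ∂γ = ∫ y, (F x - F y) ∂γ := by
    rw [integral_sub (integrable_const _) hFi]; simp
  change |F x - ∫ y, F y ∂γ| ≤ _
  rw [this]
  exact abs_integral_le_integral_abs

theorem integrable_exp_inner_stdGaussian (b : E) (t : ℝ) :
    Integrable (fun x : E => Real.exp (t * inner ℝ b x)) (stdGaussian E) := by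
  have h := integrable_exp_mul_gaussianReal (μ := 0) (v := (‖b‖ ^ 2).toNNReal) t
  rw [← map_inner_stdGaussian b] at h
  exact h.comp_measurable (by fun_prop)

theorem integral_exp_inner_stdGaussian (b : E) (t : ℝ) :
    ∫ x : E, Real.exp (t * inner ℝ b x) ∂stdGaussian E = Real.exp (‖b‖ ^ 2 * t ^ 2 / 2) := by
  have h := mgf_gaussianReal (map_inner_stdGaussian b) t
  rw [mgf] at h
  rw [h]
  simp

/-- Since z ≤ e^z, the maximum exceeds u by at most ∑_j exp(t(⟨a_j, x⟩ - u)) / t; the level u is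
chosen so that each exponential has mean at most 1/N. The free parameter t will be √(log N). -/
theorem integral_maxInner_le {σ : ℝ} (hσ : ∀ j ∈ S, ‖a j‖ ≤ σ) {t N : ℝ} (ht : 0 < t)
    (hN : 0 < N) (hSN : (S.card : ℝ) ≤ N) :
    ∫ x, maxInner hS a x ∂stdGaussian E ≤ (Real.log N + 1) / t + t * σ ^ 2 / 2 := by
  set u : ℝ := Real.log N / t + t * σ ^ 2 / 2 with hu
  have hexp : ∀ j, Integrable (fun x : E => Real.exp (t * inner ℝ (a j) x) * Real.exp (-(t * u)))
      (stdGaussian E) := fun j => (integrable_exp_inner_stdGaussian (a j) t).mul_const _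
  calc ∫ x, maxInner hS a x ∂stdGaussian E
      ≤ ∫ x, (u + (∑ j ∈ S, Real.exp (t * inner ℝ (a j) x) * Real.exp (-(t * u))) / t)
          ∂stdGaussian E := by
        refine integral_mono (integrable_maxInner hS a)
          ((integrable_const _).add ((integrable_finsetSum S fun j _ => hexp j).div_const _))
          fun x => ?_
        obtain ⟨j, hj, h⟩ := exists_maxInner_eq hS a x
        have h1 : Real.exp (t * inner ℝ (a j) x) * Real.exp (-(t * u))
            ≤ ∑ j ∈ S, Real.exp (t * inner ℝ (a j) x) * Real.exp (-(t * u)) :=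
          Finset.single_le_sum (f := fun j => Real.exp (t * inner ℝ (a j) x) *
            Real.exp (-(t * u))) (fun _ _ => by positivity) hj
        rw [← Real.exp_add] at h1
        have h2 := Real.add_one_le_exp (t * inner ℝ (a j) x + -(t * u))
        change maxInner hS a x ≤ u + _
        rw [h, ← sub_le_iff_le_add', le_div_iff₀ ht]
        linarith
    _ = u + (∑ j ∈ S, Real.exp (‖a j‖ ^ 2 * t ^ 2 / 2) * Real.exp (-(t * u))) / t := by
        rw [integral_add (integrable_const _)
          ((integrable_finsetSum S fun j _ => hexp j).div_const _), integral_div,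
          integral_finsetSum _ fun j _ => hexp j]
        simp_rw [integral_mul_const, integral_exp_inner_stdGaussian]
        simp
    _ ≤ u + 1 / t := by
        gcongr
        have hj : ∀ j ∈ S, Real.exp (‖a j‖ ^ 2 * t ^ 2 / 2) * Real.exp (-(t * u)) ≤ N⁻¹ := by
          intro j hj
          rw [← Real.exp_add, ← Real.exp_log (inv_pos.2 hN), Real.log_inv]
          refine Real.exp_le_exp.2 ?_
          have h1 : ‖a j‖ ^ 2 ≤ σ ^ 2 := pow_le_pow_left₀ (norm_nonneg _) (hσ j hj) 2
          have h2 : t * u = Real.log N + σ ^ 2 * t ^ 2 / 2 := by rw [hu]; field_simp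
          rw [h2]
          nlinarith [sq_nonneg t]
        calc _ ≤ ∑ j ∈ S, N⁻¹ := Finset.sum_le_sum hj
          _ = S.card * N⁻¹ := by simp
          _ ≤ N * N⁻¹ := by gcongr
          _ = 1 := mul_inv_cancel₀ hN.ne'
    _ = _ := by rw [hu]; ring

end Gaussian

end ARV

/-! ### Chaining along short edges -/

namespace ARV

open MeasureTheory ProbabilityTheory

/-- `M` consists of pairwise disjoint pairs. -/
def IsPairing {V : Type*} (M : Finset (V × V)) : Prop :=
  (∀ e ∈ M, ∀ f ∈ M, e.1 = f.1 ∨ e.2 = f.2 → e = f) ∧ ∀ e ∈ M, ∀ f ∈ M, e.1 ≠ f.2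

theorem IsPairing.empty {V : Type*} : IsPairing (∅ : Finset (V × V)) := by
  simp [IsPairing]

/-- Exchanging F for μ at both ends of a pair costs the deviations |F - μ| there. As the pairs are
disjoint, each index contributes at most one gain, and at most one deviation counting both
coordinates. -/
theorem IsPairing.sum_le_sum {V : Type*} [Fintype V] {M : Finset (V × V)} (hM : IsPairing M)
    {F F' μ : V → ℝ} {σ : ℝ} (hF : ∀ i, F i ≤ F' i) (he : ∀ e ∈ M, F e.2 + σ ≤ F' e.1) :
    σ * M.card + ∑ e ∈ M, (μ e.2 - μ e.1) ≤ ∑ i, (F' i - F i) + ∑ i, |F i - μ i| := by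
  classical
  have h1 : Set.InjOn Prod.fst (M : Set (V × V)) := fun e he f hf h => hM.1 e he f hf (.inl h)
  have h2 : Set.InjOn Prod.snd (M : Set (V × V)) := fun e he f hf h => hM.1 e he f hf (.inr h)
  have hgain : ∑ e ∈ M, (F' e.1 - F e.1) ≤ ∑ i, (F' i - F i) := by
    rw [← Finset.sum_image (f := fun i => F' i - F i) h1]
    exact Finset.sum_le_sum_of_subset_of_nonneg (Finset.subset_univ _)
      fun i _ _ => sub_nonneg.2 (hF i)
  have hdev : ∑ e ∈ M, |F e.1 - μ e.1| + ∑ e ∈ M, |F e.2 - μ e.2| ≤ ∑ i, |F i - μ i| := by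
    rw [← Finset.sum_image (f := fun i => |F i - μ i|) h1,
      ← Finset.sum_image (f := fun i => |F i - μ i|) h2, ← Finset.sum_union]
    · exact Finset.sum_le_sum_of_subset_of_nonneg (Finset.subset_univ _)
        fun i _ _ => abs_nonneg _
    · rw [Finset.disjoint_left]
      intro i hi hi'
      obtain ⟨e, he, rfl⟩ := Finset.mem_image.1 hi
      obtain ⟨f, hf, h⟩ := Finset.mem_image.1 hi'
      exact hM.2 e he f hf h.symm
  have hsum : ∑ e ∈ M, (σ + (μ e.2 - μ e.1)) ≤
      ∑ e ∈ M, ((F' e.1 - F e.1) + (|F e.1 - μ e.1| + |F e.2 - μ e.2|)) := by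
    refine Finset.sum_le_sum fun e h => ?_
    have := he e h
    have := le_abs_self (F e.1 - μ e.1)
    have := neg_abs_le (F e.2 - μ e.2)
    linarith
  rw [Finset.sum_add_distrib, Finset.sum_add_distrib, Finset.sum_add_distrib, Finset.sum_const,
    nsmul_eq_mul] at hsum
  linarith

theorem IsPairing.swap {V : Type*} [DecidableEq V] {M : Finset (V × V)} (hM : IsPairing M) :
    IsPairing (M.image Prod.swap) := by
  simp only [IsPairing, Finset.mem_image, Prod.exists, forall_exists_index, and_imp]
  constructor
  · rintro e a b hab rfl f c d hcd rfl h
    rw [hM.1 _ hab _ hcd h.symm]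
  · rintro e a b hab rfl f c d hcd rfl h
    exact hM.2 _ hcd _ hab h.symm

section Hops

variable {V : Type*} {m : ℕ} (v : V → EuclideanSpace ℝ (Fin m)) (Δ : ℝ)

theorem sqDist_self (i : V) : sqDist v i i = 0 := by simp [sqDist]

theorem sqDist_nonneg (i j : V) : 0 ≤ sqDist v i j := by unfold sqDist; positivity

theorem sqDist_comm (i j : V) : sqDist v i j = sqDist v j i := by
  simp [sqDist, norm_sub_rev]

variable [Fintype V]

open Classical in
/-- The points reachable from `i` in at most `k` steps of squared length at most `Δ`. -/
noncomputable def hops : ℕ → V → Finset V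
  | 0, i => {i}
  | k + 1, i => Finset.univ.filter fun j => ∃ l, sqDist v i l ≤ Δ ∧ j ∈ hops k l

variable {v Δ}

theorem mem_hops_succ {k : ℕ} {i j l : V} (h : sqDist v i l ≤ Δ) (hj : j ∈ hops v Δ k l) :
    j ∈ hops v Δ (k + 1) i := by
  simp only [hops, Finset.mem_filter, Finset.mem_univ, true_and]
  exact ⟨l, h, hj⟩

theorem sqDist_le_of_mem_hops (hv : TriangleIneq v) {k : ℕ} {i j : V} (h : j ∈ hops v Δ k i) :
    sqDist v i j ≤ k * Δ := by
  induction k generalizing i with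
  | zero =>
    simp only [hops, Finset.mem_singleton] at h
    simp [h, sqDist_self]
  | succ k ih =>
    simp only [hops, Finset.mem_filter, Finset.mem_univ, true_and] at h
    obtain ⟨l, h1, h2⟩ := h
    have := hv i j l
    have := ih h2
    push_cast
    linarith

theorem self_mem_hops (hΔ : 0 ≤ Δ) (k : ℕ) (i : V) : i ∈ hops v Δ k i := by
  induction k with
  | zero => simp [hops]
  | succ k ih => exact mem_hops_succ (by rwa [sqDist_self]) ih

variable (v) in
/-- The largest displacement in direction `g` within `k` hops from `i`. -/
noncomputable def hopMax (hΔ : 0 ≤ Δ) (k : ℕ) (i : V) (g : EuclideanSpace ℝ (Fin m)) : ℝ :=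
  maxInner ⟨i, self_mem_hops (v := v) hΔ k i⟩ (fun j => v j - v i) g

/-- The best point for l within k hops competes for i within k + 1 hops; this is why `hops` prepends
its steps. -/
theorem hopMax_add_le (hΔ : 0 ≤ Δ) {k : ℕ} {i l : V} (h : sqDist v i l ≤ Δ)
    (g : EuclideanSpace ℝ (Fin m)) :
    hopMax v hΔ k l g + inner ℝ (v l - v i) g ≤ hopMax v hΔ (k + 1) i g := by
  obtain ⟨j, hj, hm⟩ := exists_maxInner_eq ⟨l, self_mem_hops (v := v) hΔ k l⟩
    (fun j => v j - v l) g
  rw [hopMax, hm, ← inner_add_left, sub_add_sub_cancel]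
  exact inner_le_maxInner _ (fun j => v j - v i) (mem_hops_succ h hj) g

theorem hopMax_le_succ (hΔ : 0 ≤ Δ) (k : ℕ) (i : V) (g : EuclideanSpace ℝ (Fin m)) :
    hopMax v hΔ k i g ≤ hopMax v hΔ (k + 1) i g := by
  simpa using hopMax_add_le hΔ (k := k) (i := i) (l := i) (by rwa [sqDist_self]) g

/-- It is the squared lengths that add up: k hops cover a distance √(kΔ) instead of k√Δ, which keeps
the fluctuations small over order 1/Δ steps. -/
theorem norm_sub_le_of_mem_hops (hv : TriangleIneq v) {k : ℕ} {i j : V}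
    (h : j ∈ hops v Δ k i) : ‖v j - v i‖ ≤ √(k * Δ) := by
  refine Real.le_sqrt_of_sq_le ?_
  rw [norm_sub_rev]
  exact sqDist_le_of_mem_hops hv h

/-- The mean of `hopMax`. -/
noncomputable def hopMean (v : V → EuclideanSpace ℝ (Fin m)) {Δ : ℝ} (hΔ : 0 ≤ Δ) (k : ℕ)
    (i : V) : ℝ :=
  ∫ g, hopMax v hΔ k i g ∂stdGaussian (EuclideanSpace ℝ (Fin m))

theorem integrable_hopMax (hΔ : 0 ≤ Δ) (k : ℕ) (i : V) :
    Integrable (hopMax v hΔ k i) (stdGaussian (EuclideanSpace ℝ (Fin m))) :=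
  integrable_maxInner _ _

theorem integral_abs_hopMax_sub_le (hv : TriangleIneq v) (hΔ : 0 ≤ Δ) (k : ℕ) (i : V) :
    ∫ g, |hopMax v hΔ k i g - hopMean v hΔ k i| ∂stdGaussian (EuclideanSpace ℝ (Fin m))
      ≤ 4 * √(k * Δ) :=
  integral_abs_maxInner_sub_integral_le _ _ fun _ hj => norm_sub_le_of_mem_hops hv hj

theorem hopMean_le (hv : TriangleIneq v) (hΔ : 0 ≤ Δ) (k : ℕ) (i : V) {t : ℝ} (ht : 0 < t) :
    hopMean v hΔ k i ≤ (Real.log (Fintype.card V) + 1) / t + t * (k * Δ) / 2 := by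
  have hV : 0 < Fintype.card V := Fintype.card_pos_iff.2 ⟨i⟩
  have h := integral_maxInner_le (σ := √(k * Δ)) ⟨i, self_mem_hops (v := v) hΔ k i⟩
    (fun j => v j - v i) (fun _ hj => norm_sub_le_of_mem_hops hv hj) (N := Fintype.card V) ht
    (by exact_mod_cast hV) (by exact_mod_cast Finset.card_le_univ _)
  rwa [Real.sq_sqrt (by positivity)] at h

/-- One-step growth of `hopMax`, together with its deviation from the mean. -/
noncomputable def hopGain (v : V → EuclideanSpace ℝ (Fin m)) {Δ : ℝ} (hΔ : 0 ≤ Δ) (k : ℕ)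
    (g : EuclideanSpace ℝ (Fin m)) : ℝ :=
  ∑ i, (hopMax v hΔ (k + 1) i g - hopMax v hΔ k i g)
    + ∑ i, |hopMax v hΔ k i g - hopMean v hΔ k i|

/-- The directions in which there is a pairing of more than `c * |V|` pairs of squared length at
most `Δ`, each of which is stretched by at least `σ`. -/
def stretchSet (v : V → EuclideanSpace ℝ (Fin m)) (Δ σ c : ℝ) : Set (EuclideanSpace ℝ (Fin m)) :=
  {g | ∃ M : Finset (V × V), IsPairing M ∧
    (∀ e ∈ M, sqDist v e.1 e.2 ≤ Δ ∧ σ ≤ inner ℝ (v e.2 - v e.1) g) ∧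
    c * Fintype.card V < M.card}

/-- The pairing in direction g and its reversal in direction -g are both stretched by σ. In the sum
of the two estimates the differences of `hopMean` cancel, so the means at individual points need no
control. -/
theorem IsPairing.le_hopGain {M : Finset (V × V)} (hM : IsPairing M) (hΔ : 0 ≤ Δ) (k : ℕ) {σ : ℝ}
    {g : EuclideanSpace ℝ (Fin m)}
    (h : ∀ e ∈ M, sqDist v e.1 e.2 ≤ Δ ∧ σ ≤ inner ℝ (v e.2 - v e.1) g) :
    2 * σ * M.card ≤ hopGain v hΔ k g + hopGain v hΔ k (-g) := by
  classical
  have h1 := hM.sum_le_sum (σ := σ) (μ := hopMean v hΔ k) (fun i => hopMax_le_succ hΔ k i g)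
    (fun e he => by
      have := hopMax_add_le hΔ (k := k) (h e he).1 g
      linarith [(h e he).2])
  have h2 := hM.swap.sum_le_sum (σ := σ) (μ := hopMean v hΔ k)
    (fun i => hopMax_le_succ hΔ k i (-g)) (fun e he => by
      obtain ⟨f, hf, rfl⟩ := Finset.mem_image.1 he
      have h3 := hopMax_add_le hΔ (k := k) (i := f.2) (l := f.1)
        (by rw [sqDist_comm]; exact (h f hf).1) (-g)
      have h4 := (h f hf).2
      rw [inner_neg_right, ← inner_neg_left, neg_sub] at h3
      simp only [Prod.fst_swap, Prod.snd_swap]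
      linarith)
  rw [Finset.card_image_of_injective _ Prod.swap_injective,
    Finset.sum_image Prod.swap_injective.injOn] at h2
  simp only [Prod.fst_swap, Prod.snd_swap] at h2
  have h5 : ∑ e ∈ M, (hopMean v hΔ k e.1 - hopMean v hΔ k e.2)
      = -∑ e ∈ M, (hopMean v hΔ k e.2 - hopMean v hΔ k e.1) := by
    rw [← Finset.sum_neg_distrib]
    exact Finset.sum_congr rfl fun _ _ => by ring
  rw [h5] at h2
  unfold hopGain
  linarith

theorem integrable_hopGain (hΔ : 0 ≤ Δ) (k : ℕ) :
    Integrable (hopGain v hΔ k) (stdGaussian (EuclideanSpace ℝ (Fin m))) :=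
  (integrable_finsetSum _ fun i _ => (integrable_hopMax hΔ (k + 1) i).sub
    (integrable_hopMax hΔ k i)).add (integrable_finsetSum _ fun i _ =>
      ((integrable_hopMax hΔ k i).sub (integrable_const _)).abs)

theorem integral_hopGain_le (hv : TriangleIneq v) (hΔ : 0 ≤ Δ) (k : ℕ) :
    ∫ g, hopGain v hΔ k g ∂stdGaussian (EuclideanSpace ℝ (Fin m)) ≤
      ∑ i, hopMean v hΔ (k + 1) i - ∑ i, hopMean v hΔ k i
        + Fintype.card V * (4 * √(k * Δ)) := by
  have hi1 : ∀ i, Integrable (fun g => hopMax v hΔ (k + 1) i g - hopMax v hΔ k i g)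
      (stdGaussian (EuclideanSpace ℝ (Fin m))) := fun i =>
    (integrable_hopMax hΔ (k + 1) i).sub (integrable_hopMax hΔ k i)
  have hi2 : ∀ i, Integrable (fun g => |hopMax v hΔ k i g - hopMean v hΔ k i|)
      (stdGaussian (EuclideanSpace ℝ (Fin m))) := fun i =>
    ((integrable_hopMax hΔ k i).sub (integrable_const _)).abs
  unfold hopGain
  rw [integral_add (integrable_finsetSum _ fun i _ => hi1 i)
    (integrable_finsetSum _ fun i _ => hi2 i), integral_finsetSum _ fun i _ => hi1 i,
    integral_finsetSum _ fun i _ => hi2 i, ← Finset.sum_sub_distrib]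
  refine add_le_add (Finset.sum_le_sum fun i _ => ?_) ?_
  · rw [integral_sub (integrable_hopMax hΔ (k + 1) i) (integrable_hopMax hΔ k i)]
    rfl
  · refine (Finset.sum_le_sum fun i _ => integral_abs_hopMax_sub_le hv hΔ k i).trans ?_
    simp

/-- Markov's inequality for `hopGain` at g plus `hopGain` at -g, whose mean is twice that of
`hopGain`. No measurability of `stretchSet` is needed, as it is only compared with a superlevel set
containing it. -/
theorem sum_hopMean_succ_ge (hv : TriangleIneq v) (hΔ : 0 ≤ Δ) (k : ℕ) {σ c : ℝ} (hσ : 0 ≤ σ) :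
    ∑ i, hopMean v hΔ k i + Fintype.card V *
      (σ * c * (stdGaussian (EuclideanSpace ℝ (Fin m))).real (stretchSet v Δ σ c)
        - 4 * √(k * Δ)) ≤ ∑ i, hopMean v hΔ (k + 1) i := by
  set γ := stdGaussian (EuclideanSpace ℝ (Fin m)) with hγ
  set f : EuclideanSpace ℝ (Fin m) → ℝ := fun g => hopGain v hΔ k g + hopGain v hΔ k (-g)
  have hneg : MeasurePreserving (fun g : EuclideanSpace ℝ (Fin m) => -g) γ γ :=
    ⟨by fun_prop, map_neg_stdGaussian⟩
  have hg := integrable_hopGain (v := v) hΔ k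
  have hg' : Integrable (fun g => hopGain v hΔ k (-g)) γ := hneg.integrable_comp_of_integrable hg
  have hf : Integrable f γ := hg.add hg'
  -- Nonnegativity is the case of the empty pairing.
  have hf0 : 0 ≤ᵐ[γ] f := Filter.Eventually.of_forall fun g => by
    have := IsPairing.empty.le_hopGain (v := v) hΔ k (σ := 0) (g := g) (by simp)
    simpa using this
  have hmarkov := mul_meas_ge_le_integral_of_nonneg hf0 hf (2 * σ * (c * Fintype.card V))
  have hsub : stretchSet v Δ σ c ⊆ {g | 2 * σ * (c * Fintype.card V) ≤ f g} := by
    rintro g ⟨M, hM, hM', hc⟩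
    have := hM.le_hopGain hΔ k hM'
    refine le_trans ?_ this
    have := hc.le
    gcongr
  have hmono : γ.real (stretchSet v Δ σ c) ≤ γ.real {g | 2 * σ * (c * Fintype.card V) ≤ f g} :=
    measureReal_mono hsub
  have hint : ∫ g, f g ∂γ = 2 * ∫ g, hopGain v hΔ k g ∂γ := by
    rw [integral_add hg hg']
    have : ∫ g, hopGain v hΔ k (-g) ∂γ = ∫ g, hopGain v hΔ k g ∂γ :=
      hneg.integral_comp (MeasurableEquiv.neg _).measurableEmbedding _
    rw [this]; ring
  have hle := integral_hopGain_le hv hΔ k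
  rw [← hγ] at hle
  rcases le_or_gt 0 c with hc | hc
  · have := mul_le_mul_of_nonneg_left hmono
      (show 0 ≤ 2 * σ * (c * Fintype.card V) by positivity)
    linarith
  · have h0 : 0 ≤ ∫ g, f g ∂γ := integral_nonneg_of_ae hf0
    have : Fintype.card V * (σ * c * γ.real (stretchSet v Δ σ c)) ≤ 0 := by
      have : σ * c ≤ 0 := mul_nonpos_of_nonneg_of_nonpos hσ hc.le
      exact mul_nonpos_of_nonneg_of_nonpos (by positivity)
        (mul_nonpos_of_nonpos_of_nonneg this measureReal_nonneg)
    linarith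

theorem stretchSet_mono {Δ' σ c : ℝ} (h : Δ ≤ Δ') : stretchSet v Δ σ c ⊆ stretchSet v Δ' σ c := by
  rintro g ⟨M, hM, hM', hc⟩
  exact ⟨M, hM, fun e he => ⟨(hM' e he).1.trans h, (hM' e he).2⟩, hc⟩

end Hops

/-- It is unlikely that many pairs of squared distance `O(1 / √(log n))` are stretched. -/
theorem exists_stretchSet_le {σ c q : ℝ} (hσ : 0 < σ) (hc : 0 < c) (hq : 0 < q) :
    ∃ κ : ℝ, 0 < κ ∧ ∀ (V : Type) [Fintype V] (m : ℕ) (v : V → EuclideanSpace ℝ (Fin m)) (Δ : ℝ),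
      2 ≤ Fintype.card V → TriangleIneq v → Δ ≤ κ / √(Real.log (Fintype.card V)) →
      (stdGaussian (EuclideanSpace ℝ (Fin m))).real (stretchSet v Δ σ c) ≤ q := by
  set η : ℝ := σ * c * q with hη
  have hη0 : 0 < η := by positivity
  -- While kΔ ≤ ε, the loss 4√(kΔ) is at most η/2, so half of the gain η per point survives.
  set ε : ℝ := (η / 8) ^ 2 with hε
  have hε0 : 0 < ε := by positivity
  -- The bound 1/2 ensures Δ ≤ 1, because √(log n) ≥ 1/2. The second bound makes the final lower
  -- bound (ε/Δ)(η/2) at least twice the upper bound (4 + ε)√(log n).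
  set κ : ℝ := min (1 / 2) (ε * η / (4 * (4 + ε))) with hκ
  have hκ0 : 0 < κ := by positivity
  refine ⟨κ, hκ0, ?_⟩
  intro V _ m v Δ₀ hV hv hΔ₀
  by_contra! hp
  set s : ℝ := √(Real.log (Fintype.card V)) with hs
  have hV' : (2 : ℝ) ≤ Fintype.card V := by exact_mod_cast hV
  have hlog : 1 / 2 ≤ Real.log (Fintype.card V) := by
    have := Real.log_le_log (by norm_num) hV'
    linarith [Real.log_two_gt_d9]
  have hs2 : s ^ 2 = Real.log (Fintype.card V) := Real.sq_sqrt (by linarith)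
  have hs0 : 1 / 2 ≤ s := Real.le_sqrt_of_sq_le (by linarith)
  have hspos : 0 < s := by linarith
  set Δ : ℝ := κ / s with hΔ
  have hΔ0 : 0 < Δ := by positivity
  have hΔ1 : Δ ≤ 1 := by
    rw [hΔ, div_le_one hspos]
    exact (min_le_left _ _).trans hs0
  set n : ℝ := (Fintype.card V : ℝ) with hn
  set P := (stdGaussian (EuclideanSpace ℝ (Fin m))).real (stretchSet v Δ σ c) with hP
  have hPq : q ≤ P := hp.le.trans (measureReal_mono (stretchSet_mono hΔ₀))
  have hgrow : ∀ k : ℕ, k * Δ ≤ ε →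
      ∑ i, hopMean v hΔ0.le k i + n * (η / 2) ≤ ∑ i, hopMean v hΔ0.le (k + 1) i := by
    intro k hk
    refine le_trans ?_ (sum_hopMean_succ_ge hv hΔ0.le k hσ.le (c := c))
    have h1 : √(k * Δ) ≤ η / 8 := Real.sqrt_le_iff.2 ⟨by positivity, hk⟩
    have h2 : η ≤ σ * c * P := by rw [hη]; gcongr
    have : n * (η / 2) ≤ n * (σ * c * P - 4 * √(k * Δ)) := by
      gcongr
      linarith
    linarith
  have hlower : ∀ k : ℕ, (∀ j : ℕ, j < k → j * Δ ≤ ε) →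
      k * (n * (η / 2)) ≤ ∑ i, hopMean v hΔ0.le k i := by
    intro k
    induction k with
    | zero =>
      intro _
      have : ∀ i, hopMean v hΔ0.le 0 i = 0 := by
        intro i
        simp [hopMean, hopMax, maxInner, hops]
      simp [this]
    | succ k ih =>
      intro h
      have h1 := ih fun j hj => h j (by omega)
      have h2 := hgrow k (h k (by omega))
      push_cast
      linarith
  -- The first index beyond ε/Δ: every earlier step grows, and KΔ ≤ ε + Δ stays bounded.
  set K : ℕ := ⌊ε / Δ⌋₊ + 1 with hK
  have hK1 : ε / Δ ≤ K := by
    rw [hK]; push_cast; exact (Nat.lt_floor_add_one _).le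
  have hK2 : ∀ j : ℕ, j < K → j * Δ ≤ ε := by
    intro j hj
    have h1 : (j : ℝ) ≤ ε / Δ := by
      refine le_trans ?_ (Nat.floor_le (by positivity : 0 ≤ ε / Δ))
      exact_mod_cast Nat.lt_succ_iff.1 hj
    rwa [le_div_iff₀ hΔ0] at h1
  have hK3 : K * Δ ≤ ε + 1 := by
    have h1 := hK2 (K - 1) (by omega)
    have h2 : ((K - 1 : ℕ) : ℝ) = K - 1 := by
      rw [Nat.cast_sub (by omega)]; simp
    rw [h2] at h1
    linarith
  have hlow := hlower K hK2
  -- This is `hopMean_le` with t = √(log n).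
  have hup : ∑ i, hopMean v hΔ0.le K i ≤ n * (s * (4 + ε)) := by
    calc ∑ i, hopMean v hΔ0.le K i ≤ ∑ _i : V, s * (4 + ε) := by
          refine Finset.sum_le_sum fun i _ => (hopMean_le hv hΔ0.le K i hspos).trans ?_
          rw [← hs2]
          have h1 : (s ^ 2 + 1) / s ≤ 3 * s := by
            rw [div_le_iff₀ hspos]
            nlinarith
          have h2 : s * (K * Δ) ≤ s * (ε + 1) := by gcongr
          nlinarith
      _ = n * (s * (4 + ε)) := by simp [n]
  have hlow2 : ε / Δ * (n * (η / 2)) ≤ n * (s * (4 + ε)) := by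
    refine le_trans ?_ (hlow.trans hup)
    gcongr
  have hn0 : 0 < n := by linarith
  have h3 : ε / Δ = ε * s / κ := by rw [hΔ]; field_simp
  have h4 : κ * (4 * (4 + ε)) ≤ ε * η := by
    rw [← le_div_iff₀ (by positivity)]
    exact min_le_right _ _
  rw [h3, div_mul_eq_mul_div, div_le_iff₀ hκ0] at hlow2
  have h5 : n * s * (κ * (4 * (4 + ε))) ≤ n * s * (ε * η) := by gcongr
  have h6 : 0 < n * s * (κ * (4 + ε)) := by positivity
  nlinarith

end ARV

/-! ### Both sides of the cut are large with constant probability -/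

namespace ARV

open MeasureTheory ProbabilityTheory

/-- Reverse Markov: the count has mean at least p|P| and never exceeds |P|, so its mean is at most
(p/2)|P| plus |P| times the probability in question. -/
theorem le_prob_card_filter {Ω ι : Type*} {mΩ : MeasurableSpace Ω} {μ : Measure Ω}
    [IsProbabilityMeasure μ] (P : Finset ι) (A : Ω → ι → Prop) [∀ ω, DecidablePred (A ω)]
    (hA : ∀ e ∈ P, MeasurableSet {ω | A ω e}) {p : ℝ} (hp0 : 0 ≤ p)
    (hP : P.Nonempty) (hp : ∀ e ∈ P, p ≤ μ.real {ω | A ω e}) :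
    p / 2 ≤ μ.real {ω | p / 2 * P.card < (P.filter (A ω)).card} := by
  have hP0 : (0 : ℝ) < P.card := by exact_mod_cast hP.card_pos
  set X : Ω → ℝ := fun ω => ∑ e ∈ P, ({ω | A ω e} : Set Ω).indicator (fun _ => (1 : ℝ)) ω with hX
  have hXc : ∀ ω, X ω = (P.filter (A ω)).card := by
    intro ω
    simp [hX, Set.indicator_apply]
  have hi : ∀ e ∈ P, Integrable (({ω | A ω e} : Set Ω).indicator (fun _ => (1 : ℝ))) μ :=
    fun e he => (integrable_const _).indicator (hA e he)
  have hXm : Measurable X :=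
    Finset.measurable_fun_sum _ fun e he => measurable_const.indicator (hA e he)
  have hXi : Integrable X μ := integrable_finsetSum _ hi
  set G : Set Ω := {ω | p / 2 * P.card < (P.filter (A ω)).card} with hG
  have hG' : G = {ω | p / 2 * P.card < X ω} := by
    ext ω; simp only [hG, Set.mem_ofPred_eq, hXc]
  have hGm : MeasurableSet G := by
    rw [hG']; exact measurableSet_lt measurable_const hXm
  have hlow : p * P.card ≤ ∫ ω, X ω ∂μ := by
    rw [integral_finsetSum _ hi]
    calc p * P.card = ∑ _e ∈ P, p := by simp [mul_comm]
      _ ≤ _ := Finset.sum_le_sum fun e he => by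
        rw [integral_indicator_const _ (hA e he)]
        simpa using hp e he
  have hup : ∫ ω, X ω ∂μ ≤ p / 2 * P.card + P.card * μ.real G := by
    calc ∫ ω, X ω ∂μ ≤ ∫ ω, (p / 2 * P.card + G.indicator (fun _ => (P.card : ℝ)) ω) ∂μ := by
          refine integral_mono hXi
            ((integrable_const _).add ((integrable_const _).indicator hGm)) fun ω => ?_
          by_cases hω : ω ∈ G
          · simp only [Set.indicator_of_mem hω, hXc]
            have : ((P.filter (A ω)).card : ℝ) ≤ P.card := by
              exact_mod_cast Finset.card_filter_le _ _
            have : 0 ≤ p / 2 * P.card := by positivity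
            linarith
          · have h := hω
            rw [hG', Set.mem_ofPred_eq, not_lt] at h
            simpa [Set.indicator_of_notMem hω] using h
      _ = _ := by
        rw [integral_add (integrable_const _) ((integrable_const _).indicator hGm),
          integral_indicator_const _ hGm]
        simp [mul_comm]
  have : P.card * (p / 2) ≤ P.card * μ.real G := by linarith
  exact le_of_mul_le_mul_left this hP0

/-- The density on the interval has a lower bound independent of v: use v₁ in the prefactor, and v₀
with the largest x² in the exponential. -/
theorem exists_gaussianReal_Icc_ge {v₀ v₁ b c : ℝ} (h₀ : 0 < v₀) (hbc : b < c) :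
    ∃ p : ℝ, 0 < p ∧ ∀ v : ℝ, v₀ ≤ v → v ≤ v₁ →
      p ≤ (gaussianReal 0 v.toNNReal).real (Set.Icc b c) := by
  rcases lt_or_ge v₁ v₀ with h | h₁
  · exact ⟨1, one_pos, fun v h1 h2 => absurd (h1.trans h2) (not_le.2 h)⟩
  have h₁0 : 0 < v₁ := h₀.trans_le h₁
  set B : ℝ := max (b ^ 2) (c ^ 2) with hB
  set d : ℝ := (√(2 * Real.pi * v₁))⁻¹ * Real.exp (-B / (2 * v₀)) with hd
  have hd0 : 0 < d := by positivity
  refine ⟨d * (c - b), mul_pos hd0 (sub_pos.2 hbc), fun v h1 h2 => ?_⟩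
  have hv : 0 < v := h₀.trans_le h1
  have hv' : v.toNNReal ≠ 0 := by simpa using hv
  rw [measureReal_def, gaussianReal_apply_eq_integral 0 hv', ENNReal.toReal_ofReal
    (setIntegral_nonneg measurableSet_Icc fun _ _ => gaussianPDFReal_nonneg _ _ _)]
  have h := setIntegral_ge_of_const_le_real (μ := volume) (s := Set.Icc b c) (c := d)
    (f := gaussianPDFReal 0 v.toNNReal) measurableSet_Icc (by simp) (fun x hx => ?_)
    (integrable_gaussianPDFReal _ _).integrableOn
  · simpa [hbc.le] using h
  · rw [gaussianPDFReal, Real.coe_toNNReal _ hv.le, hd]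
    have hxB : (x - 0) ^ 2 ≤ B := by
      rw [sub_zero, hB, le_max_iff]
      rcases le_total 0 x with hx0 | hx0
      · right; nlinarith [hx.2]
      · left; nlinarith [hx.1]
    have hB0 : 0 ≤ B := (sq_nonneg _).trans hxB
    have hexp : (x - 0) ^ 2 / (2 * v) ≤ B / (2 * v₀) := by gcongr
    refine mul_le_mul (by gcongr) (Real.exp_le_exp.2 ?_) (by positivity) (by positivity)
    rw [neg_div, neg_div]
    exact neg_le_neg hexp

section TwoPoints

variable {E : Type*} [NormedAddCommGroup E] [InnerProductSpace ℝ E] [FiniteDimensional ℝ E]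
  [MeasurableSpace E] [BorelSpace E]

theorem indepFun_inner_stdGaussian {x y : E} (h : inner ℝ x y = 0) :
    IndepFun (fun g : E => inner ℝ x g) (fun g : E => inner ℝ y g) (stdGaussian E) := by
  refine HasGaussianLaw.indepFun_of_covariance_eq_zero ?_ ?_
  · exact (IsGaussian.hasGaussianLaw_id (μ := stdGaussian E)).map_fun
      ((innerSL ℝ x).prod (innerSL ℝ y))
  · have h1 := covarianceBilin_stdGaussian (E := E)
    have h2 := covarianceBilin_apply (μ := stdGaussian E) IsGaussian.memLp_two_id x y
    rw [h1] at h2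
    rw [covariance, integral_inner_stdGaussian, integral_inner_stdGaussian]
    simpa [innerSL_apply_apply ℝ, h] using h2.symm

theorem real_inner_mem_Icc (x : E) (b c : ℝ) :
    (stdGaussian E).real {g | inner ℝ x g ∈ Set.Icc b c}
      = (gaussianReal 0 (‖x‖ ^ 2).toNNReal).real (Set.Icc b c) := by
  rw [← map_inner_stdGaussian, map_measureReal_apply (by fun_prop) measurableSet_Icc]
  rfl

/-- Write y = r x + z with z orthogonal to x and r = ⟨x, y⟩ / ‖x‖² in [0, 1]. The projections of x
and z are independent, and if they lie in [-2, -1] and [3, 4], then ⟨y, g⟩ ≥ 3 - 2r ≥ 1. -/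
theorem exists_prob_opposite_ge : ∃ p : ℝ, 0 < p ∧ ∀ (m : ℕ) (x y : EuclideanSpace ℝ (Fin m)),
    1 / 8 ≤ ‖x‖ ^ 2 → ‖x‖ ^ 2 ≤ 2 → 1 / 8 ≤ ‖y‖ ^ 2 → ‖y‖ ^ 2 ≤ 2 → 0 ≤ inner ℝ x y →
    inner ℝ x y ≤ ‖x‖ ^ 2 → inner ℝ x y ≤ ‖y‖ ^ 2 → 1 / 8 ≤ ‖x - y‖ ^ 2 →
    p ≤ (stdGaussian (EuclideanSpace ℝ (Fin m))).real
      {g | inner ℝ x g ≤ -1 ∧ 1 ≤ inner ℝ y g} := by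
  obtain ⟨p, hp, H⟩ := exists_gaussianReal_Icc_ge (v₀ := 1 / 256) (v₁ := 2) (b := -2) (c := -1)
    (by norm_num) (by norm_num)
  obtain ⟨q, hq, H'⟩ := exists_gaussianReal_Icc_ge (v₀ := 1 / 256) (v₁ := 2) (b := 3) (c := 4)
    (by norm_num) (by norm_num)
  refine ⟨p * q, mul_pos hp hq, fun m x y hx hx' hy hy' hs hsx hsy hd => ?_⟩
  set a : ℝ := ‖x‖ ^ 2 with ha
  set b : ℝ := ‖y‖ ^ 2 with hb
  set s : ℝ := inner ℝ x y with hs'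
  have ha0 : 0 < a := by linarith
  rw [norm_sub_sq_real, ← ha, ← hb, ← hs'] at hd
  set z := y - (s / a) • x with hz
  have hxz : inner ℝ x z = 0 := by
    rw [hz, inner_sub_right, real_inner_smul_right, real_inner_self_eq_norm_sq, ← ha, ← hs']
    field_simp
    ring
  have hzn : ‖z‖ ^ 2 = (a * b - s ^ 2) / a := by
    rw [hz, norm_sub_sq_real, real_inner_smul_right, norm_smul, mul_pow, real_inner_comm, ← ha,
      ← hb, ← hs', Real.norm_eq_abs, sq_abs]
    field_simp
    ring
  -- As a + b - 2s ≥ 1/8, one of a - s and b - s is at least 1/16. Then use ab - s² = b(a - s) + s(b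
  -- - s) = a(b - s) + s(a - s).
  have hdet : 1 / 128 ≤ a * b - s ^ 2 := by
    rcases le_total (1 / 16) (a - s) with h | h
    · nlinarith [mul_nonneg hs (sub_nonneg.2 hsy)]
    · nlinarith [mul_nonneg hs (sub_nonneg.2 hsx)]
  have hz1 : 1 / 256 ≤ ‖z‖ ^ 2 := by
    rw [hzn, le_div_iff₀ ha0]
    linarith
  have hz2 : ‖z‖ ^ 2 ≤ 2 := by
    rw [hzn, div_le_iff₀ ha0]
    nlinarith [sq_nonneg s]
  have hind := (indepFun_inner_stdGaussian hxz).measure_inter_preimage_eq_mul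
    (Set.Icc (-2) (-1)) (Set.Icc 3 4) measurableSet_Icc measurableSet_Icc
  have hind' : (stdGaussian (EuclideanSpace ℝ (Fin m))).real
      ({g | inner ℝ x g ∈ Set.Icc (-2 : ℝ) (-1)} ∩ {g | inner ℝ z g ∈ Set.Icc (3 : ℝ) 4})
      = (stdGaussian (EuclideanSpace ℝ (Fin m))).real {g | inner ℝ x g ∈ Set.Icc (-2 : ℝ) (-1)}
        * (stdGaussian (EuclideanSpace ℝ (Fin m))).real {g | inner ℝ z g ∈ Set.Icc (3 : ℝ) 4} := by
    simp only [measureReal_def, ← ENNReal.toReal_mul]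
    exact congrArg ENNReal.toReal hind
  have h1 := H (‖x‖ ^ 2) (by linarith) hx'
  have h2 := H' (‖z‖ ^ 2) hz1 hz2
  rw [← real_inner_mem_Icc] at h1 h2
  calc p * q ≤ _ := mul_le_mul h1 h2 hq.le measureReal_nonneg
    _ = _ := hind'.symm
    _ ≤ _ := by
      refine measureReal_mono ?_
      rintro g ⟨⟨hg1, hg2⟩, hg3, hg4⟩
      refine ⟨hg2, ?_⟩
      have hyz : inner ℝ y g = inner ℝ z g + s / a * inner ℝ x g := by
        rw [hz, inner_sub_left, real_inner_smul_left]; ring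
      have hr0 : 0 ≤ s / a := by positivity
      have hr1 : s / a ≤ 1 := by rwa [div_le_one ha0]
      rw [hyz]
      nlinarith

theorem exists_prob_stretch_ge : ∃ p : ℝ, 0 < p ∧ ∀ (m : ℕ) (x : EuclideanSpace ℝ (Fin m)),
    1 / 8 ≤ ‖x‖ ^ 2 → ‖x‖ ^ 2 ≤ 8 →
    p ≤ (stdGaussian (EuclideanSpace ℝ (Fin m))).real {g | 1 ≤ inner ℝ x g} := by
  obtain ⟨p, hp, H⟩ := exists_gaussianReal_Icc_ge (v₀ := 1 / 8) (v₁ := 8) (b := 1) (c := 2)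
    (by norm_num) (by norm_num)
  refine ⟨p, hp, fun m x h1 h2 => ?_⟩
  have h := H _ h1 h2
  rw [← real_inner_mem_Icc] at h
  exact h.trans (measureReal_mono fun g hg => hg.1)

end TwoPoints

theorem measurable_gaussianVector (m : ℕ) : Measurable (gaussianVector m) := by
  unfold gaussianVector
  fun_prop

theorem map_gaussianVector (m : ℕ) :
    RealRAM.samples.map (gaussianVector m) = stdGaussian (EuclideanSpace ℝ (Fin m)) := by
  have h : RealRAM.samples.map (fun (ω : ℕ → ℝ) (k : Fin m) => ω k)
      = Measure.pi fun _ : Fin m => gaussianReal 0 1 := by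
    refine (Measure.pi_eq fun t ht => ?_).symm
    rw [Measure.map_apply (by fun_prop) (.univ_pi ht)]
    have hpre : (fun (ω : ℕ → ℝ) (k : Fin m) => ω k) ⁻¹' Set.univ.pi t
        = (Finset.range m : Set ℕ).pi fun i => if h : i < m then t ⟨i, h⟩ else Set.univ := by
      ext ω
      simp only [Set.mem_preimage, Set.mem_pi, Set.mem_univ, true_imp_iff, Finset.coe_range,
        Set.mem_Iio]
      constructor
      · intro h i hi
        simpa [hi] using h ⟨i, hi⟩
      · intro h k
        simpa using h k k.2
    rw [hpre, RealRAM.samples, Measure.infinitePi_pi, Finset.prod_range]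
    · simp
    · intro i hi
      rw [dif_pos (Finset.mem_range.1 hi)]
      exact ht _
  rw [← map_pi_eq_stdGaussian, ← h, Measure.map_map (by fun_prop) (by fun_prop)]
  rfl

instance : IsProbabilityMeasure RealRAM.samples := by
  unfold RealRAM.samples; infer_instance

/-- For a set that may fail to be measurable, only this inequality of outer measures is used; it
suffices for `stretchSet`. -/
theorem samples_real_gaussianVector_le {m : ℕ} (S : Set (EuclideanSpace ℝ (Fin m))) :
    RealRAM.samples.real {ω | gaussianVector m ω ∈ S}
      ≤ (stdGaussian (EuclideanSpace ℝ (Fin m))).real S := by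
  rw [← map_gaussianVector]
  exact ENNReal.toReal_mono (measure_ne_top _ _)
    (Measure.le_map_apply (measurable_gaussianVector m).aemeasurable S)

theorem samples_real_gaussianVector_eq {m : ℕ} {S : Set (EuclideanSpace ℝ (Fin m))}
    (hS : MeasurableSet S) :
    RealRAM.samples.real {ω | gaussianVector m ω ∈ S}
      = (stdGaussian (EuclideanSpace ℝ (Fin m))).real S := by
  rw [← map_gaussianVector, map_measureReal_apply (measurable_gaussianVector m) hS]
  rfl

section Counting

variable {n m : ℕ}

/-- The indices of the entries of `y` that are at most `a`. -/
noncomputable def below (y : Fin n → ℝ) (a : ℝ) : Finset (Fin n) :=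
  Finset.univ.filter fun i => y i ≤ a

/-- The indices of the entries of `y` that are at least `b`. -/
noncomputable def above (y : Fin n → ℝ) (b : ℝ) : Finset (Fin n) :=
  Finset.univ.filter fun i => b ≤ y i

theorem card_filter_prod_eq (r : Fin n → Fin n → Prop) [∀ i j, Decidable (r i j)] :
    (Finset.univ.filter fun e : Fin n × Fin n => r e.1 e.2).card
      = ∑ i, (Finset.univ.filter fun j => r i j).card := by
  simp only [Finset.card_filter]
  rw [← Finset.univ_product_univ, Finset.sum_product]

/-- Let J be the set of i with many entries above y_i + σ. If no i works, the largest y_i with i in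
J has at most cn entries below it, and these include all of J. So |J| ≤ cn, and there are at most
|J| n + n · cn ≤ 2cn² stretched pairs. -/
theorem exists_threshold (y : Fin n → ℝ) {σ c : ℝ}
    (h : 2 * c * n ^ 2 < ((Finset.univ.filter fun e : Fin n × Fin n => σ ≤ y e.2 - y e.1).card : ℝ)) :
    ∃ i, c * n < (below y (y i)).card ∧ c * n < (above y (y i + σ)).card := by
  by_contra! H
  set J : Finset (Fin n) := Finset.univ.filter fun i => c * n < (above y (y i + σ)).card with hJ
  have hJc : (J.card : ℝ) ≤ c * n ∨ J = ∅ := by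
    rcases J.eq_empty_or_nonempty with h0 | h0
    · exact .inr h0
    · left
      obtain ⟨i, hi, hmax⟩ := J.exists_max_image y h0
      have h1 : (below y (y i)).card ≤ c * n := by
        by_contra! h2
        exact absurd (H i h2) (not_le.2 (Finset.mem_filter.1 hi).2)
      refine le_trans ?_ h1
      exact_mod_cast Finset.card_le_card fun j hj => by
        simpa [below] using hmax j hj
  rw [card_filter_prod_eq fun i j => σ ≤ y j - y i] at h
  push_cast at h
  have hrow : ∀ i, (Finset.univ.filter fun j => σ ≤ y j - y i) = above y (y i + σ) := by
    intro i
    ext j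
    simp [above, le_sub_iff_add_le']
  simp_rw [hrow] at h
  have hbound : ∀ i, ((above y (y i + σ)).card : ℝ) ≤ (if i ∈ J then (n : ℝ) else 0) + c * n ∨
      c * n < 0 := by
    intro i
    rcases lt_or_ge (c * n) 0 with h0 | h0
    · exact .inr h0
    left
    split_ifs with hi
    · have : ((above y (y i + σ)).card : ℝ) ≤ n := by
        exact_mod_cast (Finset.card_le_univ _).trans (by simp)
      linarith
    · simpa [hJ] using hi
  rcases lt_or_ge (c * n) 0 with h0 | h0
  · rcases Nat.eq_zero_or_pos n with rfl | hn
    · simp at h0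
    · have h1 := H ⟨0, hn⟩ (h0.trans_le (Nat.cast_nonneg _))
      exact absurd (h0.trans_le (Nat.cast_nonneg _)) (not_lt.2 h1)
  · have h1 : ∑ i, ((above y (y i + σ)).card : ℝ)
        ≤ ∑ i, ((if i ∈ J then (n : ℝ) else 0) + c * n) :=
      Finset.sum_le_sum fun i _ => (hbound i).resolve_right (not_lt.2 h0)
    rw [Finset.sum_add_distrib, Finset.sum_ite_mem, Finset.univ_inter] at h1
    simp only [Finset.sum_const, Finset.card_univ, Fintype.card_fin, nsmul_eq_mul] at h1
    have h2 : (J.card : ℝ) * n ≤ c * n * n := by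
      rcases hJc with h3 | h3
      · gcongr
      · rw [h3]; simp; positivity
    nlinarith

/-- The ordered pairs at squared distance more than `1/8`. -/
noncomputable def farPairs (v : Fin n → EuclideanSpace ℝ (Fin m)) : Finset (Fin n × Fin n) :=
  Finset.univ.filter fun e => 1 / 8 < sqDist v e.1 e.2

theorem Spread.card_farPairs_ge {v : Fin n → EuclideanSpace ℝ (Fin m)} (hv : Spread v) :
    (n : ℝ) ^ 2 / 4 ≤ (farPairs v).card := by
  rw [farPairs, card_filter_prod_eq fun i j => 1 / 8 < sqDist v i j]
  push_cast
  have h : ∀ i, (n : ℝ) / 4 ≤ ((Finset.univ.filter fun j => 1 / 8 < sqDist v i j).card : ℝ) := by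
    intro i
    have h1 := hv.2 i
    have h2 := Finset.card_filter_add_card_filter_not (s := (Finset.univ : Finset (Fin n)))
      (fun j => sqDist v i j ≤ 1 / 8)
    simp only [not_le, Finset.card_univ, Fintype.card_fin] at h2
    have h3 : ((ball v i (1 / 8)).card : ℝ)
        + ((Finset.univ.filter fun j => 1 / 8 < sqDist v i j).card : ℝ) = n := by
      exact_mod_cast h2
    linarith
  calc (n : ℝ) ^ 2 / 4 = ∑ _i : Fin n, (n : ℝ) / 4 := by simp; ring
    _ ≤ _ := Finset.sum_le_sum fun i _ => h i

/-- The triangle inequalities with the origin amount to 0 ≤ ⟨v_i, v_j⟩ ≤ min(‖v_i‖², ‖v_j‖²), as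
`exists_prob_opposite_ge` requires. When a constant fraction of the far pairs lies in L × R, we get
|L||R| > pn²/8, and since neither side exceeds n, both exceed pn/8. -/
theorem exists_prob_large_sides : ∃ p : ℝ, 0 < p ∧
    ∀ (n m : ℕ) (v : Fin n → EuclideanSpace ℝ (Fin m)), 0 < n → Spread v →
      TriangleIneq (withOrigin v) →
      p ≤ RealRAM.samples.real {ω | p * n < (leftSet v (gaussianVector m ω)).card ∧
        p * n < (rightSet v (gaussianVector m ω)).card} := by
  obtain ⟨p, hp, H⟩ := exists_prob_opposite_ge
  refine ⟨p / 8, by positivity, fun n m v hn hv htri => ?_⟩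
  have hn' : (0 : ℝ) < n := by exact_mod_cast hn
  have hcard := hv.card_farPairs_ge
  have hne : (farPairs v).Nonempty := by
    rw [← Finset.card_pos]
    have : (0 : ℝ) < (farPairs v).card := lt_of_lt_of_le (by positivity) hcard
    exact_mod_cast this
  have hm : ∀ e : Fin n × Fin n, MeasurableSet {g : EuclideanSpace ℝ (Fin m) |
      inner ℝ (v e.1) g ≤ -1 ∧ 1 ≤ inner ℝ (v e.2) g} := fun e => by
    measurability
  have key := le_prob_card_filter (μ := RealRAM.samples) (farPairs v)
    (fun ω e => inner ℝ (v e.1) (gaussianVector m ω) ≤ -1 ∧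
      1 ≤ inner ℝ (v e.2) (gaussianVector m ω))
    (fun e _ => measurable_gaussianVector m (hm e)) hp.le hne (fun e he => by
      refine le_trans ?_ (samples_real_gaussianVector_eq (hm e)).ge
      have hd : 1 / 8 < sqDist v e.1 e.2 := (Finset.mem_filter.1 he).2
      have t1 := htri (some e.1) (some e.2) none
      have t2 := htri none (some e.1) (some e.2)
      have t3 := htri none (some e.2) (some e.1)
      simp only [sqDist, withOrigin, sub_zero, zero_sub, norm_neg] at t1 t2 t3 hd
      rw [norm_sub_rev (v e.2)] at t2
      rw [norm_sub_sq_real] at t1 t2 t3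
      exact H m _ _ (hv.1 _).1 (hv.1 _).2 (hv.1 _).1 (hv.1 _).2 (by linarith) (by linarith)
        (by linarith) hd.le)
  refine le_trans (by linarith) (key.trans (measureReal_mono ?_))
  intro ω hω
  set g := gaussianVector m ω
  have hsub : ((farPairs v).filter fun e => inner ℝ (v e.1) g ≤ -1 ∧ 1 ≤ inner ℝ (v e.2) g)
      ⊆ leftSet v g ×ˢ rightSet v g := by
    intro e he
    have h := (Finset.mem_filter.1 he).2
    simp [leftSet, rightSet, h.1, h.2]
  have h1 : (((farPairs v).filter fun e => inner ℝ (v e.1) g ≤ -1 ∧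
      1 ≤ inner ℝ (v e.2) g).card : ℝ) ≤ (leftSet v g).card * (rightSet v g).card := by
    have := Finset.card_le_card hsub
    rw [Finset.card_product] at this
    exact_mod_cast this
  have h2 : p / 2 * (n ^ 2 / 4) < (leftSet v g).card * (rightSet v g).card := by
    refine lt_of_le_of_lt ?_ (lt_of_lt_of_le hω h1)
    gcongr
  have hL : ((leftSet v g).card : ℝ) ≤ n := by
    exact_mod_cast (Finset.card_le_univ _).trans (by simp)
  have hR : ((rightSet v g).card : ℝ) ≤ n := by
    exact_mod_cast (Finset.card_le_univ _).trans (by simp)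
  have h3 : n * (p / 8 * n) < n * ((leftSet v g).card : ℝ) := by
    have : ((leftSet v g).card : ℝ) * (rightSet v g).card ≤ (leftSet v g).card * n := by gcongr
    linarith
  have h4 : n * (p / 8 * n) < n * ((rightSet v g).card : ℝ) := by
    have : ((leftSet v g).card : ℝ) * (rightSet v g).card ≤ n * (rightSet v g).card := by gcongr
    linarith
  exact ⟨lt_of_mul_lt_mul_left h3 hn'.le, lt_of_mul_lt_mul_left h4 hn'.le⟩

/-- Without the origin only differences v_j - v_i are controlled and fixed levels such as ±1 have no
meaning, so the lower level is taken from the projections themselves. The constant comes from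
(p/2)(n²/4) = 2(p/16)n². -/
theorem exists_prob_threshold : ∃ p : ℝ, 0 < p ∧
    ∀ (n m : ℕ) (v : Fin n → EuclideanSpace ℝ (Fin m)), 0 < n → Spread v →
      p ≤ RealRAM.samples.real {ω | ∃ i,
        p * n < (below (fun j => inner ℝ (v j) (gaussianVector m ω))
          (inner ℝ (v i) (gaussianVector m ω))).card ∧
        p * n < (above (fun j => inner ℝ (v j) (gaussianVector m ω))
          (inner ℝ (v i) (gaussianVector m ω) + 1)).card} := by
  obtain ⟨p, hp, H⟩ := exists_prob_stretch_ge
  refine ⟨p / 16, by positivity, fun n m v hn hv => ?_⟩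
  have hn' : (0 : ℝ) < n := by exact_mod_cast hn
  have hcard := hv.card_farPairs_ge
  have hne : (farPairs v).Nonempty := by
    rw [← Finset.card_pos]
    have : (0 : ℝ) < (farPairs v).card := lt_of_lt_of_le (by positivity) hcard
    exact_mod_cast this
  have hm : ∀ e : Fin n × Fin n, MeasurableSet {g : EuclideanSpace ℝ (Fin m) |
      1 ≤ inner ℝ (v e.2 - v e.1) g} := fun e => measurableSet_le (by fun_prop) (by fun_prop)
  have key := le_prob_card_filter (μ := RealRAM.samples) (farPairs v)
    (fun ω e => 1 ≤ inner ℝ (v e.2 - v e.1) (gaussianVector m ω))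
    (fun e _ => measurable_gaussianVector m (hm e)) hp.le hne (fun e he => by
      refine le_trans ?_ (samples_real_gaussianVector_eq (hm e)).ge
      have hd : 1 / 8 < sqDist v e.1 e.2 := (Finset.mem_filter.1 he).2
      rw [sqDist_comm] at hd
      refine H m _ hd.le ?_
      have h1 := (hv.1 e.1).2
      have h2 := (hv.1 e.2).2
      nlinarith [parallelogram_law_with_norm ℝ (v e.2) (v e.1), norm_nonneg (v e.2 + v e.1)])
  refine le_trans (by linarith) (key.trans (measureReal_mono ?_))
  intro ω hω
  set g := gaussianVector m ω
  refine exists_threshold (fun j => inner ℝ (v j) g) (lt_of_le_of_lt ?_ (lt_of_lt_of_le hω ?_))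
  · have : p / 2 * (n ^ 2 / 4) ≤ p / 2 * (farPairs v).card := by gcongr
    linarith
  · exact_mod_cast Finset.card_le_card fun e he => by
      have h := (Finset.mem_filter.1 he).2
      rw [inner_sub_left] at h
      simpa using h

end Counting

end ARV

/-! ### Removal of a maximal matching of short pairs -/

namespace ARV

variable {n m : ℕ}

/-- The possible results of removing a maximal matching of `Δ`-short pairs from `L × R`. -/
inductive Outcome (c Δ : ℝ) (v : Fin n → EuclideanSpace ℝ (Fin m)) (L R : Finset (Fin n)) :
    Option (Finset (Fin n) × Finset (Fin n)) → Prop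
  | small : (L.card : ℝ) ≤ c * n ∨ (R.card : ℝ) ≤ c * n → Outcome c Δ v L R none
  | largeMatching (M : Finset (Fin n × Fin n)) :
      c * n < L.card → c * n < R.card → Maximal (IsShortMatching v Δ L R) M →
      c / 2 * n < M.card → Outcome c Δ v L R none
  | success (M : Finset (Fin n × Fin n)) :
      c * n < L.card → c * n < R.card → Maximal (IsShortMatching v Δ L R) M →
      (M.card : ℝ) ≤ c / 2 * n → Outcome c Δ v L R (some (uncovered M L, uncovered M R))

variable {c Δ : ℝ} {v : Fin n → EuclideanSpace ℝ (Fin m)} {L R L' R' : Finset (Fin n)}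

theorem algorithmResult_iff_outcome {g : EuclideanSpace ℝ (Fin m)}
    {o : Option (Finset (Fin n) × Finset (Fin n))} :
    AlgorithmResult c Δ v g o ↔ Outcome c Δ v (leftSet v g) (rightSet v g) o := by
  constructor
  · rintro (h | ⟨M, h1, h2, h3, h4⟩ | ⟨M, h1, h2, h3, h4⟩)
    exacts [.small h, .largeMatching M h1 h2 h3 h4, .success M h1 h2 h3 h4]
  · rintro (h | ⟨M, h1, h2, h3, h4⟩ | ⟨M, h1, h2, h3, h4⟩)
    exacts [.small h, .largeMatching M h1 h2 h3 h4, .success M h1 h2 h3 h4]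

theorem card_le_card_uncovered_add (M : Finset (Fin n × Fin n)) (S : Finset (Fin n))
    (f : Fin n × Fin n → Fin n) (hf : ∀ i ∈ S, (∀ e ∈ M, f e ≠ i) → i ∈ uncovered M S) :
    S.card ≤ (uncovered M S).card + M.card := by
  have h : S ⊆ uncovered M S ∪ M.image f := by
    intro i hi
    by_cases h : ∀ e ∈ M, f e ≠ i
    · exact Finset.mem_union_left _ (hf i hi h)
    · push Not at h
      obtain ⟨e, he, rfl⟩ := h
      exact Finset.mem_union_right _ (Finset.mem_image_of_mem _ he)
  exact (Finset.card_le_card h).trans ((Finset.card_union_le _ _).trans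
    (Nat.add_le_add_left Finset.card_image_le _))

theorem mem_uncovered_left_iff {M : Finset (Fin n × Fin n)} (hLR : Disjoint L R)
    (hM : IsShortMatching v Δ L R M) {i : Fin n} :
    i ∈ uncovered M L ↔ i ∈ L ∧ ∀ e ∈ M, e.1 ≠ i := by
  rw [uncovered, Finset.mem_filter]
  refine and_congr_right fun hi => ⟨fun h e he => (h e he).1, fun h e he => ⟨h e he, ?_⟩⟩
  rintro rfl
  exact Finset.disjoint_left.1 hLR hi (hM.1 e he).2.1

theorem mem_uncovered_right_iff {M : Finset (Fin n × Fin n)} (hLR : Disjoint L R)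
    (hM : IsShortMatching v Δ L R M) {i : Fin n} :
    i ∈ uncovered M R ↔ i ∈ R ∧ ∀ e ∈ M, e.2 ≠ i := by
  rw [uncovered, Finset.mem_filter]
  refine and_congr_right fun hi => ⟨fun h e he => (h e he).2, fun h e he => ⟨?_, h e he⟩⟩
  rintro rfl
  exact Finset.disjoint_left.1 hLR (hM.1 e he).1 hi

theorem IsShortMatching.insert {M : Finset (Fin n × Fin n)} (hM : IsShortMatching v Δ L R M)
    {i j : Fin n} (hi : i ∈ L) (hj : j ∈ R) (hd : sqDist v i j ≤ Δ) (hi' : ∀ e ∈ M, e.1 ≠ i)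
    (hj' : ∀ e ∈ M, e.2 ≠ j) : IsShortMatching v Δ L R (insert (i, j) M) := by
  refine ⟨fun e he => ?_, fun e he f hf h => ?_⟩
  · rcases Finset.mem_insert.1 he with rfl | he
    exacts [⟨hi, hj, hd⟩, hM.1 e he]
  · rcases Finset.mem_insert.1 he with rfl | he <;> rcases Finset.mem_insert.1 hf with rfl | hf
    · rfl
    · rcases h with h | h
      exacts [absurd h.symm (hi' f hf), absurd h.symm (hj' f hf)]
    · rcases h with h | h
      exacts [absurd h (hi' e he), absurd h (hj' e he)]
    · exact hM.2 e he f hf h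

/-- Each matched pair removes one element from each side, so at most (c/2)n are lost per side. A
short pair among the survivors would extend the matching, against maximality. -/
theorem Outcome.spec (hLR : Disjoint L R) (h : Outcome c Δ v L R (some (L', R'))) :
    c / 2 * n ≤ L'.card ∧ c / 2 * n ≤ R'.card ∧ Separated v Δ L' R' := by
  rcases h with _ | _ | ⟨M, h1, h2, h3, h4⟩
  have hL : (L.card : ℝ) ≤ (uncovered M L).card + M.card := by
    exact_mod_cast card_le_card_uncovered_add M L Prod.fst fun i hi h =>
      (mem_uncovered_left_iff hLR h3.1).2 ⟨hi, h⟩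
  have hR : (R.card : ℝ) ≤ (uncovered M R).card + M.card := by
    exact_mod_cast card_le_card_uncovered_add M R Prod.snd fun i hi h =>
      (mem_uncovered_right_iff hLR h3.1).2 ⟨hi, h⟩
  refine ⟨by linarith, by linarith, fun i hi j hj => ?_⟩
  by_contra! hd
  rw [mem_uncovered_left_iff hLR h3.1] at hi
  rw [mem_uncovered_right_iff hLR h3.1] at hj
  have h := h3.2 (h3.1.insert hi.1 hj.1 hd.le hi.2 hj.2) (Finset.subset_insert _ _)
  exact hi.2 _ (h (Finset.mem_insert_self _ _)) rfl

theorem Outcome.of_none (h : Outcome c Δ v L R none) :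
    ((L.card : ℝ) ≤ c * n ∨ (R.card : ℝ) ≤ c * n) ∨
      ∃ M, IsShortMatching v Δ L R M ∧ c / 2 * n < M.card := by
  rcases h with h | ⟨M, h1, h2, h3, h4⟩
  exacts [.inl h, .inr ⟨M, h3.1, h4⟩]

theorem disjoint_below_above (y : Fin n → ℝ) {a b : ℝ} (h : a < b) :
    Disjoint (below y a) (above y b) := by
  rw [Finset.disjoint_left]
  intro i hi hi'
  simp only [below, above, Finset.mem_filter, Finset.mem_univ, true_and] at hi hi'
  linarith

theorem IsShortMatching.mem_stretchSet {M : Finset (Fin n × Fin n)} {g : EuclideanSpace ℝ (Fin m)}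
    {a b σ : ℝ} (hσ : 0 < σ) (hab : a + σ ≤ b)
    (hM : IsShortMatching v Δ (below (fun i => inner ℝ (v i) g) a)
      (above (fun i => inner ℝ (v i) g) b) M) (hc : c * n < M.card) :
    g ∈ stretchSet v Δ σ c := by
  refine ⟨M, ⟨hM.2, fun e he f hf h => ?_⟩, fun e he => ⟨(hM.1 e he).2.2, ?_⟩, by simpa using hc⟩
  · have h1 := (hM.1 e he).1
    have h2 := (hM.1 f hf).2.1
    rw [h] at h1
    exact Finset.disjoint_left.1 (disjoint_below_above _ (by linarith)) h1 h2
  · have h1 := (hM.1 e he).1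
    have h2 := (hM.1 e he).2.1
    simp only [below, above, Finset.mem_filter, Finset.mem_univ, true_and] at h1 h2
    rw [inner_sub_left]
    linarith

theorem leftSet_eq_below (g : EuclideanSpace ℝ (Fin m)) :
    leftSet v g = below (fun i => inner ℝ (v i) g) (-1) := rfl

theorem rightSet_eq_above (g : EuclideanSpace ℝ (Fin m)) :
    rightSet v g = above (fun i => inner ℝ (v i) g) 1 := rfl

/-- Outside of `stretchSet` the procedure succeeds on large sets. -/
theorem Outcome.ne_none {g : EuclideanSpace ℝ (Fin m)} {a b σ : ℝ} (hσ : 0 < σ) (hab : a + σ ≤ b)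
    (hg : g ∉ stretchSet v Δ σ (c / 2))
    (hL : c * n < (below (fun i => inner ℝ (v i) g) a).card)
    (hR : c * n < (above (fun i => inner ℝ (v i) g) b).card)
    {o : Option (Finset (Fin n) × Finset (Fin n))}
    (h : Outcome c Δ v (below (fun i => inner ℝ (v i) g) a)
      (above (fun i => inner ℝ (v i) g) b) o) : o ≠ none := by
  rintro rfl
  rcases h.of_none with (h | h) | ⟨M, hM, hc⟩
  · exact absurd hL (not_lt.2 h)
  · exact absurd hR (not_lt.2 h)
  · exact hg (hM.mem_stretchSet hσ hab hc)

/-- The distance threshold used by the algorithm. -/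
noncomputable def threshold (κ : ℝ) (n : ℕ) : ℝ := κ / √(Nat.clog 2 n)

theorem clog_pos {n : ℕ} (hn : 2 ≤ n) : (0 : ℝ) < Nat.clog 2 n := by
  exact_mod_cast Nat.clog_pos one_lt_two hn

theorem log_le_clog {n : ℕ} (hn : 2 ≤ n) : Real.log n ≤ Nat.clog 2 n := by
  have h : (n : ℝ) ≤ 2 ^ Nat.clog 2 n := by exact_mod_cast Nat.le_pow_clog one_lt_two n
  have h2 := Real.log_le_log (by positivity) h
  rw [Real.log_pow] at h2
  refine h2.trans ?_
  have := Real.log_two_lt_d9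
  have := clog_pos hn
  nlinarith

theorem clog_le_log {n : ℕ} (hn : 2 ≤ n) : (Nat.clog 2 n : ℝ) ≤ 4 * Real.log n := by
  have h : 2 ^ (Nat.clog 2 n - 1) < n := Nat.pow_pred_clog_lt_self one_lt_two hn
  have h' : (2 : ℝ) ^ (Nat.clog 2 n - 1) ≤ n := by exact_mod_cast h.le
  have h2 := Real.log_le_log (by positivity) h'
  rw [Real.log_pow, Nat.cast_sub (Nat.clog_pos one_lt_two hn)] at h2
  have h3 := Real.log_le_log (by norm_num) (show (2 : ℝ) ≤ n by exact_mod_cast hn)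
  have := Real.log_two_gt_d9
  have h4 : (1 : ℝ) ≤ Nat.clog 2 n := by exact_mod_cast Nat.clog_pos one_lt_two hn
  push_cast at h2
  nlinarith

theorem threshold_le {κ : ℝ} (hκ : 0 ≤ κ) {n : ℕ} (hn : 2 ≤ n) :
    threshold κ n ≤ κ / √(Real.log n) := by
  have h := log_le_clog hn
  have : 0 < Real.log n := Real.log_pos (by exact_mod_cast hn)
  unfold threshold
  gcongr

theorem thetaInvSqrtLog_threshold {κ : ℝ} (hκ : 0 < κ) : ThetaInvSqrtLog (threshold κ) := by
  refine ⟨κ / 2, κ, by positivity, hκ, fun n hn => ⟨?_, threshold_le hκ.le hn⟩⟩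
  have h := clog_le_log hn
  have h1 := clog_pos hn
  have h0 : 0 < Real.log n := Real.log_pos (by exact_mod_cast hn)
  have h2 : √(Nat.clog 2 n : ℝ) ≤ 2 * √(Real.log n) := by
    refine Real.sqrt_le_iff.2 ⟨by positivity, ?_⟩
    rw [mul_pow, Real.sq_sqrt h0.le]
    linarith
  rw [div_div]
  unfold threshold
  have : 0 < √(Nat.clog 2 n : ℝ) := Real.sqrt_pos.2 h1
  gcongr

/-- The left-hand test is what the machine evaluates: it needs neither a square root nor a
logarithm, and `Nat.clog` is obtained by doubling an integer. -/
theorem le_threshold_iff {κ : ℝ} (hκ : 0 ≤ κ) {n : ℕ} (hn : 2 ≤ n) {d : ℝ} (hd : 0 ≤ d) :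
    d * d * Nat.clog 2 n ≤ κ ^ 2 ↔ d ≤ threshold κ n := by
  have h1 := clog_pos hn
  rw [threshold, le_div_iff₀ (Real.sqrt_pos.2 h1), ← sq_le_sq₀ (by positivity) hκ, mul_pow,
    Real.sq_sqrt h1.le, sq d]

/-- Excludes n = 1, where log n = 0 and the distance threshold degenerates. -/
theorem Spread.two_le {v : Fin n → EuclideanSpace ℝ (Fin m)} (hv : Spread v) (hn : 0 < n) :
    2 ≤ n := by
  by_contra! h
  obtain rfl : n = 1 := by omega
  have h1 := hv.2 0
  have h2 : (ball v 0 (1 / 8)) = {0} := by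
    ext i
    obtain rfl := Subsingleton.elim i 0
    simp [ball, sqDist]
  rw [h2] at h1
  norm_num at h1

end ARV

/-! ### Program logic for the real RAM -/

namespace RealRAM

/-- With random samples `ω`, the program `p` started in `s` halts after at most `T` steps in a
state satisfying `Q`. -/
def Runs (ω : ℕ → ℝ) (p : Program) (s : State) (T : ℕ) (Q : State → Prop) : Prop :=
  ∃ (t : ℕ) (s' : State), Exec ω p s t s' ∧ t ≤ T ∧ Q s'

/-- A straight-line program; the empty one copies a cell to itself. -/
def Program.block : List Instr → Program
  | [] => .instr (.copy 16 16)
  | i :: l => .seq (.instr i) (Program.block l)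

/-- `for x := 0, …, r(b) - 1 do p`; register `5` must contain `1`. -/
def Program.forLoop (x b : ℕ) (p : Program) : Program :=
  .seq (.instr (.setNat x 0)) (.loop (.natLT x b) (.seq p (.instr (.addNat x x 5))))

variable {ω : ℕ → ℝ} {p q : Program} {s : State} {T T' : ℕ} {Q R : State → Prop}

theorem Runs.mono (h : Runs ω p s T R) (hT : T ≤ T') (hQ : ∀ s', R s' → Q s') :
    Runs ω p s T' Q := by
  obtain ⟨t, s', h1, h2, h3⟩ := h
  exact ⟨t, s', h1, h2.trans hT, hQ _ h3⟩

theorem Runs.seq (h : Runs ω p s T R) (h' : ∀ s', R s' → Runs ω q s' T' Q) :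
    Runs ω (.seq p q) s (T + T') Q := by
  obtain ⟨t, s', h1, h2, h3⟩ := h
  obtain ⟨t', s'', h4, h5, h6⟩ := h' s' h3
  exact ⟨t + t', s'', .seq h1 h4, by omega, h6⟩

theorem Runs.ite {b : Test} (h : b.Holds s → Runs ω p s T Q) (h' : ¬ b.Holds s → Runs ω q s T Q) :
    Runs ω (.ite b p q) s (T + 1) Q := by
  by_cases hb : b.Holds s
  · obtain ⟨t, s', h1, h2, h3⟩ := h hb
    exact ⟨t + 1, s', .ite_true hb h1, by omega, h3⟩
  · obtain ⟨t, s', h1, h2, h3⟩ := h' hb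
    exact ⟨t + 1, s', .ite_false hb h1, by omega, h3⟩

theorem Instr.apply_copy_self (x : ℕ) : (Instr.copy x x).apply ω s = s := by
  simp [Instr.apply, State.setCell, State.cell]

theorem Runs.block {l : List Instr} (h : Q (l.foldl (Instr.apply ω) s)) :
    Runs ω (.block l) s (l.length + 1) Q := by
  induction l generalizing s with
  | nil =>
    refine ⟨1, _, .instr _ _, by simp, ?_⟩
    rw [Instr.apply_copy_self]
    exact h
  | cons i l ih =>
    obtain ⟨t, s', h1, h2, h3⟩ := ih h
    exact ⟨1 + t, s', .seq (.instr i s) h1, by simp; omega, h3⟩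

/-- A round costs the body, one test and one increment; the initialization and the last test give
the final + 2. The invariant is demanded after the increment by register 5, so the value 1 of that
register enters through the caller's invariant. -/
theorem Runs.forLoop {x b N : ℕ} {Inv : ℕ → State → Prop} (h0 : Inv 0 (s.setReg x 0))
    (hreg : ∀ k s, Inv k s → s.reg x = k ∧ s.reg b = N)
    (hstep : ∀ (k : Fin N) s, Inv k s →
      Runs ω p s T fun s' => Inv (k + 1) (s'.setReg x (s'.reg x + s'.reg 5))) :
    Runs ω (.forLoop x b p) s (N * (T + 2) + 2) (Inv N) := by
  have hloop : ∀ r k s, k + r = N → Inv k s →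
      Runs ω (.loop (.natLT x b) (.seq p (.instr (.addNat x x 5)))) s (r * (T + 2) + 1)
        (Inv N) := by
    intro r
    induction r with
    | zero =>
      intro k s hk hI
      obtain ⟨h1, h2⟩ := hreg k s hI
      refine ⟨1, s, .loop_done ?_, by simp, ?_⟩
      · simp only [Test.Holds, h1, h2]; omega
      · rw [← hk]; exact hI
    | succ r ih =>
      intro k s hk hI
      obtain ⟨h1, h2⟩ := hreg k s hI
      obtain ⟨t, s', h3, h4, h5⟩ := hstep ⟨k, by omega⟩ s hI
      obtain ⟨t', s'', h6, h7, h8⟩ := ih (k + 1) _ (by omega) h5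
      refine ⟨t + 1 + 1 + t', s'', .loop_step ?_ (.seq h3 (.instr _ _)) h6, ?_, h8⟩
      · simp only [Test.Holds, h1, h2]; omega
      · rw [add_mul]; omega
  obtain ⟨t, s', h1, h2, h3⟩ := hloop N 0 _ (by omega) h0
  exact ⟨1 + t, s', .seq (.instr _ _) h1, by omega, h3⟩

/-! ### Memory layout -/

/-- Memory cells: the input, thirteen scratch cells, the Gaussian vector, the projections, and the
indicator vectors of the two sides of the cut. -/
inductive Loc (n m : ℕ) where
  | data (i : Fin n) (k : Fin m)
  | sc (k : Fin 13)
  | g (k : Fin m)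
  | y (i : Fin n)
  | L (i : Fin n)
  | R (i : Fin n)

/-- First address of the Gaussian vector. -/
def gBase (n m : ℕ) : ℕ := n * m + 13

/-- First address of the projections. -/
def yBase (n m : ℕ) : ℕ := n * m + 13 + m

/-- First address of the left indicator vector. -/
def lBase (n m : ℕ) : ℕ := n * m + 13 + m + n

/-- First address of the right indicator vector. -/
def rBase (n m : ℕ) : ℕ := n * m + 13 + m + n + n

variable {n m : ℕ}

/-- The address of a memory cell. -/
def addr : Loc n m → ℕ
  | .data i k => i * m + k
  | .sc k => n * m + k
  | .g k => gBase n m + k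
  | .y i => yBase n m + i
  | .L i => lBase n m + i
  | .R i => rBase n m + i

theorem mul_add_lt (i : Fin n) (k : Fin m) : (i : ℕ) * m + k < n * m := by
  have h : ((i : ℕ) + 1) * m ≤ n * m := Nat.mul_le_mul_right m i.2
  rw [add_mul, one_mul] at h
  omega

theorem mul_add_inj {i j : Fin n} {k l : Fin m} (h : (i : ℕ) * m + k = j * m + l) :
    i = j ∧ k = l := by
  have h' : finProdFinEquiv (i, k) = finProdFinEquiv (j, l) := by
    ext
    simp only [finProdFinEquiv_apply_val]
    rw [mul_comm m, mul_comm m]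
    omega
  simpa using finProdFinEquiv.injective h'

/-- Reduces aliasing of memory cells to inequality of constructors of `Loc`, which `simp` settles.
-/
theorem addr_injective : Function.Injective (addr : Loc n m → ℕ) := by
  intro a b h
  rcases a with ⟨i, k⟩ | ⟨k⟩ | ⟨k⟩ | ⟨i⟩ | ⟨i⟩ | ⟨i⟩ <;>
  rcases b with ⟨i', k'⟩ | ⟨k'⟩ | ⟨k'⟩ | ⟨i'⟩ | ⟨i'⟩ | ⟨i'⟩ <;>
  simp only [addr, gBase, yBase, lBase, rBase] at h
  case data.data => obtain ⟨rfl, rfl⟩ := mul_add_inj h; rfl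
  case sc.sc => congr 1; ext; omega
  case g.g => congr 1; ext; omega
  case y.y => congr 1; ext; omega
  case L.L => congr 1; ext; omega
  case R.R => congr 1; ext; omega
  all_goals first
    | (exfalso; omega)
    | (exfalso; have := mul_add_lt i k; omega)
    | (exfalso; have := mul_add_lt i' k'; omega)

@[simp]
theorem addr_inj {a b : Loc n m} : addr a = addr b ↔ a = b := addr_injective.eq_iff

/-- The registers that keep their value after the set-up. -/
structure Regs (n m : ℕ) (r : ℕ → ℕ) : Prop where
  r0 : r 0 = n
  r1 : r 1 = m
  r3 : r 3 = lBase n m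
  r4 : r 4 = rBase n m
  r5 : r 5 = 1
  r9 : r 9 = gBase n m
  r10 : r 10 = yBase n m
  r16 : r 16 = addr (.sc 0 : Loc n m)
  r17 : r 17 = addr (.sc 1 : Loc n m)
  r18 : r 18 = addr (.sc 2 : Loc n m)
  r19 : r 19 = addr (.sc 3 : Loc n m)
  r20 : r 20 = addr (.sc 4 : Loc n m)
  r21 : r 21 = addr (.sc 5 : Loc n m)
  r22 : r 22 = addr (.sc 6 : Loc n m)
  r23 : r 23 = addr (.sc 7 : Loc n m)
  r24 : r 24 = addr (.sc 8 : Loc n m)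
  r25 : r 25 = addr (.sc 9 : Loc n m)
  r26 : r 26 = addr (.sc 10 : Loc n m)
  r27 : r 27 = addr (.sc 11 : Loc n m)
  r28 : r 28 = addr (.sc 12 : Loc n m)
  r30 : r 30 = 0

/-- The listed registers are the working ones: 2 is the success flag, 6, 7, 8 and 29 are loop
counters (7 also counts the doublings in `logLoop`), 11 serves the set-up, and 12 to 15 hold
addresses. -/
theorem Regs.update {r : ℕ → ℕ} (h : Regs n m r) {x k : ℕ}
    (hx : x ∈ [2, 6, 7, 8, 11, 12, 13, 14, 15, 29]) : Regs n m (Function.update r x k) := by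
  obtain ⟨⟩ := h
  simp only [List.mem_cons, List.not_mem_nil, or_false] at hx
  rcases hx with rfl | rfl | rfl | rfl | rfl | rfl | rfl | rfl | rfl | rfl <;>
  constructor <;> simpa

end RealRAM

/-! ### The programs -/

namespace RealRAM

variable {n m : ℕ} {ω : ℕ → ℝ}

theorem Regs.congr {r r' : ℕ → ℕ} (h : Regs n m r)
    (hr : ∀ x ∉ [2, 6, 7, 8, 11, 12, 13, 14, 15, 29], r' x = r x) : Regs n m r' := by
  obtain ⟨⟩ := h
  constructor <;> rw [hr _ (by decide)] <;> assumption

/-- `s'` differs from `s` only in the registers `xs` and the cells `ls`. -/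
structure Frame (xs : List ℕ) (ls : Set (Loc n m)) (s s' : State) : Prop where
  reg : ∀ x ∉ xs, s'.reg x = s.reg x
  mem : ∀ l ∉ ls, s'.mem (addr l) = s.mem (addr l)

theorem Frame.trans {xs : List ℕ} {ls : Set (Loc n m)} {s s' s'' : State} (h : Frame xs ls s s')
    (h' : Frame xs ls s' s'') : Frame xs ls s s'' :=
  ⟨fun x hx => (h'.reg x hx).trans (h.reg x hx), fun l hl => (h'.mem l hl).trans (h.mem l hl)⟩

/-- The sum of the first `k` values of `f`. -/
def partialSum (f : Fin m → ℝ) (k : ℕ) : ℝ :=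
  ∑ l ∈ Finset.range k, if h : l < m then f ⟨l, h⟩ else 0

theorem partialSum_zero (f : Fin m → ℝ) : partialSum f 0 = 0 := by simp [partialSum]

theorem partialSum_succ (f : Fin m → ℝ) (k : Fin m) :
    partialSum f (k + 1) = partialSum f k + f k := by
  simp [partialSum, Finset.sum_range_succ]

theorem partialSum_self (f : Fin m → ℝ) : partialSum f m = ∑ k, f k := by
  simp [partialSum, Finset.sum_range]

/-- Scratch cell `0` receives the inner product of the Gaussian vector with the row whose address
is in register `12`. -/
def dotLoop : Program :=
  .seq (.block [.setReal 16 0, .addNat 14 12 30])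
    (.forLoop 8 1 (.block [.addNat 15 9 8, .mul 17 14 15, .add 16 16 17, .addNat 14 14 5]))

/-- Scratch cell `0` receives the squared distance of the rows whose addresses are in registers
`12` and `13`. -/
def distLoop : Program :=
  .seq (.block [.setReal 16 0, .addNat 14 12 30, .addNat 15 13 30])
    (.forLoop 8 1 (.block [.sub 17 14 15, .mul 17 17 17, .add 16 16 17, .addNat 14 14 5,
      .addNat 15 15 5]))

theorem gBase_add (k : Fin m) : gBase n m + k = addr (.g k : Loc n m) := rfl

theorem yBase_add (i : Fin n) : yBase n m + i = addr (.y i : Loc n m) := rfl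

theorem lBase_add (i : Fin n) : lBase n m + i = addr (.L i : Loc n m) := rfl

theorem rBase_add (i : Fin n) : rBase n m + i = addr (.R i : Loc n m) := rfl

theorem data_addr (i : Fin n) (k : Fin m) : (i : ℕ) * m + k = addr (.data i k : Loc n m) := rfl

theorem runs_dotLoop {s : State} (hs : Regs n m s.reg) (i : Fin n) (hi : s.reg 12 = i * m) :
    Runs ω dotLoop s (m * 7 + 5) fun s' =>
      Frame (n := n) (m := m) [8, 14, 15] {.sc 0, .sc 1} s s' ∧ s'.mem (addr (.sc 0 : Loc n m))
        = ∑ k, s.mem (addr (.data i k : Loc n m)) * s.mem (addr (.g k : Loc n m)) := by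
  set f : Fin m → ℝ := fun k => s.mem (addr (.data i k : Loc n m)) * s.mem (addr (.g k : Loc n m))
    with hf
  refine Runs.mono (Runs.seq (R := fun s' => Frame (n := n) (m := m) [8, 14, 15] {.sc 0, .sc 1} s s'
    ∧ s'.mem (addr (.sc 0 : Loc n m)) = 0 ∧ s'.reg 14 = i * m) (Runs.block ?_) fun s₁ hs₁ =>
    Runs.forLoop (N := m) (T := 5)
    (Inv := fun k s' => Frame (n := n) (m := m) [8, 14, 15] {.sc 0, .sc 1} s s' ∧ s'.reg 8 = k ∧
      s'.reg 14 = i * m + k ∧ s'.mem (addr (.sc 0 : Loc n m)) = partialSum f k) ?_ ?_ ?_) ?_ ?_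
  · simp only [List.foldl, Instr.apply, State.setReg, State.setCell]
    refine ⟨⟨?_, ?_⟩, ?_, ?_⟩
    · intro x hx
      simp at hx
      simp [hx]
    · intro l hl
      simp at hl
      simp [hs.r16, hl]
    · simp [hs.r16]
    · simp [hi, hs.r30]
  · obtain ⟨h1, h2, h3⟩ := hs₁
    refine ⟨⟨?_, h1.mem⟩, ?_, ?_, ?_⟩
    · intro x hx
      have := h1.reg x hx
      simp at hx
      simpa [State.setReg, Function.update_apply, hx] using this
    · simp [State.setReg]
    · simp [State.setReg, h3]
    · simp [State.setReg, h2, partialSum_zero]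
  · rintro k s' ⟨h1, h2, -⟩
    exact ⟨h2, (h1.reg 1 (by decide)).trans hs.r1⟩
  · rintro k s' ⟨h1, h2, h3, h4⟩
    have hr : Regs n m s'.reg := hs.congr fun x hx => h1.reg x fun h => hx (by simp at h ⊢; omega)
    refine Runs.block ?_
    simp only [List.foldl, Instr.apply, State.setReg, State.setCell, State.cell]
    refine ⟨⟨?_, ?_⟩, ?_, ?_, ?_⟩
    · intro x hx
      have := h1.reg x hx
      simp at hx
      simpa [Function.update_apply, hx] using this
    · intro l hl
      have := h1.mem l hl
      simp at hl
      simpa [Function.update_apply, hr.r16, hr.r17, hl] using this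
    · simp [h2, hr.r5]
    · simp [h3, hr.r5, add_assoc]
    · have e1 := h1.mem (.data i k) (by simp)
      have e2 := h1.mem (.g k) (by simp)
      simp [hr.r16, hr.r17, hr.r9, h2, h3, gBase_add, data_addr, h4, e1, e2,
        partialSum_succ, hf]
  · simp; omega
  · rintro s' ⟨h1, -, -, h4⟩
    exact ⟨h1, by rw [h4, partialSum_self]⟩

theorem runs_distLoop {s : State} (hs : Regs n m s.reg) (i j : Fin n) (hi : s.reg 12 = i * m)
    (hj : s.reg 13 = j * m) :
    Runs ω distLoop s (m * 8 + 6) fun s' =>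
      Frame (n := n) (m := m) [8, 14, 15] {.sc 0, .sc 1} s s' ∧ s'.mem (addr (.sc 0 : Loc n m))
        = ∑ k, (s.mem (addr (.data i k : Loc n m)) - s.mem (addr (.data j k : Loc n m))) ^ 2 := by
  set f : Fin m → ℝ := fun k =>
    (s.mem (addr (.data i k : Loc n m)) - s.mem (addr (.data j k : Loc n m))) ^ 2 with hf
  refine Runs.mono (Runs.seq (R := fun s' => Frame (n := n) (m := m) [8, 14, 15] {.sc 0, .sc 1} s s'
    ∧ s'.mem (addr (.sc 0 : Loc n m)) = 0 ∧ s'.reg 14 = i * m ∧ s'.reg 15 = j * m)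
    (Runs.block ?_) fun s₁ hs₁ => Runs.forLoop (N := m) (T := 6)
    (Inv := fun k s' => Frame (n := n) (m := m) [8, 14, 15] {.sc 0, .sc 1} s s' ∧ s'.reg 8 = k ∧
      s'.reg 14 = i * m + k ∧ s'.reg 15 = j * m + k ∧
      s'.mem (addr (.sc 0 : Loc n m)) = partialSum f k) ?_ ?_ ?_) ?_ ?_
  · simp only [List.foldl, Instr.apply, State.setReg, State.setCell]
    refine ⟨⟨?_, ?_⟩, ?_, ?_, ?_⟩
    · intro x hx
      simp at hx
      simp [hx]
    · intro l hl
      simp at hl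
      simp [hs.r16, hl]
    · simp [hs.r16]
    · simp [hi, hs.r30]
    · simp [hj, hs.r30]
  · obtain ⟨h1, h2, h3, h3'⟩ := hs₁
    refine ⟨⟨?_, h1.mem⟩, ?_, ?_, ?_, ?_⟩
    · intro x hx
      have := h1.reg x hx
      simp at hx
      simpa [State.setReg, Function.update_apply, hx] using this
    · simp [State.setReg]
    · simp [State.setReg, h3]
    · simp [State.setReg, h3']
    · simp [State.setReg, h2, partialSum_zero]
  · rintro k s' ⟨h1, h2, -⟩
    exact ⟨h2, (h1.reg 1 (by decide)).trans hs.r1⟩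
  · rintro k s' ⟨h1, h2, h3, h3', h4⟩
    have hr : Regs n m s'.reg := hs.congr fun x hx => h1.reg x fun h => hx (by simp at h ⊢; omega)
    refine Runs.block ?_
    simp only [List.foldl, Instr.apply, State.setReg, State.setCell, State.cell]
    refine ⟨⟨?_, ?_⟩, ?_, ?_, ?_, ?_⟩
    · intro x hx
      have := h1.reg x hx
      simp at hx
      simpa [Function.update_apply, hx] using this
    · intro l hl
      have := h1.mem l hl
      simp at hl
      simpa [Function.update_apply, hr.r16, hr.r17, hl] using this
    · simp [h2, hr.r5]
    · simp [h3, hr.r5, add_assoc]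
    · simp [h3', hr.r5, add_assoc]
    · have e1 := h1.mem (.data i k) (by simp)
      have e2 := h1.mem (.data j k) (by simp)
      simp [hr.r16, hr.r17, h3, h3', data_addr, h4, e1, e2,
        partialSum_succ, hf, sq]
  · simp; omega
  · rintro s' ⟨h1, -, -, -, h4⟩
    exact ⟨h1, by rw [h4, partialSum_self]⟩

end RealRAM

/-! ### Indicator vectors and sizes of the two sides -/

namespace RealRAM

open ARV

variable {n m : ℕ} {ω : ℕ → ℝ}

theorem Frame.mono {xs xs' : List ℕ} {ls ls' : Set (Loc n m)} {s s' : State}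
    (h : Frame xs ls s s') (hx : ∀ x ∈ xs, x ∈ xs') (hl : ls ⊆ ls') : Frame xs' ls' s s' :=
  ⟨fun x hx' => h.reg x fun h' => hx' (hx x h'), fun l hl' => h.mem l fun h' => hl' (hl h')⟩

/-- The cells that are written to after the projections have been computed. -/
def workCells (n m : ℕ) : Set (Loc n m) :=
  {l | l = .sc 0 ∨ l = .sc 1 ∨ l = .sc 6 ∨ l = .sc 7 ∨ l = .sc 8 ∨ (∃ i, l = .L i) ∨ ∃ i, l = .R i}

/-- The set-up is complete and the projections `y` have been computed. -/
structure Ready (v : Fin n → EuclideanSpace ℝ (Fin m)) (y : Fin n → ℝ) (c κ : ℝ) (s : State) :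
    Prop where
  regs : Regs n m s.reg
  data : ∀ i k, s.mem (addr (.data i k : Loc n m)) = v i k
  y : ∀ i, s.mem (addr (.y i : Loc n m)) = y i
  one : s.mem (addr (.sc 4 : Loc n m)) = 1
  zero : s.mem (addr (.sc 5 : Loc n m)) = 0
  cn : s.mem (addr (.sc 9 : Loc n m)) = c * n
  half : s.mem (addr (.sc 10 : Loc n m)) = c / 2 * n
  ell : s.mem (addr (.sc 11 : Loc n m)) = Nat.clog 2 n
  kap : s.mem (addr (.sc 12 : Loc n m)) = κ ^ 2

variable {v : Fin n → EuclideanSpace ℝ (Fin m)} {y : Fin n → ℝ} {c κ : ℝ}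

theorem Ready.of_frame {s s' : State} (h : Ready v y c κ s)
    (hf : Frame (n := n) (m := m) [6, 7, 8, 12, 13, 14, 15] (workCells n m) s s') :
    Ready v y c κ s' where
  regs := h.regs.congr fun x hx => hf.reg x fun h => hx (by simp at h ⊢; omega)
  data i k := (hf.mem _ (by simp [workCells])).trans (h.data i k)
  y i := (hf.mem _ (by simp [workCells])).trans (h.y i)
  one := (hf.mem _ (by simp [workCells])).trans h.one
  zero := (hf.mem _ (by simp [workCells])).trans h.zero
  cn := (hf.mem _ (by simp [workCells])).trans h.cn
  half := (hf.mem _ (by simp [workCells])).trans h.half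
  ell := (hf.mem _ (by simp [workCells])).trans h.ell
  kap := (hf.mem _ (by simp [workCells])).trans h.kap

/-- Write the truth value of a test to a cell, and add it to a counter. -/
def markIf (b : Test) (x z : ℕ) : Program :=
  .ite b (.block [.copy x 20, .add z z 20]) (.block [.copy x 21])

open Classical in
-- The cell `.sc 4` is excluded as a target because the constant 1 in it is read again for the
-- counter.
theorem runs_markIf {s : State} (hs : Ready v y c κ s) (b : Test) {x z : ℕ} {l lz : Loc n m}
    (hx : s.reg x = addr l) (hz : s.reg z = addr lz) (hl : l ≠ lz) (hl' : l ≠ .sc 4) :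
    Runs ω (markIf b x z) s 4 fun s' => s'.reg = s.reg ∧
      s'.mem (addr l) = (if b.Holds s then 1 else 0) ∧
      s'.mem (addr lz) = s.mem (addr lz) + (if b.Holds s then 1 else 0) ∧
      ∀ l', l' ≠ l → l' ≠ lz → s'.mem (addr l') = s.mem (addr l') := by
  refine Runs.ite (T := 3) (fun h => Runs.block ?_) fun h => (Runs.block ?_).mono
    (by simp) fun _ h => h
  · simp only [List.foldl, Instr.apply, State.setCell, State.cell, hs.regs.r20, hx, hz, h, if_true,
      true_and]
    refine ⟨?_, ?_, ?_⟩
    · simp [Function.update_apply, hl, hs.one]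
    · simp [hl.symm, hl'.symm, hs.one]
    · intro l' h1 h2
      simp [Function.update_apply, h1, h2]
  · simp only [List.foldl, Instr.apply, State.setCell, State.cell, hs.regs.r21, hx, h, if_false,
      true_and]
    refine ⟨?_, ?_, ?_⟩
    · simp [hs.zero]
    · simp [hl.symm]
    · intro l' h1 h2
      simp [h1]

/-- Compute the indicator vectors and the sizes of the two sides of the cut, with the thresholds
in scratch cells `2` and `3`. -/
def classify : Program :=
  .seq (.block [.setReal 22 0, .setReal 23 0]) (.forLoop 6 0
    (.seq (.block [.addNat 13 10 6, .addNat 14 3 6, .addNat 15 4 6])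
      (.seq (markIf (.realLE 13 18) 14 22) (markIf (.realLE 19 13) 15 23))))

theorem partialSum_indicator (p : Fin n → Prop) [DecidablePred p] :
    partialSum (fun i => if p i then 1 else 0) n = ((Finset.univ.filter p).card : ℝ) := by
  rw [partialSum_self]
  simp

open Classical in
-- Nothing is assumed about the old indicator cells and counters: all are overwritten, so leftovers
-- of an earlier cut are harmless.
theorem runs_classify {s : State} (hs : Ready v y c κ s) {a b : ℝ}
    (ha : s.mem (addr (.sc 2 : Loc n m)) = a) (hb : s.mem (addr (.sc 3 : Loc n m)) = b) :
    Runs ω classify s (n * 14 + 5) fun s' =>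
      Frame (n := n) (m := m) [6, 13, 14, 15] (workCells n m) s s' ∧
      (∀ i, s'.mem (addr (.L i : Loc n m)) = if i ∈ below y a then 1 else 0) ∧
      (∀ i, s'.mem (addr (.R i : Loc n m)) = if i ∈ above y b then 1 else 0) ∧
      s'.mem (addr (.sc 6 : Loc n m)) = (below y a).card ∧
      s'.mem (addr (.sc 7 : Loc n m)) = (above y b).card := by
  set f : Fin n → ℝ := fun i => if y i ≤ a then 1 else 0 with hf
  set f' : Fin n → ℝ := fun i => if b ≤ y i then 1 else 0 with hf'
  refine Runs.mono (Runs.seq (R := fun s' => Frame (n := n) (m := m) [6, 13, 14, 15]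
    (workCells n m) s s' ∧ s'.mem (addr (.sc 6 : Loc n m)) = 0 ∧
      s'.mem (addr (.sc 7 : Loc n m)) = 0) (Runs.block ?_) fun s₁ hs₁ =>
    Runs.forLoop (N := n) (T := 12) (Inv := fun k s' =>
      Frame (n := n) (m := m) [6, 13, 14, 15] (workCells n m) s s' ∧ s'.reg 6 = k ∧
      (∀ i : Fin n, (i : ℕ) < k → s'.mem (addr (.L i : Loc n m)) = f i) ∧
      (∀ i : Fin n, (i : ℕ) < k → s'.mem (addr (.R i : Loc n m)) = f' i) ∧
      s'.mem (addr (.sc 6 : Loc n m)) = partialSum f k ∧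
      s'.mem (addr (.sc 7 : Loc n m)) = partialSum f' k) ?_ ?_ ?_) ?_ ?_
  · simp only [List.foldl, Instr.apply, State.setCell]
    refine ⟨⟨fun _ _ => rfl, ?_⟩, ?_, ?_⟩
    · intro l hl
      simp [workCells] at hl
      simp [hs.regs.r22, hs.regs.r23, hl]
    · simp [hs.regs.r22, hs.regs.r23]
    · simp [hs.regs.r23]
  · obtain ⟨h1, h2, h3⟩ := hs₁
    refine ⟨⟨?_, h1.mem⟩, ?_, ?_, ?_, ?_, ?_⟩
    · intro x hx
      have := h1.reg x hx
      simp at hx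
      simpa [State.setReg, Function.update_apply, hx] using this
    · simp [State.setReg]
    · simp
    · simp
    · simp [State.setReg, h2, partialSum_zero]
    · simp [State.setReg, h3, partialSum_zero]
  · rintro k s' ⟨h1, h2, -⟩
    exact ⟨h2, (h1.reg 0 (by decide)).trans hs.regs.r0⟩
  · rintro k s' ⟨h1, h2, h3, h4, h5, h6⟩
    have hr : Ready v y c κ s' := hs.of_frame (h1.mono (by decide) subset_rfl)
    have hla := (h1.mem (.sc 2) (by simp [workCells])).trans ha
    have hlb := (h1.mem (.sc 3) (by simp [workCells])).trans hb
    refine Runs.mono (T := 4 + (4 + 4)) (Runs.seq (R := fun s₁ => s₁.mem = s'.mem ∧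
      (∀ x ∉ [13, 14, 15], s₁.reg x = s'.reg x) ∧ s₁.reg 13 = addr (.y k : Loc n m) ∧
      s₁.reg 14 = addr (.L k : Loc n m) ∧ s₁.reg 15 = addr (.R k : Loc n m)) (Runs.block ?_) ?_)
      le_rfl fun _ h => h
    · simp only [List.foldl, Instr.apply, State.setReg, true_and]
      refine ⟨?_, ?_, ?_, ?_⟩
      · intro x hx
        simp at hx
        simp [hx]
      · simp [hr.regs.r10, h2, yBase_add]
      · simp [hr.regs.r3, h2, lBase_add]
      · simp [hr.regs.r4, h2, rBase_add]
    rintro s₁ ⟨e1, e2, e3, e4, e5⟩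
    have hf₁ : Frame (n := n) (m := m) [6, 13, 14, 15] (workCells n m) s s₁ :=
      h1.trans ⟨fun x hx => e2 x (by simp at hx ⊢; tauto), fun l _ => by rw [e1]⟩
    have hr₁ : Ready v y c κ s₁ := hs.of_frame (hf₁.mono (by decide) subset_rfl)
    refine Runs.seq (runs_markIf hr₁ (.realLE 13 18) e4 hr₁.regs.r22 (by simp) (by simp)) ?_
    rintro s₂ ⟨u1, u2, u3, u4⟩
    have hf₂ : Frame (n := n) (m := m) [6, 13, 14, 15] (workCells n m) s s₂ :=
      hf₁.trans ⟨fun x _ => by rw [u1], fun l hl => u4 l (by rintro rfl; simp [workCells] at hl)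
        (by rintro rfl; simp [workCells] at hl)⟩
    have hr₂ : Ready v y c κ s₂ := hs.of_frame (hf₂.mono (by decide) subset_rfl)
    have e5' : s₂.reg 15 = addr (.R k : Loc n m) := by rw [u1, e5]
    refine Runs.mono (runs_markIf hr₂ (.realLE 19 13) e5' hr₂.regs.r23 (by simp) (by simp))
      le_rfl ?_
    rintro s₃ ⟨w1, w2, w3, w4⟩
    have t1 : (Test.realLE 13 18).Holds s₁ ↔ y k ≤ a := by
      simp only [Test.Holds, State.cell, e3, hr₁.regs.r18, hr₁.y, e1, hla]
    have t2 : (Test.realLE 19 13).Holds s₂ ↔ b ≤ y k := by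
      simp only [Test.Holds, State.cell, u1, e3, hr₁.regs.r19, hr₂.y]
      rw [u4 _ (by simp) (by simp), e1, hlb]
    have hf₃ : Frame (n := n) (m := m) [6, 13, 14, 15] (workCells n m) s s₃ :=
      hf₂.trans ⟨fun x _ => by rw [w1], fun l hl => w4 l (by rintro rfl; simp [workCells] at hl)
        (by rintro rfl; simp [workCells] at hl)⟩
    have hk : s₃.reg 6 = k := by rw [w1, u1, e2 6 (by decide), h2]
    have h5' : s₃.reg 5 = 1 := by rw [w1, u1, hr₁.regs.r5]
    have hmem : (s₃.setReg 6 (s₃.reg 6 + s₃.reg 5)).mem = s₃.mem := rfl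
    rw [hmem]
    refine ⟨⟨?_, hf₃.mem⟩, ?_, ?_, ?_, ?_, ?_⟩
    · intro x hx
      have := hf₃.reg x hx
      simp at hx
      simpa [State.setReg, Function.update_apply, hx] using this
    · simp [State.setReg, hk, h5']
    · intro i hi
      rw [w4 _ (by simp) (by simp)]
      by_cases hik : i = k
      · rw [hik, u2, t1]
      · rw [u4 _ (by simpa using hik) (by simp), e1]
        exact h3 i (by have : (i : ℕ) ≠ k := fun h => hik (Fin.ext h); omega)
    · intro i hi
      by_cases hik : i = k
      · rw [hik, w2, t2]
      · rw [w4 _ (by simpa using hik) (by simp), u4 _ (by simp) (by simp), e1]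
        exact h4 i (by have : (i : ℕ) ≠ k := fun h => hik (Fin.ext h); omega)
    · rw [w4 _ (by simp) (by simp), u3, e1, h5, t1, partialSum_succ]
    · rw [w3, u4 _ (by simp) (by simp), e1, h6, t2, partialSum_succ]
  · simp; omega
  · rintro s' ⟨h1, -, h3, h4, h5, h6⟩
    refine ⟨h1, fun i => ?_, fun i => ?_, ?_, ?_⟩
    · rw [h3 i i.2]; simp [hf, below]
    · rw [h4 i i.2]; simp [hf', above]
    · rw [h5, hf, partialSum_indicator]
      congr
    · rw [h6, hf', partialSum_indicator]
      congr

end RealRAM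

/-! ### Greedy construction of a maximal matching -/

namespace RealRAM

open ARV

variable {n m : ℕ} {ω : ℕ → ℝ}

open Classical in
/-- The arrays `fL` and `fR` describe the elements of `L` and `R` left over by a matching that is
maximal among the pairs in `done`. -/
def GreedyInv (v : Fin n → EuclideanSpace ℝ (Fin m)) (Δ : ℝ) (L R : Finset (Fin n))
    (done : Fin n → Fin n → Prop) (fL fR : Fin n → ℝ) (cnt : ℝ) : Prop :=
  ∃ M : Finset (Fin n × Fin n), IsShortMatching v Δ L R M ∧
    (∀ i, fL i = if i ∈ L ∧ ∀ e ∈ M, e.1 ≠ i then 1 else 0) ∧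
    (∀ i, fR i = if i ∈ R ∧ ∀ e ∈ M, e.2 ≠ i then 1 else 0) ∧ cnt = M.card ∧
    ∀ i j, done i j → i ∈ L → j ∈ R → sqDist v i j ≤ Δ → (∃ e ∈ M, e.1 = i) ∨ ∃ e ∈ M, e.2 = j

variable {v : Fin n → EuclideanSpace ℝ (Fin m)} {y : Fin n → ℝ} {c κ Δ : ℝ}
  {L R : Finset (Fin n)} {done : Fin n → Fin n → Prop} {fL fR : Fin n → ℝ} {cnt : ℝ}

open Classical in
theorem GreedyInv.start (hL : ∀ i, fL i = if i ∈ L then 1 else 0)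
    (hR : ∀ i, fR i = if i ∈ R then 1 else 0) :
    GreedyInv v Δ L R (fun _ _ => False) fL fR 0 :=
  ⟨∅, by simp [IsShortMatching], by simp [hL], by simp [hR], by simp, by simp⟩

theorem GreedyInv.mono {done' : Fin n → Fin n → Prop} (h : GreedyInv v Δ L R done fL fR cnt)
    (hd : ∀ i j, done' i j → done i j) : GreedyInv v Δ L R done' fL fR cnt := by
  obtain ⟨M, h1, h2, h3, h4, h5⟩ := h
  exact ⟨M, h1, h2, h3, h4, fun i j hij => h5 i j (hd i j hij)⟩

open Classical in
-- A pair that is not added is too long or has a covered end, and covered elements stay covered.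
-- Hence a single pass over all pairs yields maximality.
theorem GreedyInv.step (h : GreedyInv v Δ L R done fL fR cnt) (i j : Fin n) {fL' fR' : Fin n → ℝ}
    {cnt' : ℝ}
    (hL : ∀ k, fL' k = if (1 ≤ fL i ∧ 1 ≤ fR j ∧ sqDist v i j ≤ Δ) ∧ k = i then 0 else fL k)
    (hR : ∀ k, fR' k = if (1 ≤ fL i ∧ 1 ≤ fR j ∧ sqDist v i j ≤ Δ) ∧ k = j then 0 else fR k)
    (hc : cnt' = if 1 ≤ fL i ∧ 1 ≤ fR j ∧ sqDist v i j ≤ Δ then cnt + 1 else cnt) :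
    GreedyInv v Δ L R (fun i' j' => done i' j' ∨ i' = i ∧ j' = j) fL' fR' cnt' := by
  obtain ⟨M, h1, h2, h3, h4, h5⟩ := h
  have hLi : 1 ≤ fL i ↔ i ∈ L ∧ ∀ e ∈ M, e.1 ≠ i := by
    rw [h2]
    split_ifs with h
    exacts [iff_of_true le_rfl h, iff_of_false (by norm_num) h]
  have hRj : 1 ≤ fR j ↔ j ∈ R ∧ ∀ e ∈ M, e.2 ≠ j := by
    rw [h3]
    split_ifs with h
    exacts [iff_of_true le_rfl h, iff_of_false (by norm_num) h]
  by_cases hC : 1 ≤ fL i ∧ 1 ≤ fR j ∧ sqDist v i j ≤ Δ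
  · simp only [hC, if_true, true_and] at hL hR hc
    obtain ⟨hi, hj, hd⟩ := hC
    rw [hLi] at hi
    rw [hRj] at hj
    refine ⟨insert (i, j) M, h1.insert hi.1 hj.1 hd hi.2 hj.2, fun k => ?_, fun k => ?_, ?_, ?_⟩
    · rw [hL, h2]
      by_cases hk : k = i
      · subst hk; simp
      · simp [hk, Ne.symm hk]
    · rw [hR, h3]
      by_cases hk : k = j
      · subst hk; simp
      · simp [hk, Ne.symm hk]
    · rw [hc, h4, Finset.card_insert_of_notMem fun h => hi.2 _ h rfl]
      simp
    · rintro i' j' (h | ⟨rfl, rfl⟩) a1 a2 a3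
      · rcases h5 i' j' h a1 a2 a3 with ⟨e, he, h⟩ | ⟨e, he, h⟩
        · exact .inl ⟨e, Finset.mem_insert_of_mem he, h⟩
        · exact .inr ⟨e, Finset.mem_insert_of_mem he, h⟩
      · exact .inl ⟨_, Finset.mem_insert_self _ _, rfl⟩
  · simp only [hC, if_false, false_and] at hL hR hc
    refine ⟨M, h1, fun k => by rw [hL, h2], fun k => by rw [hR, h3], by rw [hc, h4], ?_⟩
    rintro i' j' (h | ⟨rfl, rfl⟩) a1 a2 a3
    · exact h5 i' j' h a1 a2 a3
    · by_contra! H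
      exact hC ⟨hLi.2 ⟨a1, H.1⟩, hRj.2 ⟨a2, H.2⟩, a3⟩

/-- A pair in a larger matching shares an element with some pair of `M`, and therefore equals it. -/
theorem GreedyInv.maximal {M : Finset (Fin n × Fin n)} (h1 : IsShortMatching v Δ L R M)
    (h : ∀ i j, i ∈ L → j ∈ R → sqDist v i j ≤ Δ → (∃ e ∈ M, e.1 = i) ∨ ∃ e ∈ M, e.2 = j) :
    Maximal (IsShortMatching v Δ L R) M := by
  refine ⟨h1, fun M' hM' hle e he => ?_⟩
  obtain ⟨a1, a2, a3⟩ := hM'.1 e he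
  rcases h e.1 e.2 a1 a2 a3 with ⟨f, hf, hfe⟩ | ⟨f, hf, hfe⟩
  · rw [hM'.2 e he f (hle hf) (.inl hfe.symm)]; exact hf
  · rw [hM'.2 e he f (hle hf) (.inr hfe.symm)]; exact hf

/-- Match the current pair if both elements are free and their distance is small. -/
def matchStep : Program :=
  .ite (.realLE 20 14) (.ite (.realLE 20 15) (.ite (.realLE 16 28)
    (.block [.copy 14 21, .copy 15 21, .add 24 24 20]) (.block [])) (.block [])) (.block [])

open Classical in
-- The condition is an abstract `C`, so that the comparison of scratch cells can be replaced by one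
-- between `sqDist` and `threshold`.
theorem runs_matchStep {s : State} (hs : Ready v y c κ s) {i j : Fin n}
    (hi : s.reg 14 = addr (.L i : Loc n m)) (hj : s.reg 15 = addr (.R j : Loc n m)) {C : Prop}
    (hC : C ↔ 1 ≤ s.mem (addr (.L i : Loc n m)) ∧ 1 ≤ s.mem (addr (.R j : Loc n m)) ∧
      s.mem (addr (.sc 0 : Loc n m)) ≤ κ ^ 2) :
    Runs ω matchStep s 7 fun s' => s'.reg = s.reg ∧
      (∀ k, s'.mem (addr (.L k : Loc n m))
        = if C ∧ k = i then 0 else s.mem (addr (.L k : Loc n m))) ∧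
      (∀ k, s'.mem (addr (.R k : Loc n m))
        = if C ∧ k = j then 0 else s.mem (addr (.R k : Loc n m))) ∧
      s'.mem (addr (.sc 8 : Loc n m))
        = (if C then s.mem (addr (.sc 8 : Loc n m)) + 1 else s.mem (addr (.sc 8 : Loc n m))) ∧
      ∀ l ∉ workCells n m, s'.mem (addr l) = s.mem (addr l) := by
  have t1 : (Test.realLE 20 14).Holds s ↔ 1 ≤ s.mem (addr (.L i : Loc n m)) := by
    simp only [Test.Holds, State.cell, hs.regs.r20, hi, hs.one]
  have t2 : (Test.realLE 20 15).Holds s ↔ 1 ≤ s.mem (addr (.R j : Loc n m)) := by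
    simp only [Test.Holds, State.cell, hs.regs.r20, hj, hs.one]
  have t3 : (Test.realLE 16 28).Holds s ↔ s.mem (addr (.sc 0 : Loc n m)) ≤ κ ^ 2 := by
    simp only [Test.Holds, State.cell, hs.regs.r16, hs.regs.r28, hs.kap]
  refine Runs.ite (T := 6) (fun b1 => Runs.ite (T := 5) (fun b2 => Runs.ite (T := 4)
    (fun b3 => Runs.block ?_) fun b3 => (Runs.block ?_).mono (by simp) fun _ h => h)
    fun b2 => (Runs.block ?_).mono (by simp) fun _ h => h)
    fun b1 => (Runs.block ?_).mono (by simp) fun _ h => h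
  · have hC' : C := hC.2 ⟨t1.1 b1, t2.1 b2, t3.1 b3⟩
    simp only [List.foldl, Instr.apply, State.setCell, State.cell, hs.regs.r21, hs.regs.r24,
      hs.regs.r20, hi, hj, hC', if_true, true_and]
    refine ⟨?_, ?_, ?_, ?_⟩
    · intro k
      simp [Function.update_apply, hs.zero]
    · intro k
      simp [Function.update_apply, hs.zero]
    · simp [hs.one]
    · intro l hl
      simp [workCells] at hl
      simp [hl]
  · have hC' : ¬ C := fun h => b3 (t3.2 (hC.1 h).2.2)
    simp [hC']
  · have hC' : ¬ C := fun h => b2 (t2.2 (hC.1 h).2.1)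
    simp [hC']
  · have hC' : ¬ C := fun h => b1 (t1.2 (hC.1 h).1)
    simp [hC']

/-- Process one pair. -/
def pairStep : Program :=
  .seq distLoop (.seq (.block [.mul 16 16 16, .mul 16 16 27, .addNat 14 3 6, .addNat 15 4 7,
    .addNat 13 13 1]) matchStep)

/-- The state of the arrays during the greedy construction of a matching. -/
def GreedyState (v : Fin n → EuclideanSpace ℝ (Fin m)) (Δ : ℝ) (L R : Finset (Fin n))
    (done : Fin n → Fin n → Prop) (s : State) : Prop :=
  GreedyInv v Δ L R done (fun i => s.mem (addr (.L i : Loc n m)))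
    (fun i => s.mem (addr (.R i : Loc n m))) (s.mem (addr (.sc 8 : Loc n m)))

theorem sqDist_eq_sum (i j : Fin n) : sqDist v i j = ∑ k, (v i k - v j k) ^ 2 := by
  simp [sqDist, EuclideanSpace.norm_sq_eq]

theorem runs_pairStep {s : State} (hs : Ready v y c κ s) (hκ : 0 ≤ κ) (hn : 2 ≤ n) {i j : Fin n}
    (h6 : s.reg 6 = i) (h7 : s.reg 7 = j) (h12 : s.reg 12 = i * m) (h13 : s.reg 13 = j * m)
    (hg : GreedyState v (threshold κ n) L R done s) :
    Runs ω pairStep s (m * 8 + 19) fun s' =>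
      Frame (n := n) (m := m) [8, 13, 14, 15] (workCells n m) s s' ∧ s'.reg 13 = (j + 1) * m ∧
      GreedyState v (threshold κ n) L R (fun i' j' => done i' j' ∨ i' = i ∧ j' = j) s' := by
  refine Runs.mono (T := m * 8 + 6 + (6 + 7)) (Runs.seq (runs_distLoop hs.regs i j h12 h13) ?_)
    le_rfl fun _ h => h
  rintro s₁ ⟨h1, h2⟩
  have hf₁ : Frame (n := n) (m := m) [8, 13, 14, 15] (workCells n m) s s₁ :=
    h1.mono (by decide) (by rintro l (rfl | rfl) <;> simp [workCells])
  have hr₁ : Ready v y c κ s₁ := hs.of_frame (hf₁.mono (by decide) subset_rfl)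
  refine Runs.seq (R := fun s₂ => Frame (n := n) (m := m) [8, 13, 14, 15] (workCells n m) s s₂ ∧
    (∀ l : Loc n m, l ≠ .sc 0 → l ≠ .sc 1 → s₂.mem (addr l) = s.mem (addr l)) ∧
    s₂.mem (addr (.sc 0 : Loc n m)) = sqDist v i j * sqDist v i j * Nat.clog 2 n ∧
    s₂.reg 13 = (j + 1) * m ∧ s₂.reg 14 = addr (.L i : Loc n m) ∧
    s₂.reg 15 = addr (.R j : Loc n m)) (Runs.block ?_) ?_
  · simp only [List.foldl, Instr.apply, State.setReg, State.setCell, State.cell]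
    refine ⟨hf₁.trans ⟨?_, ?_⟩, ?_, ?_, ?_, ?_, ?_⟩
    · intro x hx
      simp at hx
      simp [hx]
    · intro l hl
      simp [workCells] at hl
      simp [hr₁.regs.r16, hl]
    · intro l hl hl'
      simp [hr₁.regs.r16, hl]
      exact h1.mem l (by simp [hl, hl'])
    · simp [hr₁.regs.r16, hr₁.regs.r27, h2, hr₁.ell, sqDist_eq_sum, hs.data]
    -- Register 1 holds m; adding it moves on to the next row without multiplying addresses.
    · have := h1.reg 13 (by decide)
      simp [this, h13, hr₁.regs.r1, add_mul]
    · have := h1.reg 6 (by decide)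
      simp [hr₁.regs.r3, this, h6, lBase_add]
    · have := h1.reg 7 (by decide)
      simp [hr₁.regs.r4, this, h7, rBase_add]
  rintro s₂ ⟨hf₂, e1, e2, e3, e4, e5⟩
  have hr₂ : Ready v y c κ s₂ := hs.of_frame (hf₂.mono (by decide) subset_rfl)
  refine Runs.mono (runs_matchStep hr₂ e4 e5 (C := 1 ≤ s.mem (addr (.L i : Loc n m)) ∧
    1 ≤ s.mem (addr (.R j : Loc n m)) ∧ sqDist v i j ≤ threshold κ n) ?_) le_rfl ?_
  · rw [e1 _ (by simp) (by simp), e1 _ (by simp) (by simp), e2,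
      le_threshold_iff hκ hn (sqDist_nonneg v i j)]
  rintro s₃ ⟨u1, u2, u3, u4, u5⟩
  refine ⟨hf₂.trans ⟨fun x _ => by rw [u1], u5⟩, by rw [u1, e3], ?_⟩
  refine GreedyInv.step hg i j ?_ ?_ ?_
  · intro k
    rw [u2, e1 _ (by simp) (by simp)]
    congr
  · intro k
    rw [u3, e1 _ (by simp) (by simp)]
    congr
  · rw [u4, e1 _ (by simp) (by simp)]
    congr

/-- Match greedily. -/
def greedy : Program :=
  .seq (.block [.setReal 24 0, .setNat 12 0]) (.forLoop 6 0
    (.seq (.seq (.block [.setNat 13 0]) (.forLoop 7 0 pairStep)) (.block [.addNat 12 12 1])))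

theorem runs_greedyRow {s : State} (hs : Ready v y c κ s) (hκ : 0 ≤ κ) (hn : 2 ≤ n) {i : Fin n}
    (h6 : s.reg 6 = i) (h12 : s.reg 12 = i * m)
    (hg : GreedyState v (threshold κ n) L R (fun i' _ => (i' : ℕ) < i) s) :
    Runs ω (.seq (.block [.setNat 13 0]) (.forLoop 7 0 pairStep)) s
      (2 + (n * (m * 8 + 21) + 2)) fun s' =>
      Frame (n := n) (m := m) [7, 8, 13, 14, 15] (workCells n m) s s' ∧
      GreedyState v (threshold κ n) L R (fun i' _ => (i' : ℕ) < i + 1) s' := by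
  refine Runs.mono (Runs.seq (R := fun s' => s'.mem = s.mem ∧ s'.reg 13 = 0 ∧
    ∀ x ≠ 13, s'.reg x = s.reg x) (Runs.block ?_) fun s₁ hs₁ =>
    Runs.forLoop (N := n) (T := m * 8 + 19) (Inv := fun k s' =>
      Frame (n := n) (m := m) [7, 8, 13, 14, 15] (workCells n m) s s' ∧ s'.reg 7 = k ∧
      s'.reg 13 = k * m ∧ GreedyState v (threshold κ n) L R
        (fun i' j' => (i' : ℕ) < i ∨ i' = i ∧ (j' : ℕ) < k) s') ?_ ?_ ?_) ?_ ?_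
  · simp only [List.foldl, Instr.apply, State.setReg]
    refine ⟨trivial, by simp, fun x hx => ?_⟩
    simp [hx]
  · obtain ⟨h1, h2, h3⟩ := hs₁
    refine ⟨⟨?_, fun l _ => by simp [State.setReg, h1]⟩, ?_, ?_, ?_⟩
    · intro x hx
      simp at hx
      simp [State.setReg, hx, h3]
    · simp [State.setReg]
    · simp [State.setReg, h2]
    · unfold GreedyState at hg ⊢
      simp only [State.setReg, h1]
      exact hg.mono fun i' j' h => by simpa using h
  · rintro k s' ⟨h1, h2, -⟩
    exact ⟨h2, (h1.reg 0 (by decide)).trans hs.regs.r0⟩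
  · rintro k s' ⟨h1, h2, h3, h4⟩
    have hr : Ready v y c κ s' := hs.of_frame (h1.mono (by decide) subset_rfl)
    refine Runs.mono (runs_pairStep hr hκ hn (i := i) (j := k)
      ((h1.reg 6 (by decide)).trans h6) h2 ((h1.reg 12 (by decide)).trans h12) h3 h4) le_rfl ?_
    rintro s'' ⟨u1, u2, u3⟩
    have hf : Frame (n := n) (m := m) [7, 8, 13, 14, 15] (workCells n m) s s'' :=
      h1.trans (u1.mono (by decide) subset_rfl)
    have hr' : Ready v y c κ s'' := hs.of_frame (hf.mono (by decide) subset_rfl)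
    refine ⟨⟨?_, hf.mem⟩, ?_, ?_, ?_⟩
    · intro x hx
      have := hf.reg x hx
      simp at hx
      simpa [State.setReg, hx] using this
    · have := u1.reg 7 (by decide)
      simp [State.setReg, this, h2, hr'.regs.r5]
    · simp [State.setReg, u2]
    · exact GreedyInv.mono u3 fun i' j' h => by
        rcases h with h | ⟨h, h'⟩
        · exact .inl (.inl h)
        · rcases Nat.lt_succ_iff_lt_or_eq.1 h' with h' | h'
          · exact .inl (.inr ⟨h, h'⟩)
          · exact .inr ⟨h, Fin.ext h'⟩
  · simp
  · rintro s' ⟨h1, -, -, h4⟩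
    refine ⟨h1, GreedyInv.mono h4 fun i' j' h => ?_⟩
    rcases Nat.lt_succ_iff_lt_or_eq.1 h with h | h
    · exact .inl h
    · exact .inr ⟨Fin.ext h, j'.2⟩

open Classical in
theorem runs_greedy {s : State} (hs : Ready v y c κ s) (hκ : 0 ≤ κ) (hn : 2 ≤ n)
    (hL : ∀ i, s.mem (addr (.L i : Loc n m)) = if i ∈ L then 1 else 0)
    (hR : ∀ i, s.mem (addr (.R i : Loc n m)) = if i ∈ R then 1 else 0) :
    Runs ω greedy s (3 + (n * ((2 + (n * (m * 8 + 21) + 2) + 2) + 2) + 2)) fun s' =>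
      Frame (n := n) (m := m) [6, 7, 8, 12, 13, 14, 15] (workCells n m) s s' ∧
      GreedyState v (threshold κ n) L R (fun _ _ => True) s' := by
  refine Runs.mono (Runs.seq (R := fun s' =>
    Frame (n := n) (m := m) [6, 7, 8, 12, 13, 14, 15] (workCells n m) s s' ∧ s'.reg 12 = 0 ∧
    GreedyState v (threshold κ n) L R (fun _ _ => False) s') (Runs.block ?_) fun s₁ hs₁ =>
    Runs.forLoop (N := n) (T := 2 + (n * (m * 8 + 21) + 2) + 2) (Inv := fun k s' =>
      Frame (n := n) (m := m) [6, 7, 8, 12, 13, 14, 15] (workCells n m) s s' ∧ s'.reg 6 = k ∧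
      s'.reg 12 = k * m ∧ GreedyState v (threshold κ n) L R (fun i' _ => (i' : ℕ) < k) s')
      ?_ ?_ ?_) ?_ ?_
  · simp only [List.foldl, Instr.apply, State.setReg, State.setCell, hs.regs.r24]
    refine ⟨⟨?_, ?_⟩, ?_, ?_⟩
    · intro x hx
      simp at hx
      simp [hx]
    · intro l hl
      simp [workCells] at hl
      simp [hl]
    · simp
    · simp only [GreedyState]
      rw [Function.update_self, Rat.cast_zero]
      refine GreedyInv.start (fun i => ?_) fun i => ?_
      · simp [hL]
      · simp [hR]
  · obtain ⟨h1, h2, h3⟩ := hs₁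
    refine ⟨⟨?_, h1.mem⟩, ?_, ?_, ?_⟩
    · intro x hx
      have := h1.reg x hx
      simp at hx
      simpa [State.setReg, hx] using this
    · simp [State.setReg]
    · simp [State.setReg, h2]
    · exact GreedyInv.mono h3 fun i' j' h => by simp at h
  · rintro k s' ⟨h1, h2, -⟩
    exact ⟨h2, (h1.reg 0 (by decide)).trans hs.regs.r0⟩
  · rintro k s' ⟨h1, h2, h3, h4⟩
    have hr : Ready v y c κ s' := hs.of_frame h1
    refine Runs.seq (runs_greedyRow hr hκ hn h2 h3 h4) ?_
    rintro s₂ ⟨u1, u2⟩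
    have hf : Frame (n := n) (m := m) [6, 7, 8, 12, 13, 14, 15] (workCells n m) s s₂ :=
      h1.trans (u1.mono (by decide) subset_rfl)
    have hr₂ : Ready v y c κ s₂ := hs.of_frame hf
    refine Runs.block ?_
    simp only [List.foldl, Instr.apply, State.setReg]
    refine ⟨⟨?_, hf.mem⟩, ?_, ?_, u2⟩
    · intro x hx
      have := hf.reg x hx
      simp at hx
      simpa [hx] using this
    · have := u1.reg 6 (by decide)
      simp [this, h2, hr₂.regs.r5]
    · have := u1.reg 12 (by decide)
      simp [this, h3, hr₂.regs.r1, add_mul]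
  · simp
  · rintro s' ⟨h1, -, -, h4⟩
    exact ⟨h1, GreedyInv.mono h4 fun i' _ _ => i'.2⟩

/-- Cut at the thresholds in scratch cells `2` and `3`, and remove a maximal matching of short
pairs. -/
def cutAndMatch : Program :=
  .seq classify (.ite (.realLE 22 25) (.block []) (.ite (.realLE 23 25) (.block [])
    (.seq greedy (.ite (.realLE 24 26) (.block [.setNat 2 1]) (.block [])))))

/-- Register 2 stays 0 on every failing branch. On success the arrays left by `greedy` already are
the indicator vectors of the uncovered elements, so only the flag has to be set. -/
theorem runs_cutAndMatch {s : State} (hs : Ready v y c κ s) (hκ : 0 ≤ κ) (hn : 2 ≤ n) {a b : ℝ}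
    (ha : s.mem (addr (.sc 2 : Loc n m)) = a) (hb : s.mem (addr (.sc 3 : Loc n m)) = b)
    (hab : a < b) (h2 : s.reg 2 = 0) :
    Runs ω cutAndMatch s (100 * (n + m + 1) ^ 3) fun s' => Ready v y c κ s' ∧
      s'.reg 29 = s.reg 29 ∧ s'.reg 2 ≤ 1 ∧
      Outcome c (threshold κ n) v (below y a) (above y b) (output n s') := by
  refine Runs.mono (T := n * 14 + 5 +
    ((3 + (n * ((2 + (n * (m * 8 + 21) + 2) + 2) + 2) + 2)) + 3 + 1 + 1))
    (Runs.seq (runs_classify hs ha hb) ?_) ?_ fun _ h => h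
  · rintro s₁ ⟨h1, hL, hR, cL, cR⟩
    have hf₁ : Frame (n := n) (m := m) [6, 7, 8, 12, 13, 14, 15] (workCells n m) s s₁ :=
      h1.mono (by decide) subset_rfl
    have hr₁ : Ready v y c κ s₁ := hs.of_frame hf₁
    have t1 : (Test.realLE 22 25).Holds s₁ ↔ ((below y a).card : ℝ) ≤ c * n := by
      simp only [Test.Holds, State.cell, hr₁.regs.r22, hr₁.regs.r25, cL, hr₁.cn]
    have t2 : (Test.realLE 23 25).Holds s₁ ↔ ((above y b).card : ℝ) ≤ c * n := by
      simp only [Test.Holds, State.cell, hr₁.regs.r23, hr₁.regs.r25, cR, hr₁.cn]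
    have f2 : s₁.reg 2 = 0 := by rw [h1.reg 2 (by decide), h2]
    have f29 : s₁.reg 29 = s.reg 29 := h1.reg 29 (by decide)
    have hfail : ∀ s' : State, s'.reg 2 = 0 → output n s' = none := fun s' h => by
      simp [output, h]
    refine Runs.ite (fun b1 => (Runs.block ?_).mono (by simp) fun _ h => h) fun b1 =>
      Runs.ite (fun b2 => (Runs.block ?_).mono (by simp) fun _ h => h) fun b2 =>
        Runs.seq (runs_greedy hr₁ hκ hn hL hR) ?_
    · refine ⟨hr₁, f29, by simp [f2], ?_⟩
      rw [List.foldl_nil, hfail _ f2]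
      exact .small (.inl (t1.1 b1))
    · refine ⟨hr₁, f29, by simp [f2], ?_⟩
      rw [List.foldl_nil, hfail _ f2]
      exact .small (.inr (t2.1 b2))
    rintro s₂ ⟨u1, M, hM, hML, hMR, hMc, hmax⟩
    have hr₂ : Ready v y c κ s₂ := hs.of_frame (hf₁.trans u1)
    have g2 : s₂.reg 2 = 0 := by rw [u1.reg 2 (by decide), f2]
    have g29 : s₂.reg 29 = s.reg 29 := by rw [u1.reg 29 (by decide), f29]
    have t3 : (Test.realLE 24 26).Holds s₂ ↔ (M.card : ℝ) ≤ c / 2 * n := by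
      simp only [Test.Holds, State.cell, hr₂.regs.r24, hr₂.regs.r26, hMc, hr₂.half]
    have hmax' := GreedyInv.maximal hM fun i j => hmax i j trivial
    rw [t1, not_le] at b1
    rw [t2, not_le] at b2
    refine Runs.ite (T := 2) (fun b3 => Runs.block ?_) fun b3 =>
      (Runs.block ?_).mono (by simp) fun _ h => h
    · rw [t3] at b3
      simp only [List.foldl, Instr.apply, State.setReg]
      have hr₃ : Regs n m (Function.update s₂.reg 2 1) := hr₂.regs.update (by simp)
      refine ⟨{ hr₂ with regs := hr₃ }, by simp [g29], by simp, ?_⟩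
      have hLR := disjoint_below_above y hab
      have hML' : ∀ i, s₂.mem (addr (.L i : Loc n m)) = _ := hML
      have hMR' : ∀ i, s₂.mem (addr (.R i : Loc n m)) = _ := hMR
      convert Outcome.success M b1 b2 hmax' b3 using 1
      simp only [output, Function.update_self, one_ne_zero, if_false, hr₃.r3, hr₃.r4, lBase_add,
        rBase_add]
      congr 2
      · ext i
        rw [mem_uncovered_left_iff hLR hM, Finset.mem_filter, hML']
        simp only [Finset.mem_univ, true_and, ne_eq, ite_eq_right_iff, one_ne_zero, imp_false,
          not_not]
      · ext i
        rw [mem_uncovered_right_iff hLR hM, Finset.mem_filter, hMR']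
        simp only [Finset.mem_univ, true_and, ne_eq, ite_eq_right_iff, one_ne_zero, imp_false,
          not_not]
    · rw [t3, not_le] at b3
      refine ⟨hr₂, g29, by simp [g2], ?_⟩
      rw [List.foldl_nil, hfail _ g2]
      exact .largeMatching M b1 b2 hmax' b3
  -- The cubic term comes from n² pairs, each costing 8m + O(1) steps.
  · set S := n + m + 1 with hS
    have hn' : n ≤ S := by omega
    have hm' : m * 8 + 21 ≤ 21 * S := by omega
    have h1 : n * (m * 8 + 21) ≤ S * (21 * S) := Nat.mul_le_mul hn' hm'
    have hS1 : 1 ≤ S := by omega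
    have h2 : n * ((2 + (n * (m * 8 + 21) + 2) + 2) + 2) ≤ S * (21 * S ^ 2 + 8) :=
      Nat.mul_le_mul hn' (by nlinarith)
    have h3 : S ≤ S ^ 3 := Nat.le_self_pow (by norm_num) S
    have h4 : 1 ≤ S ^ 3 := Nat.one_le_pow _ _ hS1
    have h5 : S * (21 * S ^ 2 + 8) = 21 * S ^ 3 + 8 * S := by ring
    omega

end RealRAM

/-! ### Set-up, sampling, projections, and the two complete programs -/

namespace RealRAM

open ARV

variable {n m : ℕ} {ω : ℕ → ℝ}

/-- Compute the addresses of the memory layout. -/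
def setupRegs : Program :=
  .seq (.seq (.block [.setNat 5 1]) (.forLoop 6 0 (.block [.addNat 11 11 1])))
    (.block [.addNat 16 11 30, .addNat 17 16 5, .addNat 18 17 5, .addNat 19 18 5, .addNat 20 19 5,
      .addNat 21 20 5, .addNat 22 21 5, .addNat 23 22 5, .addNat 24 23 5, .addNat 25 24 5,
      .addNat 26 25 5, .addNat 27 26 5, .addNat 28 27 5, .addNat 9 28 5, .addNat 10 9 1,
      .addNat 3 10 0, .addNat 4 3 0])

variable (v : Fin n → EuclideanSpace ℝ (Fin m))

/-- Registers cannot be multiplied, so n * m arises by adding m repeatedly. That `drawn` is still 0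
is recorded so that the k-th sample will be `ω k`. -/
theorem runs_setupRegs :
    Runs ω setupRegs (input v) (n * 4 + 22) fun s => Regs n m s.reg ∧ s.reg 2 = 0 ∧
      s.mem = (input v).mem ∧ s.drawn = 0 := by
  refine Runs.mono (Runs.seq (Runs.seq (R := fun s => s.mem = (input v).mem ∧ s.drawn = 0 ∧
    s.reg 5 = 1 ∧ s.reg 11 = 0 ∧ s.reg 0 = n ∧ s.reg 1 = m ∧ s.reg 2 = 0 ∧ s.reg 30 = 0)
    (Runs.block ?_) fun s₁ hs₁ => Runs.forLoop (N := n) (T := 2) (Inv := fun k s =>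
      s.mem = (input v).mem ∧ s.drawn = 0 ∧ s.reg 5 = 1 ∧ s.reg 11 = k * m ∧ s.reg 0 = n ∧
      s.reg 1 = m ∧ s.reg 2 = 0 ∧ s.reg 30 = 0 ∧ s.reg 6 = k) ?_ ?_ ?_) ?_) (T := _ + 18) ?_
      fun _ h => h
  · simp only [List.foldl, Instr.apply, State.setReg]
    simp [input]
  · obtain ⟨h1, h2, h3, h4, h5, h6, h7, h8⟩ := hs₁
    simp [State.setReg, h1, h2, h3, h4, h5, h6, h7, h8]
  · rintro k s ⟨-, -, -, -, h, -, -, -, h'⟩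
    exact ⟨h', h⟩
  · rintro k s ⟨h1, h2, h3, h4, h5, h6, h7, h8, h9⟩
    refine Runs.block ?_
    simp only [List.foldl, Instr.apply, State.setReg]
    simp [h1, h2, h3, h4, h5, h6, h7, h8, h9, add_mul]
  · rintro s ⟨h1, h2, h3, h4, h5, h6, h7, h8, -⟩
    refine Runs.block ?_
    simp only [List.foldl, Instr.apply, State.setReg]
    refine ⟨?_, by simp [h7], h1, h2⟩
    constructor <;> simp [h3, h4, h5, h6, h8, addr, gBase, yBase, lBase, rBase]
  · simp; omega

/-- Register `7` receives the binary logarithm of `n`, rounded up. -/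
def logLoop : Program :=
  .seq (.block [.setNat 11 1, .setNat 7 0])
    (.forLoop 6 0 (.ite (.natLT 11 0) (.block [.addNat 11 11 11, .addNat 7 7 5]) (.block [])))

theorem clog_le_self (n : ℕ) : Nat.clog 2 n ≤ n :=
  Nat.clog_le_of_le_pow Nat.lt_two_pow_self.le

/-- Register 11 doubles until it reaches n while register 7 counts. Since `Nat.clog 2 n ≤ n`, n
rounds suffice; the surplus rounds do nothing, hence the `min` in the invariant. -/
theorem runs_logLoop {s : State} (hs : Regs n m s.reg) (h2 : s.reg 2 = 0) :
    Runs ω logLoop s (n * 6 + 5) fun s' => Regs n m s'.reg ∧ s'.reg 2 = 0 ∧ s'.mem = s.mem ∧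
      s'.drawn = s.drawn ∧ s'.reg 7 = Nat.clog 2 n := by
  refine Runs.mono (Runs.seq (R := fun s' => Regs n m s'.reg ∧ s'.reg 2 = 0 ∧ s'.mem = s.mem ∧
      s'.drawn = s.drawn ∧ s'.reg 11 = 1 ∧ s'.reg 7 = 0) (Runs.block ?_) fun s₁ hs₁ =>
    Runs.forLoop (N := n) (T := 4) (Inv := fun k s' => Regs n m s'.reg ∧ s'.reg 2 = 0 ∧
      s'.mem = s.mem ∧ s'.drawn = s.drawn ∧ s'.reg 6 = k ∧
      s'.reg 11 = 2 ^ min k (Nat.clog 2 n) ∧ s'.reg 7 = min k (Nat.clog 2 n)) ?_ ?_ ?_) ?_ ?_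
  · simp only [List.foldl, Instr.apply, State.setReg]
    exact ⟨(hs.update (by simp)).update (by simp), by simp [h2], trivial, trivial, by simp, by simp⟩
  · obtain ⟨h1, h2, h3, h4, h5, h6⟩ := hs₁
    exact ⟨h1.update (by simp), by simp [State.setReg, h2], h3, h4, by simp [State.setReg],
      by simp [State.setReg, h5], by simp [State.setReg, h6]⟩
  · rintro k s ⟨h1, -, -, -, h, -⟩
    exact ⟨h, h1.r0⟩
  · rintro k s ⟨h1, h2, h3, h4, h5, h6, h7⟩
    have ht : (Test.natLT 11 0).Holds s ↔ (k : ℕ) < Nat.clog 2 n := by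
      simp only [Test.Holds, h6, h1.r0]
      rcases lt_or_ge (k : ℕ) (Nat.clog 2 n) with h | h
      · rw [min_eq_left h.le]
        exact iff_of_true ((Nat.lt_clog_iff_pow_lt one_lt_two).1 h) h
      · rw [min_eq_right h]
        exact iff_of_false (not_lt.2 (Nat.le_pow_clog one_lt_two n)) (not_lt.2 h)
    refine Runs.ite (fun b => Runs.block ?_) fun b => (Runs.block ?_).mono (by simp) fun _ h => h
    · rw [ht] at b
      simp only [List.foldl, Instr.apply, State.setReg]
      refine ⟨((h1.update (by simp)).update (by simp)).update (by simp), by simp [h2], h3, h4,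
        by simp [h5, h1.r5], ?_, ?_⟩
      · simp [h6, min_eq_left b.le, min_eq_left (Nat.succ_le_of_lt b), pow_succ, mul_two]
      · simp [h7, min_eq_left b.le, min_eq_left (Nat.succ_le_of_lt b), h1.r5]
    · rw [ht, not_lt] at b
      simp only [List.foldl, State.setReg]
      refine ⟨h1.update (by simp), by simp [h2], h3, h4, by simp [h5, h1.r5], ?_, ?_⟩
      · simp [h6, min_eq_right b, min_eq_right (b.trans (Nat.le_succ _))]
      · simp [h7, min_eq_right b, min_eq_right (b.trans (Nat.le_succ _))]
  · simp; omega
  · rintro s' ⟨h1, h2, h3, h4, -, -, h7⟩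
    exact ⟨h1, h2, h3, h4, by rw [h7, min_eq_right (clog_le_self n)]⟩

/-- Compute the memory layout and the constants. -/
def setup (c κ : ℚ) : Program :=
  .seq setupRegs (.seq logLoop (.block [.setReal 20 1, .setReal 21 0, .ofNat 16 0, .setReal 25 c,
    .mul 25 25 16, .setReal 26 (c / 2), .mul 26 26 16, .ofNat 27 7, .setReal 28 (κ ^ 2)]))

theorem input_mem_data (i : Fin n) (k : Fin m) :
    (input v).mem (addr (.data i k : Loc n m)) = v i k := by
  have h : (⟨(i : ℕ) * m + k, mul_add_lt i k⟩ : Fin (n * m)) = finProdFinEquiv (i, k) := by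
    ext
    simp [finProdFinEquiv_apply_val]
    ring
  simp only [input, addr, mul_add_lt i k, dite_true, h, Equiv.symm_apply_apply]

theorem input_mem_y (i : Fin n) : (input v).mem (addr (.y i : Loc n m)) = 0 := by
  have h : ¬ (addr (.y i : Loc n m) < n * m) := by
    simp only [addr, yBase]; omega
  simp only [input, h, dite_false]

/-- The projection cells still hold their initial zeros, which makes `Ready` applicable with 0 for
the projections. -/
theorem runs_setup (c κ : ℚ) :
    Runs ω (setup c κ) (input v) (n * 10 + 37) fun s => Ready v 0 (c : ℝ) (κ : ℝ) s ∧
      s.reg 2 = 0 ∧ s.drawn = 0 := by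
  refine Runs.mono (T := n * 4 + 22 + (n * 6 + 5 + 10)) (Runs.seq (runs_setupRegs v) ?_) (by omega)
    fun _ h => h
  rintro s₁ ⟨h1, h2, h3, h4⟩
  refine Runs.seq (runs_logLoop h1 h2) ?_
  rintro s₂ ⟨u1, u2, u3, u4, u5⟩
  refine Runs.block ?_
  simp only [List.foldl, Instr.apply, State.setCell, State.cell]
  refine ⟨⟨u1, fun i k => ?_, fun i => ?_, ?_, ?_, ?_, ?_, ?_, ?_⟩, u2, u4.trans h4⟩ <;>
  simp only [u1.r16, u1.r20, u1.r21, u1.r25, u1.r26, u1.r27, u1.r28]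
  · simp [u3, h3, input_mem_data]
  · simp [u3, h3, input_mem_y]
  all_goals simp [u1.r0, u5]

/-- Draw the Gaussian vector. -/
def sampleLoop : Program := .forLoop 8 1 (.block [.addNat 14 9 8, .sample 14])

variable {v} {y : Fin n → ℝ} {c κ : ℝ}

theorem runs_sampleLoop {s : State} (hs : Regs n m s.reg) (hd : s.drawn = 0) :
    Runs ω sampleLoop s (m * 5 + 2) fun s' =>
      Frame (n := n) (m := m) [8, 14] (Set.range Loc.g) s s' ∧
      ∀ k : Fin m, s'.mem (addr (.g k : Loc n m)) = ω k := by
  refine Runs.mono (Runs.forLoop (N := m) (T := 3) (Inv := fun k s' =>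
    Frame (n := n) (m := m) [8, 14] (Set.range Loc.g) s s' ∧ s'.reg 8 = k ∧ s'.drawn = k ∧
    ∀ l : Fin m, (l : ℕ) < k → s'.mem (addr (.g l : Loc n m)) = ω l) ?_ ?_ ?_) le_rfl ?_
  · refine ⟨⟨fun x hx => ?_, fun _ _ => rfl⟩, by simp [State.setReg], hd, by simp⟩
    simp at hx
    simp [State.setReg, hx]
  · rintro k s' ⟨h1, h2, -⟩
    exact ⟨h2, (h1.reg 1 (by decide)).trans hs.r1⟩
  · rintro k s' ⟨h1, h2, h3, h4⟩
    have hr : Regs n m s'.reg := hs.congr fun x hx => h1.reg x fun h => hx (by simp at h ⊢; omega)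
    refine Runs.block ?_
    simp only [List.foldl, Instr.apply, State.setReg, State.setCell]
    refine ⟨⟨?_, ?_⟩, ?_, by simp [h3], ?_⟩
    · intro x hx
      have := h1.reg x hx
      simp at hx
      simpa [hx] using this
    · intro l hl
      have := h1.mem l hl
      simp at hl
      have hl' : l ≠ .g k := fun h => hl k h.symm
      simpa [Function.update_apply, hr.r9, h2, gBase_add, hl'] using this
    · simp [h2, hr.r5]
    · intro l hl
      by_cases hlk : l = k
      · simp [hr.r9, h2, gBase_add, hlk, h3]
      · have : (l : ℕ) ≠ k := fun h => hlk (Fin.ext h)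
        simp [hr.r9, h2, gBase_add, hlk, h4 l (by omega)]
  · rintro s' ⟨h1, -, -, h4⟩
    exact ⟨h1, fun k => h4 k k.2⟩

/-- Compute the projections of the input vectors to the Gaussian vector. -/
def projectLoop : Program :=
  .seq (.block [.setNat 12 0]) (.forLoop 6 0
    (.seq dotLoop (.block [.addNat 14 10 6, .copy 14 16, .addNat 12 12 1])))

theorem runs_projectLoop {s : State} (hs : Regs n m s.reg) :
    Runs ω projectLoop s (n * (m * 7 + 11) + 4) fun s' =>
      Frame (n := n) (m := m) [6, 8, 12, 14, 15] {l | l = .sc 0 ∨ l = .sc 1 ∨ ∃ i, l = .y i} s s' ∧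
      ∀ i : Fin n, s'.mem (addr (.y i : Loc n m))
        = ∑ k, s.mem (addr (.data i k : Loc n m)) * s.mem (addr (.g k : Loc n m)) := by
  refine Runs.mono (Runs.seq (R := fun s' => s'.mem = s.mem ∧ s'.reg 12 = 0 ∧
    ∀ x ≠ 12, s'.reg x = s.reg x) (Runs.block ?_) fun s₁ hs₁ =>
    Runs.forLoop (N := n) (T := m * 7 + 5 + 4) (Inv := fun k s' =>
      Frame (n := n) (m := m) [6, 8, 12, 14, 15] {l | l = .sc 0 ∨ l = .sc 1 ∨ ∃ i, l = .y i} s s' ∧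
      s'.reg 6 = k ∧ s'.reg 12 = k * m ∧ ∀ i : Fin n, (i : ℕ) < k →
        s'.mem (addr (.y i : Loc n m))
          = ∑ k, s.mem (addr (.data i k : Loc n m)) * s.mem (addr (.g k : Loc n m)))
      ?_ ?_ ?_) ?_ ?_
  · simp only [List.foldl, Instr.apply, State.setReg]
    refine ⟨trivial, by simp, fun x hx => ?_⟩
    simp [hx]
  · obtain ⟨h1, h2, h3⟩ := hs₁
    refine ⟨⟨?_, fun l _ => by simp [State.setReg, h1]⟩, ?_, ?_, by simp⟩
    · intro x hx
      simp at hx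
      simp [State.setReg, hx, h3]
    · simp [State.setReg]
    · simp [State.setReg, h2]
  · rintro k s' ⟨h1, h2, -⟩
    exact ⟨h2, (h1.reg 0 (by decide)).trans hs.r0⟩
  · rintro k s' ⟨h1, h2, h3, h4⟩
    have hr : Regs n m s'.reg := hs.congr fun x hx => h1.reg x fun h => hx (by simp at h ⊢; omega)
    refine Runs.seq (runs_dotLoop hr k h3) ?_
    rintro s'' ⟨u1, u2⟩
    have hf : Frame (n := n) (m := m) [6, 8, 12, 14, 15]
        {l | l = .sc 0 ∨ l = .sc 1 ∨ ∃ i, l = .y i} s s'' :=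
      h1.trans (u1.mono (by decide) (by rintro l (rfl | rfl) <;> simp))
    have hr' : Regs n m s''.reg := hs.congr fun x hx => hf.reg x fun h => hx (by simp at h ⊢; omega)
    have e6 : s''.reg 6 = k := (u1.reg 6 (by decide)).trans h2
    have e12 : s''.reg 12 = k * m := (u1.reg 12 (by decide)).trans h3
    refine Runs.block ?_
    simp only [List.foldl, Instr.apply, State.setReg, State.setCell, State.cell]
    refine ⟨⟨?_, ?_⟩, ?_, ?_, ?_⟩
    · intro x hx
      have := hf.reg x hx
      simp at hx
      simpa [hx] using this
    · intro l hl
      have := hf.mem l hl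
      simp at hl
      simpa [hr'.r10, e6, yBase_add, hl] using this
    · simp [e6, hr'.r5]
    · simp [e12, hr'.r1, add_mul]
    · intro i hi
      by_cases hik : i = k
      · subst hik
        simp only [hr'.r10, hr'.r16, e6, yBase_add, u2, Function.update_self, ne_eq, Nat.reduceEqDiff,
          not_false_eq_true, Function.update_of_ne]
        refine Finset.sum_congr rfl fun k _ => ?_
        rw [h1.mem _ (by simp), h1.mem _ (by simp)]
      · have hne : (i : ℕ) ≠ k := fun h => hik (Fin.ext h)
        have := u1.mem (.y i) (by simp)
        simp [hr'.r10, e6, yBase_add, hik, this, h4 i (by omega)]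
  · rw [show m * 7 + 5 + 4 + 2 = m * 7 + 11 by ring]
    simp only [List.length_cons, List.length_nil]
    omega
  · rintro s' ⟨h1, -, -, h4⟩
    exact ⟨h1, fun i => h4 i i.2⟩

/-- Set up, draw the Gaussian vector, and compute the projections. -/
def prelude (c κ : ℚ) : Program := .seq (setup c κ) (.seq sampleLoop projectLoop)

theorem runs_prelude (v : Fin n → EuclideanSpace ℝ (Fin m)) (c κ : ℚ) :
    Runs ω (prelude c κ) (input v) (100 * (n + m + 1) ^ 2) fun s =>
      Ready v (fun i => inner ℝ (v i) (gaussianVector m ω)) (c : ℝ) (κ : ℝ) s ∧ s.reg 2 = 0 := by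
  refine Runs.mono (Runs.seq (runs_setup v c κ) ?_) (T := _ + (m * 5 + 2 + (n * (m * 7 + 11) + 4)))
    ?_ fun _ h => h
  · rintro s₁ ⟨h1, h2, h3⟩
    refine Runs.seq (runs_sampleLoop h1.regs h3) ?_
    rintro s₂ ⟨u1, u2⟩
    have hr₂ : Regs n m s₂.reg :=
      h1.regs.congr fun x hx => u1.reg x fun h => hx (by simp at h ⊢; omega)
    refine Runs.mono (runs_projectLoop hr₂) le_rfl ?_
    rintro s₃ ⟨w1, w2⟩
    have hr₃ : Regs n m s₃.reg :=
      hr₂.congr fun x hx => w1.reg x fun h => hx (by simp at h ⊢; omega)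
    have hmem : ∀ l : Loc n m, l ≠ .sc 0 → l ≠ .sc 1 → (∀ i, l ≠ .y i) → (∀ k, l ≠ .g k) →
        s₃.mem (addr l) = s₁.mem (addr l) := by
      intro l l1 l2 l3 l4
      rw [w1.mem l (by simp [l1, l2, l3]), u1.mem l (by simpa using fun k h => l4 k h.symm)]
    refine ⟨⟨hr₃, fun i k => ?_, fun i => ?_, ?_, ?_, ?_, ?_, ?_, ?_⟩, ?_⟩
    · rw [hmem _ (by simp) (by simp) (by simp) (by simp), h1.data]
    · rw [w2, PiLp.inner_apply]
      refine Finset.sum_congr rfl fun k _ => ?_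
      rw [u1.mem _ (by simp), h1.data, u2]
      simp [gaussianVector, mul_comm]
    · rw [hmem _ (by simp) (by simp) (by simp) (by simp), h1.one]
    · rw [hmem _ (by simp) (by simp) (by simp) (by simp), h1.zero]
    · rw [hmem _ (by simp) (by simp) (by simp) (by simp), h1.cn]
    · rw [hmem _ (by simp) (by simp) (by simp) (by simp), h1.half]
    · rw [hmem _ (by simp) (by simp) (by simp) (by simp), h1.ell]
    · rw [hmem _ (by simp) (by simp) (by simp) (by simp), h1.kap]
    · rw [w1.reg 2 (by decide), u1.reg 2 (by decide), h2]
  · nlinarith [Nat.zero_le n, Nat.zero_le m, Nat.zero_le (n * m)]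

/-- Cut at the thresholds `-1` and `1`. -/
def roundingProgram (c κ : ℚ) : Program :=
  .seq (prelude c κ) (.seq (.block [.setReal 18 (-1), .setReal 19 1]) cutAndMatch)

theorem runs_roundingProgram (v : Fin n → EuclideanSpace ℝ (Fin m)) {c κ : ℚ} (hκ : 0 ≤ κ)
    (hn : 2 ≤ n) :
    Runs ω (roundingProgram c κ) (input v) (300 * (n + m + 1) ^ 4) fun s =>
      AlgorithmResult c (threshold κ n) v (gaussianVector m ω) (output n s) := by
  have hκ' : (0 : ℝ) ≤ κ := by exact_mod_cast hκ
  refine Runs.mono (Runs.seq (runs_prelude v c κ) ?_)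
    (T := _ + (3 + 100 * (n + m + 1) ^ 3)) ?_ fun _ h => h
  · rintro s₁ ⟨h1, h2⟩
    refine Runs.seq (R := fun s' => Ready v (fun i => inner ℝ (v i) (gaussianVector m ω)) (c : ℝ)
      (κ : ℝ) s' ∧ s'.reg 2 = 0 ∧ s'.mem (addr (.sc 2 : Loc n m)) = -1 ∧
      s'.mem (addr (.sc 3 : Loc n m)) = 1) (Runs.block ?_) ?_
    · simp only [List.foldl, Instr.apply, State.setCell]
      have hr := h1.regs
      refine ⟨⟨hr, fun i k => ?_, fun i => ?_, ?_, ?_, ?_, ?_, ?_, ?_⟩, h2, ?_, ?_⟩ <;>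
      simp only [hr.r18, hr.r19]
      · simp [h1.data]
      · simp [h1.y]
      · simp [h1.one]
      · simp [h1.zero]
      · simp [h1.cn]
      · simp [h1.half]
      · simp [h1.ell]
      · simp [h1.kap]
      · simp
      · simp
    · rintro s₂ ⟨u1, u2, u3, u4⟩
      refine Runs.mono (runs_cutAndMatch u1 hκ' hn u3 u4 (by norm_num) u2) le_rfl ?_
      rintro s₃ ⟨-, -, -, w⟩
      exact algorithmResult_iff_outcome.2 w
  · have h1 : 1 ≤ n + m + 1 := by omega
    have h2 := Nat.pow_le_pow_right h1 (show 2 ≤ 4 by norm_num)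
    have h3 := Nat.pow_le_pow_right h1 (show 3 ≤ 4 by norm_num)
    have h4 := Nat.one_le_pow 4 _ h1
    omega

/-- Try the projection of every input vector as the lower threshold until one succeeds. -/
def searchProgram (c κ : ℚ) : Program :=
  .seq (prelude c κ) (.forLoop 29 0 (.ite (.natLT 2 5)
    (.seq (.block [.addNat 14 10 29, .copy 18 14, .add 19 18 20]) cutAndMatch) (.block [])))

theorem Ready.setReg {s : State} (h : Ready v y c κ s) {x k : ℕ}
    (hx : x ∈ [2, 6, 7, 8, 11, 12, 13, 14, 15, 29]) : Ready v y c κ (s.setReg x k) :=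
  { h with regs := h.regs.update hx }

theorem output_setReg {s : State} {x k : ℕ} (h2 : 2 ≠ x) (h3 : 3 ≠ x) (h4 : 4 ≠ x) :
    output n (s.setReg x k) = output n s := by
  simp [output, State.setReg, h2, h3, h4]

/-- Total failure carries a failing `Outcome` for each cut, so a single cut that cannot fail
excludes it. After a success the flag makes the remaining rounds idle, which preserves the output.
-/
theorem runs_searchProgram (v : Fin n → EuclideanSpace ℝ (Fin m)) {c κ : ℚ} (hκ : 0 ≤ κ)
    (hn : 2 ≤ n) {y : Fin n → ℝ} (hy : y = fun i => inner ℝ (v i) (gaussianVector m ω)) :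
    Runs ω (searchProgram c κ) (input v) (300 * (n + m + 1) ^ 4) fun s =>
      (∀ i, Outcome c (threshold κ n) v (below y (y i)) (above y (y i + 1)) none) ∨
      ∃ i o, output n s = some o ∧
        Outcome c (threshold κ n) v (below y (y i)) (above y (y i + 1)) (some o) := by
  have hκ' : (0 : ℝ) ≤ κ := by exact_mod_cast hκ
  refine Runs.mono (Runs.seq (runs_prelude v c κ) fun s₁ hs₁ => Runs.forLoop (N := n)
    (T := 4 + 100 * (n + m + 1) ^ 3 + 1) (Inv := fun k s => Ready v y (c : ℝ) (κ : ℝ) s ∧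
      s.reg 29 = k ∧ ((s.reg 2 = 0 ∧ ∀ i : Fin n, (i : ℕ) < k →
        Outcome c (threshold κ n) v (below y (y i)) (above y (y i + 1)) none) ∨
      (s.reg 2 = 1 ∧ ∃ i o, output n s = some o ∧
        Outcome c (threshold κ n) v (below y (y i)) (above y (y i + 1)) (some o)))) ?_ ?_ ?_) ?_ ?_
  · rw [← hy] at hs₁
    exact ⟨hs₁.1.setReg (by simp), by simp [State.setReg], .inl ⟨by simp [State.setReg, hs₁.2],
      by simp⟩⟩
  · rintro k s ⟨h1, h2, -⟩
    exact ⟨h2, h1.regs.r0⟩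
  · rintro k s ⟨h1, h2, h3⟩
    have ht : (Test.natLT 2 5).Holds s ↔ s.reg 2 = 0 := by
      simp only [Test.Holds, h1.regs.r5, Nat.lt_one_iff]
    refine Runs.ite (fun b => ?_) fun b => (Runs.block ?_).mono (by simp; omega) fun _ h => h
    · rw [ht] at b
      have h3' := (h3.resolve_right fun h => by simp [b] at h).2
      refine Runs.seq (R := fun s' => Ready v y (c : ℝ) (κ : ℝ) s' ∧ s'.reg 2 = 0 ∧
        s'.reg 29 = k ∧ s'.mem (addr (.sc 2 : Loc n m)) = y k ∧
        s'.mem (addr (.sc 3 : Loc n m)) = y k + 1) (Runs.block ?_) ?_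
      · simp only [List.foldl, Instr.apply, State.setReg, State.setCell, State.cell]
        have hr : Regs n m (Function.update s.reg 14 (s.reg 10 + s.reg 29)) :=
          h1.regs.update (by simp)
        have e14 : s.reg 10 + s.reg 29 = addr (.y k : Loc n m) := by
          rw [h1.regs.r10, h2, yBase_add]
        refine ⟨⟨hr, fun i k => ?_, fun i => ?_, ?_, ?_, ?_, ?_, ?_, ?_⟩, by simp [b],
          by simp [h2], ?_, ?_⟩ <;>
        simp only [Function.update_self, e14] <;>
        simp only [ne_eq, Nat.reduceEqDiff, not_false_eq_true, Function.update_of_ne, h1.regs.r18,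
          h1.regs.r19, h1.regs.r20]
        · simp [h1.data]
        · simp [h1.y]
        · simp [h1.one]
        · simp [h1.zero]
        · simp [h1.cn]
        · simp [h1.half]
        · simp [h1.ell]
        · simp [h1.kap]
        · simp [h1.y]
        · simp [h1.y, h1.one]
      · rintro s₂ ⟨u1, u2, u3, u4, u5⟩
        refine Runs.mono (runs_cutAndMatch u1 hκ' hn u4 u5 (by linarith) u2) le_rfl ?_
        rintro s₃ ⟨w1, w2, w3, w4⟩
        refine ⟨w1.setReg (by simp), by simp [State.setReg, w2, u3, w1.regs.r5], ?_⟩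
        rw [output_setReg (by norm_num) (by norm_num) (by norm_num)]
        rcases Nat.le_one_iff_eq_zero_or_eq_one.1 w3 with h | h
        · left
          refine ⟨by simp [State.setReg, h], fun i hi => ?_⟩
          rcases Nat.lt_succ_iff_lt_or_eq.1 hi with h' | h'
          · exact h3' i h'
          · obtain rfl := Fin.ext h'
            have ho : output n s₃ = none := by simp [output, h]
            rwa [ho] at w4
        · right
          obtain ⟨o, ho⟩ : ∃ o, output n s₃ = some o := ⟨_, by
            rw [output, if_neg (by simp [h])]⟩
          exact ⟨by simp [State.setReg, h], k, o, ho, by rwa [ho] at w4⟩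
    · rw [ht] at b
      have h3' := h3.resolve_left fun h => b h.1
      rw [List.foldl_nil]
      refine ⟨h1.setReg (by simp), by simp [State.setReg, h2, h1.regs.r5], .inr ?_⟩
      rw [output_setReg (by norm_num) (by norm_num) (by norm_num)]
      exact ⟨by simp [State.setReg, h3'.1], h3'.2⟩
  · have hS : 1 ≤ n + m + 1 := by omega
    have hn' : n ≤ n + m + 1 := by omega
    have h2 := Nat.pow_le_pow_right hS (show 2 ≤ 4 by norm_num)
    have h3 := Nat.pow_le_pow_right hS (show 1 ≤ 4 by norm_num)
    have h4 := Nat.one_le_pow 4 _ hS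
    have h5 : n * (4 + 100 * (n + m + 1) ^ 3 + 1 + 2)
        ≤ (n + m + 1) * (4 + 100 * (n + m + 1) ^ 3 + 1 + 2) := Nat.mul_le_mul_right _ hn'
    have h6 : (n + m + 1) * (4 + 100 * (n + m + 1) ^ 3 + 1 + 2)
        = 100 * (n + m + 1) ^ 4 + 7 * (n + m + 1) := by ring
    have h7 := h5.trans h6.le
    rw [pow_one] at h3
    linarith
  · rintro s ⟨-, -, ⟨-, h⟩ | ⟨-, h⟩⟩
    · exact .inl fun i => h i i.2
    · exact .inr h

end RealRAM

/-! ### Choice of the constants and conclusion -/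

namespace ARV

open RealRAM MeasureTheory

variable {n m : ℕ}

/-- An event of probability at least `p`, minus a set of directions of measure at most `p / 2`. -/
theorem half_le_samples_real {p : ℝ} {G : Set (ℕ → ℝ)} {B : Set (EuclideanSpace ℝ (Fin m))}
    {S : Set (ℕ → ℝ)} (hG : p ≤ samples.real G)
    (hB : (ProbabilityTheory.stdGaussian (EuclideanSpace ℝ (Fin m))).real B ≤ p / 2)
    (hS : ∀ ω ∈ G, gaussianVector m ω ∉ B → ω ∈ S) : p / 2 ≤ samples.real S := by
  have h1 : samples.real G ≤ samples.real (S ∪ {ω | gaussianVector m ω ∈ B}) :=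
    measureReal_mono fun ω hω => by
      by_cases h : gaussianVector m ω ∈ B
      exacts [.inr h, .inl (hS ω hω h)]
  -- The union bound holds for outer measures, so no event here has to be measurable.
  have h2 := measureReal_union_le (μ := samples) S {ω | gaussianVector m ω ∈ B}
  have h3 := samples_real_gaussianVector_le B
  linarith

/-- Rational constants for which cutting at two thresholds at distance `1` gives no large matching
of short pairs. -/
theorem exists_rat_constants {p : ℝ} (hp : 0 < p) :
    ∃ c κ : ℚ, 0 < c ∧ (c : ℝ) ≤ p ∧ 0 < κ ∧
      ∀ (n m : ℕ) (v : Fin n → EuclideanSpace ℝ (Fin m)), 2 ≤ n → TriangleIneq v →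
        (ProbabilityTheory.stdGaussian (EuclideanSpace ℝ (Fin m))).real
          (stretchSet v (threshold κ n) 1 (c / 2)) ≤ p / 2 := by
  -- Programs contain only rational constants, and both c and κ may be lowered. The bound κ' depends
  -- on c, because a large matching means more than (c/2)n pairs.
  obtain ⟨c, hc, hcp⟩ := exists_rat_btwn hp
  obtain ⟨κ', hκ', h⟩ := exists_stretchSet_le one_pos (half_pos hc) (half_pos hp)
  obtain ⟨κ, hκ, hκκ'⟩ := exists_rat_btwn hκ'
  refine ⟨c, κ, by exact_mod_cast hc, hcp.le, by exact_mod_cast hκ, fun n m v hn hv => ?_⟩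
  refine h (Fin n) m v _ (by simpa using hn) hv ?_
  rw [Fintype.card_fin]
  refine (threshold_le hκ.le hn).trans ?_
  gcongr

/-- The running time bound, as a polynomial. -/
noncomputable def timeBound : Polynomial ℕ := Polynomial.C 300 * (Polynomial.X + 1) ^ 4

theorem timeBound_eval (k : ℕ) : timeBound.eval k = 300 * (k + 1) ^ 4 := by
  simp [timeBound]

end ARV

theorem mainTheorem2 :
    -- a polynomial-time randomized algorithm exists
    (∃ (P : RealRAM.Program) (T : Polynomial ℕ) (c p : ℝ) (Δ : ℕ → ℝ),
      0 < c ∧ 0 < p ∧ ARV.ThetaInvSqrtLog Δ ∧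
      ∀ (n m : ℕ) (v : Fin n → EuclideanSpace ℝ (Fin m)),
        0 < n → ARV.Spread v → ARV.TriangleIneq v →
        (∀ ω : ℕ → ℝ, ∃ o, RealRAM.Outputs P v ω (T.eval (n + m)) o) ∧
        p ≤ RealRAM.samples.real
          {ω | ∃ L R : Finset (Fin n),
            RealRAM.Outputs P v ω (T.eval (n + m)) (some (L, R)) ∧
            c * n ≤ L.card ∧ c * n ≤ R.card ∧ ARV.Separated v (Δ n) L R}) ∧
    -- if the triangle inequality includes the origin, then hyperplane rounding with
    -- thresholds `±1` and removal of a maximal matching of short pairs is such an algorithm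
    (∃ (P : RealRAM.Program) (T : Polynomial ℕ) (c p : ℝ) (Δ : ℕ → ℝ),
      0 < c ∧ 0 < p ∧ ARV.ThetaInvSqrtLog Δ ∧
      ∀ (n m : ℕ) (v : Fin n → EuclideanSpace ℝ (Fin m)),
        0 < n → ARV.Spread v → ARV.TriangleIneq (ARV.withOrigin v) →
        (∀ ω : ℕ → ℝ, ∃ o, RealRAM.Outputs P v ω (T.eval (n + m)) o ∧
          ARV.AlgorithmResult c (Δ n) v (ARV.gaussianVector m ω) o) ∧
        (∀ (g : EuclideanSpace ℝ (Fin m)) (L R : Finset (Fin n)),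
          ARV.AlgorithmResult c (Δ n) v g (some (L, R)) →
          c / 2 * n ≤ L.card ∧ c / 2 * n ≤ R.card ∧ ARV.Separated v (Δ n) L R) ∧
        p ≤ RealRAM.samples.real
          {ω | ∀ o, ARV.AlgorithmResult c (Δ n) v (ARV.gaussianVector m ω) o → o ≠ none}) := by
  constructor
  · obtain ⟨p, hp, hlarge⟩ := ARV.exists_prob_threshold
    obtain ⟨c, κ, hc, hcp, hκ, hsmall⟩ := ARV.exists_rat_constants hp
    have hc' : (0 : ℝ) < c := by exact_mod_cast hc
    refine ⟨RealRAM.searchProgram c κ, ARV.timeBound, c / 2, p / 2, ARV.threshold κ, by positivity,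
      by positivity, ARV.thetaInvSqrtLog_threshold (by exact_mod_cast hκ), fun n m v hn hv ht => ?_⟩
    have hn2 := hv.two_le hn
    rw [ARV.timeBound_eval]
    refine ⟨fun ω => ?_, ?_⟩
    · obtain ⟨t, s, h1, h2, -⟩ := RealRAM.runs_searchProgram (ω := ω) (c := c) v hκ.le hn2 rfl
      exact ⟨_, t, s, h1, h2, rfl⟩
    · refine ARV.half_le_samples_real (hlarge n m v hn hv) (hsmall n m v hn2 ht) ?_
      rintro ω ⟨i, hL, hR⟩ hω
      have hcn : (c : ℝ) * n ≤ p * n := by gcongr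
      -- The cut at i cannot fail, so the search succeeds somewhere, possibly at another j;
      -- `Outcome.spec` applies to any successful cut.
      obtain ⟨t, s, h1, h2, h | ⟨j, ⟨L, R⟩, h3, h4⟩⟩ :=
        RealRAM.runs_searchProgram (ω := ω) (c := c) v hκ.le hn2 rfl
      · exact absurd rfl (ARV.Outcome.ne_none one_pos le_rfl hω (hcn.trans_lt hL)
          (hcn.trans_lt hR) (h i))
      · exact ⟨L, R, ⟨t, s, h1, h2, h3⟩, h4.spec (ARV.disjoint_below_above _ (lt_add_one _))⟩
  · obtain ⟨p, hp, hlarge⟩ := ARV.exists_prob_large_sides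
    obtain ⟨c, κ, hc, hcp, hκ, hsmall⟩ := ARV.exists_rat_constants hp
    have hc' : (0 : ℝ) < c := by exact_mod_cast hc
    refine ⟨RealRAM.roundingProgram c κ, ARV.timeBound, c, p / 2, ARV.threshold κ, hc',
      by positivity, ARV.thetaInvSqrtLog_threshold (by exact_mod_cast hκ), fun n m v hn hv ht => ?_⟩
    have hn2 := hv.two_le hn
    rw [ARV.timeBound_eval]
    refine ⟨fun ω => ?_, fun g L R h => ?_, ?_⟩
    · obtain ⟨t, s, h1, h2, h3⟩ := RealRAM.runs_roundingProgram (ω := ω) (c := c) v hκ.le hn2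
      exact ⟨_, ⟨t, s, h1, h2, rfl⟩, h3⟩
    · rw [ARV.algorithmResult_iff_outcome, ARV.leftSet_eq_below, ARV.rightSet_eq_above] at h
      exact h.spec (ARV.disjoint_below_above _ (by norm_num))
    · refine ARV.half_le_samples_real (hlarge n m v hn hv ht)
        (hsmall n m v hn2 fun i j k => ht (some i) (some j) (some k)) ?_
      rintro ω ⟨hL, hR⟩ hω o ho
      have hcn : (c : ℝ) * n ≤ p * n := by gcongr
      rw [ARV.algorithmResult_iff_outcome, ARV.leftSet_eq_below, ARV.rightSet_eq_above] at ho
      -- The levels -1 and 1 differ by 2, more than the stretch 1 that is needed.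
      exact ARV.Outcome.ne_none one_pos (by norm_num) hω (hcn.trans_lt hL) (hcn.trans_lt hR) ho
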